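/- Let $[D]=\{1,\dots,D\}$. The histogram of $z=(z_1,\dots,z_n)\in[D]^n$ is $h_j=|\{i: z_i=j\}|$ for $j\in[D]$, and its anonymized histogram $\mathbf n=(n^{(1)},\dots,n^{(D)})$ lists the $h_j$ in non-increasing order. Two sequences of the same length are neighboring if they differ in at most one entry. A randomized map $M$ is $(\varepsilon,\delta)$-DP if $\Pr[M(S)\in E]\le e^{\varepsilon}\Pr[M(S')\in E]+\delta$ for all neighboring $S,S'$ and all events $E$; $\varepsilon$-DP means $(\varepsilon,0)$-DP. *Pan-private model.* A streaming algorithm has a random initial internal state, a randomized state update for each arriving element, and an output computed (possibly with randomness) from the state. It is $\varepsilon$-DP in the pan-private model if for every $t\ge 0$ the internal state after $t$ steps is $\varepsilon$-DP as a function of the first $t$ elements of the stream. *Shuffle model (with public randomness).* A public random seed, drawn independently of the data, is known to everybody. Each of the $n$ users applies the same local randomizer (depending on the seed), with independent private randomness, to their own input and sends a multiset of messages. The shuffler outputs the randomly permuted collection of all messages, i.e. their multiset, and the analyzer computes the output from the seed and this multiset. The protocol is $(\varepsilon,\delta)$-DP if for every value of the seed the output of the shuffler is $(\varepsilon,\delta)$-DP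 as a function of the inputs of the $n$ users. **Corollary.** There are a constant $c>0$ and a function $g$ such that for every $\varepsilon>0$ and all integers $n,D\ge 0$ the following hold. 1. There is an algorithm that is $\varepsilon$-DP in the pan-private model and, on every stream $z\in[D]^n$ of length $n$, outputs after the $n$ steps an anonymized histogram $\hat{\mathbf n}$ (a non-increasing vector in $\mathbb Z_{\ge0}^D$) with $$\mathbb E\,\|\hat{\mathbf n}-\mathbf n\|_1\le g(\varepsilon)\sqrt n\,\log^c(n+2)\quad\text{and}\quad \mathbb E\,\|\hat{\mathbf n}-\mathbf n\|_2^2\le g(\varepsilon)\sqrt n\,\log^c(n+2).$$ 2. For every $\delta\in(0,1]$ there is an $n$-user protocol that is $(\varepsilon,\delta)$-DP in the shuffle model and whose output $\hat{\mathbf n}$ satisfies the same two bounds on every $z\in[D]^n$. Here $c$ and $g$ do not depend on $n$, $D$, $\delta$ or the data. The algorithm and the protocol may depend on $n$, $D$, $\varepsilon$ (and, for the protocol, $\delta$). -/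

import Mathlib

open scoped ENNReal

noncomputable section

namespace AnonymizedHistogram

/-! ### Histograms and anonymized histograms -/

/-- The histogram of a dataset `z` with entries in a domain of size `D`:
`histogram z j` is the number of users whose input is the item `j`. -/
def histogram {n D : ℕ} (z : Fin n → Fin D) (j : Fin D) : ℕ :=
  (Finset.univ.filter fun i => z i = j).card

/-- Anonymized histograms over a domain of size `D`: non-increasing vectors of `D` natural
numbers, i.e. histograms without their item labels. -/
def AnonHist (D : ℕ) : Type := {v : Fin D → ℕ // Antitone v}

/-- The anonymized histogram of `h`: the entries of `h` sorted in non-increasing order. The sorting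
permutation `Tuple.sort h` is increasing, so it is read backwards. -/
def anonymize {D : ℕ} (h : Fin D → ℕ) : AnonHist D :=
  ⟨fun l => h (Tuple.sort h (Fin.rev l)), fun _ _ hab =>
    Tuple.monotone_sort h (Fin.rev_le_rev.mpr hab)⟩

/-- The `ℓ₁`-error `∑ j, |u j - v j|`. -/
def l1Error {D : ℕ} (u v : AnonHist D) : ℝ := ∑ j, |(u.1 j : ℝ) - (v.1 j : ℝ)|

/-- The `ℓ₂²`-error `∑ j, (u j - v j) ^ 2`. -/
def l2SqError {D : ℕ} (u v : AnonHist D) : ℝ := ∑ j, ((u.1 j : ℝ) - (v.1 j : ℝ)) ^ 2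

/-- The expectation of a nonnegative function `f` of a random outcome with law `p`, as an extended
nonnegative real (so `∞` when the series diverges). -/
def expect {α : Type*} (p : PMF α) (f : α → ℝ) : ℝ≥0∞ := ∑' a, p a * ENNReal.ofReal (f a)

/-! ### Differential privacy -/

/-- Two datasets of the same size are neighboring if they agree outside one index. -/
def Neighboring {n : ℕ} {Z : Type*} (S S' : Fin n → Z) : Prop :=
  ∃ i, ∀ j, j ≠ i → S j = S' j

/-- `(ε, δ)`-differential privacy of a randomized algorithm `M` on datasets of size `n`. -/
def IsDP {n : ℕ} {Z R : Type*} (ε δ : ℝ) (M : (Fin n → Z) → PMF R) : Prop :=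
  ∀ S S' : Fin n → Z, Neighboring S S' → ∀ E : Set R,
    (M S).toOuterMeasure E ≤
      ENNReal.ofReal (Real.exp ε) * (M S').toOuterMeasure E + ENNReal.ofReal δ

/-! ### The pan-private model -/

/-- A randomized streaming algorithm on a stream of elements of `Z`: a random initial internal
state, a randomized update for each arriving element, and a randomized output computed from the
internal state. -/
structure StreamAlgorithm (Z Out : Type) where
  State : Type
  init : PMF State
  step : State → Z → PMF State
  output : State → PMF Out

namespace StreamAlgorithm

variable {Z Out : Type}

/-- The law of the internal state after the elements of a finite stream have been processed. -/
def stateAfter (A : StreamAlgorithm Z Out) (zs : List Z) : PMF A.State :=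
  zs.foldl (fun μ z => μ.bind fun s => A.step s z) A.init

/-- The law of the output after the stream `S 0, …, S (n - 1)`. -/
def run (A : StreamAlgorithm Z Out) {n : ℕ} (S : Fin n → Z) : PMF Out :=
  (A.stateAfter (List.ofFn S)).bind A.output

/-- `ε`-DP in the pan-private model (event level): streams have unbounded length, and after any
number `t` of steps the internal state is `ε`-DP as a function of the first `t` elements. -/
def IsPanPrivate (A : StreamAlgorithm Z Out) (ε : ℝ) : Prop :=
  ∀ t : ℕ, IsDP ε 0 fun S : Fin t → Z => A.stateAfter (List.ofFn S)

end StreamAlgorithm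

/-! ### The shuffle model -/

/-- Independent runs of a local randomizer on each input in a list. -/
def runAll {Z M : Type} (R : Z → PMF (Multiset M)) : List Z → PMF (List (Multiset M))
  | [] => PMF.pure []
  | z :: zs => (R z).bind fun m => (runAll R zs).map fun ms => m :: ms

/-- The shuffler. A uniformly random ordering of the messages of all users carries exactly the
information of the multiset of all messages, so the output is that multiset: it does not show
which message was sent by whom. -/
def shuffler {M : Type} (ms : List (Multiset M)) : Multiset M := ms.sum

/-- A one-round protocol in the shuffle model with public randomness. A public random seed (for
instance a hash function), drawn independently of the data, is known to everybody; each user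
applies the same local randomizer to their own input with fresh private randomness and sends a
multiset of messages; the analyzer sees the seed and the shuffled messages of all users. -/
structure ShuffleProtocol (Z Out : Type) where
  Seed : Type
  seed : PMF Seed
  Msg : Type
  randomizer : Seed → Z → PMF (Multiset Msg)
  analyzer : Seed → Multiset Msg → PMF Out

namespace ShuffleProtocol

variable {Z Out : Type}

/-- The law of the output of the shuffler when the public seed is `r`. -/
def shuffled (P : ShuffleProtocol Z Out) (r : P.Seed) {n : ℕ} (S : Fin n → Z) :
    PMF (Multiset P.Msg) :=
  (runAll (P.randomizer r) (List.ofFn S)).map shuffler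

/-- The law of the output of the protocol. -/
def run (P : ShuffleProtocol Z Out) {n : ℕ} (S : Fin n → Z) : PMF Out :=
  P.seed.bind fun r => (P.shuffled r S).bind (P.analyzer r)

/-- `(ε, δ)`-DP in the shuffle model with `n` users: for each value of the public seed, the output
of the shuffler is `(ε, δ)`-DP. -/
def IsShuffleDP (P : ShuffleProtocol Z Out) (n : ℕ) (ε δ : ℝ) : Prop :=
  ∀ r : P.Seed, IsDP ε δ fun S : Fin n → Z => P.shuffled r S

end ShuffleProtocol

/-- A mechanism on datasets of `n` items of a domain of size `D`, whose output is an anonymized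
histogram, has expected `ℓ₁`-error and expected `ℓ₂²`-error at most `b` on each dataset. -/
def ErrorAtMost {n D : ℕ} (M : (Fin n → Fin D) → PMF (AnonHist D)) (b : ℝ) : Prop :=
  ∀ z : Fin n → Fin D,
    expect (M z) (l1Error (anonymize (histogram z))) ≤ ENNReal.ofReal b ∧
    expect (M z) (l2SqError (anonymize (histogram z))) ≤ ENNReal.ofReal b

end AnonymizedHistogram

end

/-!
Both mechanisms keep the same table. Two random hash functions place each item in one of
`(n + 1) ^ 4` buckets of a first table and in one of `16 (n + 1)` buckets of a second one, and each
bucket holds the number of users hashed to it plus the difference of two independent geometric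
variables with ratio `q = exp (-ε / 4)`. Replacing one input changes four buckets by one unit each,
so the noisy table is `ε`-private (`close_tableOf`, `hidesShift_dlap`).

* A stream is processed by starting from pure noise and adding each item to its two buckets. The
  state is then the noisy table of the elements so far, at every time
  (`stateAfter_panAlgorithm`), so the algorithm is pan-private.
* In the shuffle model the geometric law is split into the shares of the `n` users, as it is
  infinitely divisible (`exists_nconv_eq_geo`). A user sends the positive and the negative part of
  their row as two kinds of messages. The difference of the two totals is the noisy count; their
  common size is hidden as each user floods both kinds with the same number of messages, uniform
  on `{0, …, K}`. This costs `O (1 / K)` in `δ`, and the flooding cancels in the difference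
  (`hidesShift_floodedPair`, `run_shuffleProtocol`). So `δ` does not enter the error.

It remains to estimate the anonymized histogram from the noisy table. The noise is inverted by a
second order difference operator: `denoise q f` at a noisy count is an unbiased and bounded
estimator of `f` at the count (`integral_denoise`), and the variances of independent buckets add up
(`expect_sq_sum_denoise_le`). With `T` of order `log n / ε`, counts are treated as follows.

* Light counts, at most `T`. The second table has only `O (n)` buckets, so for each root of unity
  `u` the sum of `u ^ load` over its buckets is estimated with error `O (√n)`. Its mean over the
  hash function is the product `charProd`, with variance `O (n)` (`sum_hash_sq_le`). Collisions are
  not rare here, but the product determines the character sum `∑ j, (u ^ h j - 1)` up to a constant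
  since its logarithm is well conditioned (`norm_charSum_sub_le`), and Fourier inversion over the
  roots of unity of order `n + 1` recovers the number of items of each positive count
  (`numEq_eq_sum_charSum`, `abs_numEq_sub_le`).
* Heavy counts, above `T`. The first table has no collisions with high probability. The estimator
  of the number of buckets with count at least `r` has variance exponentially small in the distance
  of each bucket from `r`, so empty buckets do not matter, and the variances weighted by `r` add up
  to `O (n)` over all `r`; hence the errors add up to `O (√n log n)` (`expect_heavyStat_le`).

The output is a histogram of total `n` whose statistics are closest to those of the table, among
those whose sorted entries agree up to `T` with the noisy counts of the first table. By the triangle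
inequality its `ℓ₁`-error is at most of order `T ^ 2` times the error of the statistics
(`l1Error_le_statistics`), and as each of its entries is off by at most `2 T` the `ℓ₂²`-error is
only larger by another factor `2 T`. Collisions and large noise in the first table have
probability `O (n ^ (-2))`, while the errors never exceed `2 n ^ 2` (`expect_errors_le`).
-/

noncomputable section

namespace AnonymizedHistogram

/-! ### Products and convolutions of probability mass functions -/

theorem tsum_pi_prod_fin {α : Type*} : ∀ (m : ℕ) (f : Fin m → α → ℝ≥0∞),
    ∑' x : Fin m → α, ∏ i, f i (x i) = ∏ i, ∑' a, f i a
  | 0, f => by simp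
  | m + 1, f => by
    rw [← (Fin.consEquiv fun _ => α).tsum_eq, ENNReal.tsum_prod', Fin.prod_univ_succ,
      ← tsum_pi_prod_fin m fun i => f i.succ, ← ENNReal.tsum_mul_right]
    refine tsum_congr fun a => ?_
    rw [← ENNReal.tsum_mul_left]
    refine tsum_congr fun x => ?_
    simp [Fin.prod_univ_succ, Fin.consEquiv]

theorem tsum_pi_prod {ι α : Type*} [Fintype ι] (f : ι → α → ℝ≥0∞) :
    ∑' x : ι → α, ∏ i, f i (x i) = ∏ i, ∑' a, f i a := by
  have e := Fintype.equivFin ι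
  rw [← (e.symm.arrowCongr (Equiv.refl α)).tsum_eq, ← e.symm.prod_comp,
    ← tsum_pi_prod_fin _ fun i => f (e.symm i)]
  refine tsum_congr fun x => ?_
  rw [← e.symm.prod_comp]
  simp [Equiv.arrowCongr]

/-- The law of a family of independent random variables with laws `p i`. -/
def piPMF {ι α : Type*} [Fintype ι] (p : ι → PMF α) : PMF (ι → α) :=
  ⟨fun x => ∏ i, p i (x i), by
    rw [ENNReal.summable.hasSum_iff, tsum_pi_prod]
    simp⟩

theorem piPMF_apply {ι α : Type*} [Fintype ι] (p : ι → PMF α) (x : ι → α) :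
    piPMF p x = ∏ i, p i (x i) := rfl

theorem piPMF_bind {ι α β : Type*} [Fintype ι] (p : ι → PMF α) (k : ι → α → PMF β) :
    piPMF (fun i => (p i).bind (k i)) = (piPMF p).bind fun a => piPMF fun i => k i (a i) := by
  ext x
  simp only [piPMF_apply, PMF.bind_apply]
  rw [← tsum_pi_prod fun i a => p i a * k i a (x i)]
  simp [Finset.prod_mul_distrib]

theorem piPMF_pure {ι α : Type*} [Fintype ι] (a : ι → α) :
    piPMF (fun i => PMF.pure (a i)) = PMF.pure a := by
  classical
  ext x
  simp [piPMF_apply, PMF.pure_apply, Finset.prod_ite_zero, funext_iff]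

theorem piPMF_map {ι α β : Type*} [Fintype ι] (p : ι → PMF α) (k : ι → α → β) :
    piPMF (fun i => (p i).map (k i)) = (piPMF p).map fun a i => k i (a i) := by
  simp only [PMF.map, Function.comp_def]
  rw [piPMF_bind p fun i a => PMF.pure (k i a)]
  simp [piPMF_pure]

/-- The law of a pair of independent random variables. -/
def pairPMF {α β : Type*} (p : PMF α) (p' : PMF β) : PMF (α × β) :=
  p.bind fun a => p'.map fun b => (a, b)

/-- The law of the sum of `n` independent random variables with law `p`. -/
def nconv {α : Type*} [AddCommMonoid α] (p : PMF α) : ℕ → PMF α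
  | 0 => PMF.pure 0
  | n + 1 => p.bind fun a => (nconv p n).map (a + ·)

theorem nconv_map {α β : Type*} [AddCommMonoid α] [AddCommMonoid β] (φ : α →+ β) (p : PMF α)
    (n : ℕ) : nconv (p.map φ) n = (nconv p n).map φ := by
  induction n with
  | zero => simp [nconv, PMF.pure_map]
  | succ n ih =>
    rw [nconv, ih, nconv]
    simp only [PMF.map, PMF.bind_bind, PMF.pure_bind, Function.comp_def, map_add]

theorem nconv_pairPMF {α β : Type*} [AddCommMonoid α] [AddCommMonoid β] (p : PMF α) (p' : PMF β)
    (n : ℕ) : nconv (pairPMF p p') n = pairPMF (nconv p n) (nconv p' n) := by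
  induction n with
  | zero => simp [nconv, pairPMF, PMF.map]; rfl
  | succ n ih =>
    rw [nconv, ih, nconv, nconv]
    simp only [pairPMF, PMF.map, PMF.bind_bind, PMF.pure_bind, Function.comp_def, Prod.mk_add_mk]
    refine congrArg _ (funext fun a => ?_)
    rw [PMF.bind_comm]

theorem nconv_piPMF {ι α : Type*} [Fintype ι] [AddCommMonoid α] (p : PMF α) (n : ℕ) :
    nconv (piPMF fun _ : ι => p) n = piPMF fun _ => nconv p n := by
  induction n with
  | zero => simp only [nconv]; exact (piPMF_pure _).symm
  | succ n ih =>
    simp only [nconv, ih]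
    rw [piPMF_bind (fun _ : ι => p) fun _ a => (nconv p n).map (a + ·)]
    refine congrArg _ (funext fun a => ?_)
    rw [piPMF_map (fun _ : ι => nconv p n) fun i b => a i + b]
    rfl

/-! ### Expectations of nonnegative functions -/

theorem expect_mono {α : Type*} (p : PMF α) {f g : α → ℝ} (h : ∀ a, f a ≤ g a) :
    expect p f ≤ expect p g :=
  ENNReal.tsum_le_tsum fun a => by gcongr; exact h a

theorem expect_map {α β : Type*} (p : PMF α) (k : α → β) (f : β → ℝ) :
    expect (p.map k) f = expect p (f ∘ k) := by
  classical
  simp only [expect, PMF.map_apply, ← ENNReal.tsum_mul_right]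
  rw [ENNReal.tsum_comm]
  refine tsum_congr fun a => ?_
  rw [tsum_eq_single (k a) fun b hb => by simp [hb]]
  simp

theorem expect_bind {α β : Type*} (p : PMF α) (k : α → PMF β) (f : β → ℝ) :
    expect (p.bind k) f = ∑' a, p a * expect (k a) f := by
  simp only [expect, PMF.bind_apply, ← ENNReal.tsum_mul_right, ← ENNReal.tsum_mul_left]
  rw [ENNReal.tsum_comm]
  simp [mul_assoc]

theorem expect_add {α : Type*} (p : PMF α) {f g : α → ℝ} (hf : ∀ a, 0 ≤ f a) (hg : ∀ a, 0 ≤ g a) :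
    expect p (fun a => f a + g a) = expect p f + expect p g := by
  simp only [expect, ← ENNReal.tsum_add, ← mul_add]
  exact tsum_congr fun a => by rw [ENNReal.ofReal_add (hf a) (hg a)]

theorem expect_const_mul {α : Type*} (p : PMF α) {c : ℝ} (hc : 0 ≤ c) (f : α → ℝ) :
    expect p (fun a => c * f a) = ENNReal.ofReal c * expect p f := by
  simp only [expect, ← ENNReal.tsum_mul_left]
  exact tsum_congr fun a => by rw [ENNReal.ofReal_mul hc]; ring

theorem expect_const {α : Type*} (p : PMF α) (c : ℝ) :
    expect p (fun _ => c) = ENNReal.ofReal c := by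
  simp [expect, ENNReal.tsum_mul_right]

theorem expect_sum {α κ : Type*} (p : PMF α) (s : Finset κ) {f : κ → α → ℝ}
    (hf : ∀ k a, 0 ≤ f k a) :
    expect p (fun a => ∑ k ∈ s, f k a) = ∑ k ∈ s, expect p (f k) := by
  classical
  induction s using Finset.induction_on with
  | empty => simp [expect]
  | insert k s hk ih =>
    simp only [Finset.sum_insert hk, ← ih]
    exact expect_add p (hf k) fun a => Finset.sum_nonneg fun k _ => hf k a

theorem expect_indicator {α : Type*} (p : PMF α) (E : Set α) :
    expect p (E.indicator fun _ => 1) = p.toOuterMeasure E := by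
  classical
  rw [PMF.toOuterMeasure_apply]
  exact tsum_congr fun a => by by_cases h : a ∈ E <;> simp [h]

/-! ### Approximate domination of laws -/

/-- `p` is dominated by `C` times `p'` up to an excess of total mass at most `δ`. For laws on a
discrete space this is the pointwise form of the inequality in `(log C, δ)`-differential privacy. -/
def Close {α : Type*} (C δ : ℝ≥0∞) (p p' : PMF α) : Prop :=
  ∃ η : α → ℝ≥0∞, ∑' a, η a ≤ δ ∧ ∀ a, p a ≤ C * p' a + η a

namespace Close

variable {α β : Type*}

theorem toOuterMeasure_le {C δ : ℝ≥0∞} {p p' : PMF α} (h : Close C δ p p') (E : Set α) :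
    p.toOuterMeasure E ≤ C * p'.toOuterMeasure E + δ := by
  obtain ⟨η, hη, h⟩ := h
  rw [PMF.toOuterMeasure_apply, PMF.toOuterMeasure_apply, ← ENNReal.tsum_mul_left]
  refine le_trans ?_ (add_le_add_right hη _)
  rw [← ENNReal.tsum_add]
  refine ENNReal.tsum_le_tsum fun a => ?_
  by_cases ha : a ∈ E
  · simpa [ha] using h a
  · simp [ha]

theorem of_le {C : ℝ≥0∞} {p p' : PMF α} (h : ∀ a, p a ≤ C * p' a) : Close C 0 p p' :=
  ⟨0, by simp, by simpa using h⟩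

theorem mono {C δ C' δ' : ℝ≥0∞} {p p' : PMF α} (h : Close C δ p p') (hC : C ≤ C') (hδ : δ ≤ δ') :
    Close C' δ' p p' := by
  obtain ⟨η, hη, h⟩ := h
  exact ⟨η, hη.trans hδ, fun a => (h a).trans (by gcongr)⟩

theorem trans {C δ C' δ' : ℝ≥0∞} {p p' p'' : PMF α} (h : Close C δ p p') (h' : Close C' δ' p' p'') :
    Close (C * C') (δ + C * δ') p p'' := by
  obtain ⟨η, hη, h⟩ := h
  obtain ⟨η', hη', h'⟩ := h'
  refine ⟨fun a => η a + C * η' a, ?_, fun a => ?_⟩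
  · rw [ENNReal.tsum_add, ENNReal.tsum_mul_left]
    gcongr
  · refine (h a).trans ?_
    calc C * p' a + η a ≤ C * (C' * p'' a + η' a) + η a := by gcongr; exact h' a
      _ = _ := by ring

theorem bind_left {C δ : ℝ≥0∞} {p p' : PMF α} (h : Close C δ p p') (k : α → PMF β) :
    Close C δ (p.bind k) (p'.bind k) := by
  obtain ⟨η, hη, h⟩ := h
  refine ⟨fun b => ∑' a, η a * k a b, ?_, fun b => ?_⟩
  · rw [ENNReal.tsum_comm]
    simpa [ENNReal.tsum_mul_left] using hη
  · rw [PMF.bind_apply, PMF.bind_apply, ← ENNReal.tsum_mul_left, ← ENNReal.tsum_add]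
    refine ENNReal.tsum_le_tsum fun a => ?_
    calc p a * k a b ≤ (C * p' a + η a) * k a b := by gcongr; exact h a
      _ = _ := by ring

theorem map {C δ : ℝ≥0∞} {p p' : PMF α} (h : Close C δ p p') (k : α → β) :
    Close C δ (p.map k) (p'.map k) := h.bind_left _

theorem bind_right {C δ : ℝ≥0∞} (p : PMF α) {k k' : α → PMF β} (h : ∀ a, Close C δ (k a) (k' a)) :
    Close C δ (p.bind k) (p.bind k') := by
  choose η hη h using h
  refine ⟨fun b => ∑' a, p a * η a b, ?_, fun b => ?_⟩
  · rw [ENNReal.tsum_comm]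
    simp only [ENNReal.tsum_mul_left]
    calc ∑' a, p a * ∑' b, η a b ≤ ∑' a, p a * δ := by gcongr with a; exact hη a
      _ = δ := by rw [ENNReal.tsum_mul_right, p.tsum_coe, one_mul]
  · rw [PMF.bind_apply, PMF.bind_apply, ← ENNReal.tsum_mul_left, ← ENNReal.tsum_add]
    refine ENNReal.tsum_le_tsum fun a => ?_
    calc p a * k a b ≤ p a * (C * k' a b + η a b) := by gcongr; exact h a b
      _ = _ := by ring

/-- Changing the law of one of several independent coordinates. -/
theorem piPMF_update {ι : Type*} [Fintype ι] [DecidableEq ι] {C δ : ℝ≥0∞} (p p' : ι → PMF α)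
    (i : ι) (hi : Close C δ (p i) (p' i)) (hne : ∀ j, j ≠ i → p j = p' j) :
    Close C δ (piPMF p) (piPMF p') := by
  obtain ⟨η, hη, h⟩ := hi
  refine ⟨fun x => ∏ j, (if j = i then η else p' j) (x j), ?_, fun x => ?_⟩
  · rw [tsum_pi_prod fun j => (if j = i then η else p' j), Finset.prod_eq_single i]
    · simpa using hη
    · intro j _ hj
      simp [hj]
    · simp
  · have hp : ∀ q : ι → α → ℝ≥0∞, (∀ j, j ≠ i → q j = p' j) →
        ∏ j, q j (x j) = q i (x i) * ∏ j ∈ Finset.univ.erase i, p' j (x j) := fun q hq => by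
      rw [← Finset.mul_prod_erase _ _ (Finset.mem_univ i)]
      congr 1
      exact Finset.prod_congr rfl fun j hj => by rw [hq j (Finset.ne_of_mem_erase hj)]
    rw [piPMF_apply, piPMF_apply, hp (fun j => p j) fun j hj => by rw [hne j hj],
      hp (fun j => p' j) fun _ _ => rfl]
    beta_reduce
    rw [hp (fun j => if j = i then η else p' j) fun j hj => by simp [hj]]
    simp only [if_true]
    calc _ ≤ (C * p' i (x i) + η (x i)) * ∏ j ∈ Finset.univ.erase i, p' j (x j) := by
          gcongr; exact h _
      _ = _ := by ring

end Close

/-! ### Geometric noise and its infinite divisibility -/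

/-- The geometric law with ratio `q`: the value `k` has probability `(1 - q) q ^ k`. -/
def geo (q : Set.Ioo (0 : ℝ) 1) : PMF ℕ :=
  ⟨fun k => ENNReal.ofReal ((1 - q) * (q : ℝ) ^ k), by
    have h := (hasSum_geometric_of_lt_one q.2.1.le q.2.2).mul_left (1 - (q : ℝ))
    rw [mul_inv_cancel₀ (by linarith [q.2.2])] at h
    rw [ENNReal.summable.hasSum_iff, ← ENNReal.ofReal_tsum_of_nonneg (fun k =>
      mul_nonneg (by linarith [q.2.2]) (pow_nonneg q.2.1.le k)) h.summable, h.tsum_eq,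
      ENNReal.ofReal_one]⟩

theorem geo_apply (q : Set.Ioo (0 : ℝ) 1) (k : ℕ) :
    geo q k = ENNReal.ofReal ((1 - q) * (q : ℝ) ^ k) := rfl

theorem multichoose_nonneg {r : ℝ} (hr : 0 ≤ r) (k : ℕ) : 0 ≤ Ring.multichoose r k := by
  have h := Ring.factorial_nsmul_multichoose_eq_ascPochhammer r k
  rw [nsmul_eq_mul, Polynomial.ascPochhammer_smeval_eq_eval] at h
  rcases hr.eq_or_lt with rfl | hr
  · cases k with
    | zero => simp
    | succ k => simp [Ring.multichoose_zero_succ]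
  · have h2 := ascPochhammer_pos k r hr
    rw [← h] at h2
    exact (pos_of_mul_pos_right h2 (by positivity)).le

/-- The Vandermonde identity for rising factorials, which is the one for binomial coefficients at
negative arguments. -/
theorem multichoose_add (r s : ℝ) (k : ℕ) :
    Ring.multichoose (r + s) k =
      ∑ x ∈ Finset.HasAntidiagonal.antidiagonal k,
        Ring.multichoose r x.1 * Ring.multichoose s x.2 := by
  have hneg : ∀ (t : ℝ) (m : ℕ), Ring.choose (-t) m = (-1) ^ m * Ring.multichoose t m := by
    intro t m
    rw [Ring.choose_neg', Units.smul_def, zsmul_eq_mul]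
    simp [Int.negOnePow_def]
  have h := Ring.add_choose_eq k (Commute.all (-r) (-s))
  rw [← neg_add, hneg] at h
  have h1 : ∀ x ∈ Finset.HasAntidiagonal.antidiagonal k,
      Ring.choose (-r) x.1 * Ring.choose (-s) x.2 =
        (-1) ^ k * (Ring.multichoose r x.1 * Ring.multichoose s x.2) := fun x hx => by
    rw [hneg, hneg, ← Finset.HasAntidiagonal.mem_antidiagonal.1 hx, pow_add]
    ring
  rw [Finset.sum_congr rfl h1, ← Finset.mul_sum] at h
  exact mul_left_cancel₀ (by simp) h

/-- The weights `(1 - q) ^ r * multichoose r k * q ^ k` of the negative binomial law with real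
parameter `r`. -/
def negBinWeight (q r : ℝ) (k : ℕ) : ℝ := (1 - q) ^ r * Ring.multichoose r k * q ^ k

theorem negBinWeight_nonneg (q : Set.Ioo (0 : ℝ) 1) {r : ℝ} (hr : 0 ≤ r) (k : ℕ) :
    0 ≤ negBinWeight q r k := by
  have := q.2.1
  have := q.2.2
  exact mul_nonneg (mul_nonneg (Real.rpow_nonneg (by linarith) _) (multichoose_nonneg hr k))
    (by positivity)

/-- Convolution of negative binomial weights adds the parameters. -/
theorem negBinWeight_add (q : Set.Ioo (0 : ℝ) 1) {r s : ℝ} (hr : 0 ≤ r) (hs : 0 ≤ s) (k : ℕ) :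
    ENNReal.ofReal (negBinWeight q (r + s) k) = ∑ x ∈ Finset.HasAntidiagonal.antidiagonal k,
      ENNReal.ofReal (negBinWeight q r x.1) * ENNReal.ofReal (negBinWeight q s x.2) := by
  have h : negBinWeight q (r + s) k =
      ∑ x ∈ Finset.HasAntidiagonal.antidiagonal k, negBinWeight q r x.1 * negBinWeight q s x.2 := by
    rw [negBinWeight, multichoose_add, Real.rpow_add (by linarith [q.2.2]), Finset.mul_sum,
      Finset.sum_mul]
    refine Finset.sum_congr rfl fun x hx => ?_
    rw [negBinWeight, negBinWeight, ← Finset.HasAntidiagonal.mem_antidiagonal.1 hx, pow_add]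
    ring
  rw [h, ENNReal.ofReal_sum_of_nonneg fun x _ => mul_nonneg (negBinWeight_nonneg q hr _)
    (negBinWeight_nonneg q hs _)]
  exact Finset.sum_congr rfl fun x _ => ENNReal.ofReal_mul (negBinWeight_nonneg q hr _)

/-- The Cauchy product of nonnegative series. -/
theorem tsum_antidiagonal (f g : ℕ → ℝ≥0∞) :
    ∑' k, ∑ x ∈ Finset.HasAntidiagonal.antidiagonal k, f x.1 * g x.2 = (∑' k, f k) * ∑' k, g k := by
  rw [← ENNReal.tsum_mul_right]
  simp only [← ENNReal.tsum_mul_left]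
  rw [← ENNReal.tsum_prod, ← Finset.HasAntidiagonal.sigmaAntidiagonalEquivProd.tsum_eq,
    ENNReal.tsum_sigma']
  refine tsum_congr fun k => ?_
  rw [← Finset.tsum_subtype]
  rfl

theorem negBinWeight_one (q : ℝ) (k : ℕ) : negBinWeight q 1 k = (1 - q) * q ^ k := by
  simp [negBinWeight, Ring.multichoose_one]

theorem negBinWeight_zero (q : ℝ) (k : ℕ) : negBinWeight q 0 k = if k = 0 then 1 else 0 := by
  cases k with
  | zero => simp [negBinWeight]
  | succ k => simp [negBinWeight, Ring.multichoose_zero_succ]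

theorem map_add_left_apply (p : PMF ℕ) (i k : ℕ) :
    p.map (i + ·) k = if i ≤ k then p (k - i) else 0 := by
  rw [PMF.map_apply]
  split_ifs with hi
  · refine (tsum_eq_single (k - i) fun b hb => if_neg (by omega)).trans (if_pos (by omega))
  · exact ENNReal.tsum_eq_zero.2 fun b => if_neg (by omega)

theorem nconv_succ_apply (p : PMF ℕ) (n k : ℕ) :
    nconv p (n + 1) k =
      ∑ x ∈ Finset.HasAntidiagonal.antidiagonal k, p x.1 * nconv p n x.2 := by
  rw [nconv, PMF.bind_apply, tsum_eq_sum (s := Finset.range (k + 1)),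
    Finset.Nat.sum_antidiagonal_eq_sum_range_succ_mk]
  · refine Finset.sum_congr rfl fun i hi => ?_
    rw [map_add_left_apply, if_pos (by simpa [Nat.lt_succ_iff] using hi)]
  · intro i hi
    rw [map_add_left_apply, if_neg (by simpa [Nat.lt_succ_iff] using hi), mul_zero]

/-- The geometric law is infinitely divisible: it is the law of a sum of `n` independent
negative binomial variables with parameter `1 / n`. -/
theorem exists_nconv_eq_geo (q : Set.Ioo (0 : ℝ) 1) {n : ℕ} (hn : n ≠ 0) :
    ∃ p : PMF ℕ, nconv p n = geo q := by
  have hr : (0 : ℝ) ≤ 1 / n := by positivity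
  -- The total mass `t m` of the weights with parameter `m / n` is multiplicative and `t n = 1`.
  have hpow : ∀ m : ℕ, ∑' k, ENNReal.ofReal (negBinWeight q (m * (1 / n)) k) =
      (∑' k, ENNReal.ofReal (negBinWeight q (1 / n) k)) ^ m := by
    intro m
    induction m with
    | zero =>
      simp only [Nat.cast_zero, zero_mul, negBinWeight_zero, pow_zero]
      rw [tsum_eq_single 0 fun k hk => by simp [hk]]
      simp
    | succ m ih =>
      rw [pow_succ, ← ih, ← tsum_antidiagonal]
      push_cast
      rw [add_mul, one_mul]
      exact tsum_congr fun k => negBinWeight_add q (by positivity) hr k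
  have hone : ∑' k, ENNReal.ofReal (negBinWeight q (1 / n) k) = 1 := by
    have h := hpow n
    rw [mul_one_div_cancel (by positivity)] at h
    simp only [negBinWeight_one] at h
    have h1 : ∑' k, ENNReal.ofReal ((1 - q) * (q : ℝ) ^ k) = 1 := (geo q).tsum_coe
    rw [h1] at h
    exact (ENNReal.pow_right_strictMono hn).injective (by simpa using h.symm)
  let p : PMF ℕ := ⟨fun k => ENNReal.ofReal (negBinWeight q (1 / n) k),
    ENNReal.summable.hasSum_iff.2 hone⟩
  have hconv : ∀ m k : ℕ, nconv p m k = ENNReal.ofReal (negBinWeight q (m * (1 / n)) k) := by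
    intro m
    induction m with
    | zero =>
      intro k
      simp only [nconv, PMF.pure_apply, Nat.cast_zero, zero_mul, negBinWeight_zero]
      split_ifs <;> simp
    | succ m ih =>
      intro k
      rw [nconv_succ_apply]
      push_cast
      rw [add_mul, one_mul, add_comm, negBinWeight_add q hr (by positivity)]
      exact Finset.sum_congr rfl fun x _ => by rw [ih]; rfl
  refine ⟨p, PMF.ext fun k => ?_⟩
  rw [hconv, mul_one_div_cancel (by positivity), negBinWeight_one, geo_apply]

/-! ### Noise laws that hide a unit shift -/

/-- Adding `u` to a variable with law `p` is hidden up to a factor `C` and an excess `δ`. -/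
def HidesShift {α : Type*} [Add α] (C δ : ℝ≥0∞) (p : PMF α) (u : α) : Prop :=
  Close C δ p (p.map (u + ·)) ∧ Close C δ (p.map (u + ·)) p

/-- `q⁻¹` as an extended nonnegative real. -/
def ratioInv (q : Set.Ioo (0 : ℝ) 1) : ℝ≥0∞ := ENNReal.ofReal (q : ℝ)⁻¹

/-- Domination in one direction only: the shifted law never takes the value `0`, so the converse
fails. -/
theorem close_geo_shift (q : Set.Ioo (0 : ℝ) 1) :
    Close (ratioInv q) 0 ((geo q).map (1 + ·)) (geo q) := by
  refine Close.of_le fun k => ?_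
  have hq := q.2.1
  rw [map_add_left_apply]
  cases k with
  | zero => simp
  | succ k =>
    rw [if_pos (by omega), Nat.add_sub_cancel, geo_apply, geo_apply, ratioInv,
      ← ENNReal.ofReal_mul (by positivity)]
    refine ENNReal.ofReal_le_ofReal (le_of_eq ?_)
    field_simp
    ring

/-- The law of a pair of independent geometric variables. -/
def geoPair (q : Set.Ioo (0 : ℝ) 1) : PMF (ℕ × ℕ) := pairPMF (geo q) (geo q)

/-- The two-sided noise `X - Y` with `X`, `Y` independent and geometric. -/
def dlap (q : Set.Ioo (0 : ℝ) 1) : PMF ℤ := (geoPair q).map fun x => (x.1 : ℤ) - x.2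

theorem close_geoPair_shift_left (q : Set.Ioo (0 : ℝ) 1) :
    Close (ratioInv q) 0 ((geoPair q).map ((1, 0) + ·)) (geoPair q) := by
  have h := (close_geo_shift q).bind_left fun a => (geo q).map fun b => (a, b)
  rw [PMF.map, PMF.bind_bind] at h
  convert h using 1
  · simp [geoPair, pairPMF, PMF.map, PMF.bind_bind, Function.comp_def]
  · rfl

theorem close_geoPair_shift_right (q : Set.Ioo (0 : ℝ) 1) :
    Close (ratioInv q) 0 ((geoPair q).map ((0, 1) + ·)) (geoPair q) := by
  have h := Close.bind_right (geo q) fun a => (close_geo_shift q).map fun b => (a, b)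
  convert h using 1
  · simp [geoPair, pairPMF, PMF.map, PMF.bind_bind, Function.comp_def]
  · rfl

/-- The pair `(X + 1, Y + 1)` is dominated by `(X + 1, Y)`. -/
theorem close_geoPair_shift_both (q : Set.Ioo (0 : ℝ) 1) :
    Close (ratioInv q) 0 ((geoPair q).map ((1, 1) + ·)) ((geoPair q).map ((1, 0) + ·)) := by
  have h := (close_geoPair_shift_right q).map ((1, 0) + ·)
  rw [PMF.map_comp] at h
  convert h using 2
  ext x <;> simp

/-- In a difference a shift of `X` by `1` is the same as a shift of `Y` by `-1`, so the one-sided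
dominations of the two geometric laws combine to a two-sided one. -/
theorem hidesShift_dlap (q : Set.Ioo (0 : ℝ) 1) : HidesShift (ratioInv q) 0 (dlap q) 1 := by
  have h1 := (close_geoPair_shift_left q).map fun x => (x.1 : ℤ) - x.2
  have h2 := (close_geoPair_shift_both q).map fun x => (x.1 : ℤ) - x.2
  simp only [PMF.map_comp] at h1 h2
  constructor
  · rw [dlap, PMF.map_comp]
    convert h2 using 2
    · ext x; simp
    · ext x; simp; ring
  · rw [dlap, PMF.map_comp]
    convert h1 using 2
    ext x; simp; ring

/-! ### Noise of the shuffle protocol -/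

/-- The uniform law on `{0, …, K}`. -/
def unifUpTo (K : ℕ) : PMF ℕ :=
  PMF.uniformOfFinset (Finset.range (K + 1)) Finset.nonempty_range_add_one

/-- The only excess is at the value `0`. -/
theorem close_unifUpTo_shift (K : ℕ) :
    Close 1 ((K + 1 : ℕ) : ℝ≥0∞)⁻¹ (unifUpTo K) ((unifUpTo K).map (1 + ·)) := by
  refine ⟨fun k => if k = 0 then ((K + 1 : ℕ) : ℝ≥0∞)⁻¹ else 0, by simp, fun k => ?_⟩
  rw [map_add_left_apply]
  cases k with
  | zero => rw [unifUpTo, PMF.uniformOfFinset_apply]; simp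
  | succ k =>
    rw [if_pos (by omega), Nat.add_sub_cancel]
    rw [unifUpTo, PMF.uniformOfFinset_apply, PMF.uniformOfFinset_apply]
    by_cases h : k < K
    · simp [h, h.le]
    · simp [h]

theorem close_nconv_shift {p : PMF ℕ} {δ : ℝ≥0∞} (h : Close 1 δ p (p.map (1 + ·))) {n : ℕ}
    (hn : n ≠ 0) : Close 1 δ (nconv p n) ((nconv p n).map (1 + ·)) := by
  obtain ⟨m, rfl : n = m + 1⟩ := Nat.exists_eq_succ_of_ne_zero hn
  have h' := h.bind_left fun a => (nconv p m).map (a + ·)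
  convert h' using 1
  · rfl
  · simp only [nconv, PMF.map, PMF.bind_bind, PMF.pure_bind, Function.comp_def, add_assoc]

/-- The noise of one bucket in the shuffle protocol: a pair of independent variables with law `p`,
to both of which the same flooding variable with law `p'` is added. -/
def floodedPair (p p' : PMF ℕ) : PMF (ℕ × ℕ) :=
  (pairPMF (pairPMF p p) p').map fun x => x.1 + (x.2, x.2)

theorem nconv_floodedPair (p p' : PMF ℕ) (n : ℕ) :
    nconv (floodedPair p p') n = floodedPair (nconv p n) (nconv p' n) := by
  let φ : (ℕ × ℕ) × ℕ →+ ℕ × ℕ :=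
    { toFun := fun x => x.1 + (x.2, x.2)
      map_zero' := rfl
      map_add' := fun x y => by ext <;> simp <;> ring }
  have h := nconv_map φ (pairPMF (pairPMF p p) p') n
  rw [nconv_pairPMF, nconv_pairPMF] at h
  exact h

theorem map_sub_floodedPair (q : Set.Ioo (0 : ℝ) 1) (p' : PMF ℕ) :
    ((floodedPair (geo q) p').map fun x => (x.1 : ℤ) - x.2) = dlap q := by
  simp [floodedPair, dlap, geoPair, pairPMF, PMF.map, PMF.bind_bind, Function.comp_def]

/-- Flooding hides the joint shift of both coordinates, which turns the one-sided domination of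
`close_geoPair_shift_left` into a two-sided one. -/
theorem hidesShift_floodedPair (q : Set.Ioo (0 : ℝ) 1) {p' : PMF ℕ} {δ : ℝ≥0∞}
    (h : Close 1 δ p' (p'.map (1 + ·))) :
    HidesShift (ratioInv q) δ (floodedPair (geo q) p') (1, 0) := by
  have key : ∀ u : ℕ × ℕ, (floodedPair (geo q) p').map (u + ·) =
      ((geoPair q).map (u + ·)).bind fun x => p'.map fun z => x + (z, z) := by
    intro u
    simp [floodedPair, geoPair, pairPMF, PMF.map, PMF.bind_bind, Function.comp_def, add_assoc]
  have key0 : floodedPair (geo q) p' = (geoPair q).bind fun x => p'.map fun z => x + (z, z) := by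
    simp [floodedPair, geoPair, pairPMF, PMF.map, PMF.bind_bind, Function.comp_def]
  constructor
  · have h1 : Close 1 δ (floodedPair (geo q) p') ((floodedPair (geo q) p').map ((1, 1) + ·)) := by
      have := Close.bind_right (geoPair q) fun x => h.map fun z => x + (z, z)
      rw [← key0] at this
      convert this using 1
      rw [key]
      simp only [PMF.map, PMF.bind_bind, PMF.pure_bind, Function.comp_def]
      refine congrArg _ (funext fun x => congrArg _ (funext fun z => congrArg _ ?_))
      ext <;> simp <;> ring
    have h2 := (close_geoPair_shift_both q).bind_left fun x => p'.map fun z => x + (z, z)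
    rw [← key, ← key] at h2
    simpa using h1.trans h2
  · have h1 := (close_geoPair_shift_left q).bind_left fun x => p'.map fun z => x + (z, z)
    rw [← key, ← key0] at h1
    exact h1.mono le_rfl (zero_le)

/-! ### Privacy of noisy tables -/

/-- The contribution of an item to a table: the amount `u` in each of its two buckets. -/
def itemVec {ι α : Type*} [DecidableEq ι] [AddCommMonoid α] (u : α) (b : ι × ι) : ι → α :=
  Pi.single b.1 u + Pi.single b.2 u

/-- The table of a dataset whose items are placed in the buckets `loc`. -/
def tableOf {ι α Z : Type*} [DecidableEq ι] [AddCommMonoid α] (u : α) (loc : Z → ι × ι) {n : ℕ}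
    (S : Fin n → Z) : ι → α :=
  ∑ i, itemVec u (loc (S i))

section Close

variable {ι α Z : Type*} [Fintype ι] [DecidableEq ι] [AddCommMonoid α] {C δ : ℝ≥0∞} {p : PMF α}
  {u : α}

theorem close_single (h : HidesShift C δ p u) (w : ι → α) (b : ι) :
    Close C δ ((piPMF fun _ => p).map (w + ·)) ((piPMF fun _ => p).map (w + Pi.single b u + ·)) ∧
    Close C δ ((piPMF fun _ => p).map (w + Pi.single b u + ·))
      ((piPMF fun _ => p).map (w + ·)) := by
  have key : (piPMF fun j => if j = b then p.map (u + ·) else p).map (w + ·) =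
      (piPMF fun _ => p).map (w + Pi.single b u + ·) := by
    have h1 : (fun j => if j = b then p.map (u + ·) else p) =
        fun j => p.map ((Pi.single b u : ι → α) j + ·) := by
      funext j
      by_cases hj : j = b
      · subst hj; simp
      · simp [hj, PMF.map, Function.comp_def]
    rw [h1, piPMF_map (fun _ => p) fun j a => (Pi.single b u : ι → α) j + a, PMF.map_comp]
    refine congrArg (PMF.map · _) (funext fun x => funext fun j => ?_)
    simp [add_assoc]
  rw [← key]
  exact ⟨(Close.piPMF_update _ _ b (by simpa using h.1) fun j hj => by simp [hj]).map _,
    (Close.piPMF_update _ _ b (by simpa using h.2) fun j hj => by simp [hj]).map _⟩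

theorem close_itemVec (h : HidesShift C δ p u) (w : ι → α) (b : ι × ι) :
    Close (C * C) (δ + C * δ) ((piPMF fun _ => p).map (w + ·))
      ((piPMF fun _ => p).map (w + itemVec u b + ·)) ∧
    Close (C * C) (δ + C * δ) ((piPMF fun _ => p).map (w + itemVec u b + ·))
      ((piPMF fun _ => p).map (w + ·)) := by
  have h1 := close_single h w b.1
  have h2 := close_single h (w + Pi.single b.1 u) b.2
  rw [itemVec, ← add_assoc]
  exact ⟨h1.1.trans h2.1, h2.2.trans h1.2⟩

/-- Replacing one item changes four buckets by one unit each. -/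
theorem close_tableOf (h : HidesShift C δ p u) (loc : Z → ι × ι) {n : ℕ} {S S' : Fin n → Z}
    (hS : Neighboring S S') :
    Close ((C * C) * (C * C)) ((δ + C * δ) + (C * C) * (δ + C * δ))
      ((piPMF fun _ => p).map (tableOf u loc S + ·))
      ((piPMF fun _ => p).map (tableOf u loc S' + ·)) := by
  obtain ⟨i, hi⟩ := hS
  have e : ∀ R : Fin n → Z, tableOf u loc R =
      (∑ j ∈ Finset.univ.erase i, itemVec u (loc (R j))) + itemVec u (loc (R i)) := fun R =>
    (Finset.sum_erase_add _ _ (Finset.mem_univ i)).symm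
  have h0 : ∑ j ∈ Finset.univ.erase i, itemVec u (loc (S j)) =
      ∑ j ∈ Finset.univ.erase i, itemVec u (loc (S' j)) :=
    Finset.sum_congr rfl fun j hj => by rw [hi j (Finset.ne_of_mem_erase hj)]
  rw [e S, e S', h0]
  exact (close_itemVec h _ _).2.trans (close_itemVec h _ _).1

end Close

theorem isDP_of_close {n : ℕ} {Z R : Type*} {ε δ : ℝ} {M : (Fin n → Z) → PMF R}
    (h : ∀ S S', Neighboring S S' →
      Close (ENNReal.ofReal (Real.exp ε)) (ENNReal.ofReal δ) (M S) (M S')) : IsDP ε δ M :=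
  fun S S' hS E => (h S S' hS).toOuterMeasure_le E

/-- The ratio `exp (-ε / 4)` of the noise: four units of change cost a factor `exp ε`. -/
def ratio (ε : ℝ) (hε : 0 < ε) : Set.Ioo (0 : ℝ) 1 :=
  ⟨Real.exp (-(ε / 4)), Real.exp_pos _, by rw [Real.exp_lt_one_iff]; linarith⟩

theorem ratioInv_pow_four (ε : ℝ) (hε : 0 < ε) :
    (ratioInv (ratio ε hε) * ratioInv (ratio ε hε)) *
      (ratioInv (ratio ε hε) * ratioInv (ratio ε hε)) = ENNReal.ofReal (Real.exp ε) := by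
  have h : ratioInv (ratio ε hε) = ENNReal.ofReal (Real.exp (ε / 4)) := by
    rw [ratioInv, ratio, ← Real.exp_neg, neg_neg]
  rw [h, ← ENNReal.ofReal_mul (Real.exp_pos _).le, ← Real.exp_add,
    ← ENNReal.ofReal_mul (Real.exp_pos _).le, ← Real.exp_add]
  congr 2
  ring

/-! ### The two mechanisms -/

section Mechanisms

variable {Seed ι Z Out : Type} [Fintype ι] [DecidableEq ι]

/-- The law of `analysis` applied to a random seed and to the noisy table of the dataset. -/
def tableLaw (seed : PMF Seed) (loc : Seed → Z → ι × ι) (q : Set.Ioo (0 : ℝ) 1)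
    (analysis : Seed → (ι → ℤ) → Out) {n : ℕ} (S : Fin n → Z) : PMF Out :=
  seed.bind fun s => (piPMF fun _ => dlap q).map fun ξ =>
    analysis s (tableOf 1 (loc s) S + ξ)

/-- The streaming algorithm whose state is the seed and the noisy table of the elements so far. -/
abbrev panAlgorithm (seed : PMF Seed) (loc : Seed → Z → ι × ι) (q : Set.Ioo (0 : ℝ) 1)
    (analysis : Seed → (ι → ℤ) → Out) : StreamAlgorithm Z Out where
  State := Seed × (ι → ℤ)
  init := seed.bind fun s => (piPMF fun _ => dlap q).map fun ξ => (s, ξ)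
  step st z := PMF.pure (st.1, itemVec 1 (loc st.1 z) + st.2)
  output st := PMF.pure (analysis st.1 st.2)

/-- Initial noise and items commute, so the state is the noisy table of the elements so far. -/
theorem stateAfter_panAlgorithm (seed : PMF Seed) (loc : Seed → Z → ι × ι)
    (q : Set.Ioo (0 : ℝ) 1) (analysis : Seed → (ι → ℤ) → Out) {n : ℕ} (S : Fin n → Z) :
    (panAlgorithm seed loc q analysis).stateAfter (List.ofFn S) =
      seed.bind fun s => (piPMF fun _ => dlap q).map fun ξ => (s, tableOf 1 (loc s) S + ξ) := by
  have key : ∀ zs : List Z, (panAlgorithm seed loc q analysis).stateAfter zs =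
      seed.bind fun s => (piPMF fun _ => dlap q).map fun ξ =>
        (s, (zs.map fun z => itemVec 1 (loc s z)).sum + ξ) := by
    intro zs
    induction zs using List.reverseRecOn with
    | nil => simp [StreamAlgorithm.stateAfter, panAlgorithm]
    | append_singleton zs z ih =>
      rw [StreamAlgorithm.stateAfter, List.foldl_append, ← StreamAlgorithm.stateAfter, ih]
      simp only [List.foldl_cons, List.foldl_nil, panAlgorithm, PMF.map, PMF.bind_bind,
        PMF.pure_bind, Function.comp_def, List.map_append, List.sum_append, List.map_cons,
        List.map_nil, List.sum_cons, List.sum_nil, add_zero]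
      refine congrArg _ (funext fun s => congrArg _ (funext fun ξ => ?_))
      rw [add_right_comm, add_comm, add_comm _ ξ]
  rw [key]
  simp [tableOf, List.map_ofFn, List.sum_ofFn]

theorem run_panAlgorithm (seed : PMF Seed) (loc : Seed → Z → ι × ι) (q : Set.Ioo (0 : ℝ) 1)
    (analysis : Seed → (ι → ℤ) → Out) {n : ℕ} (S : Fin n → Z) :
    (panAlgorithm seed loc q analysis).run S = tableLaw seed loc q analysis S := by
  rw [StreamAlgorithm.run, stateAfter_panAlgorithm]
  simp [panAlgorithm, tableLaw, PMF.map, PMF.bind_bind, Function.comp_def]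

theorem isPanPrivate_panAlgorithm (seed : PMF Seed) (loc : Seed → Z → ι × ι) {ε : ℝ} (hε : 0 < ε)
    (analysis : Seed → (ι → ℤ) → Out) :
    (panAlgorithm seed loc (ratio ε hε) analysis).IsPanPrivate ε := by
  refine fun t => isDP_of_close fun S S' hS => ?_
  rw [stateAfter_panAlgorithm, stateAfter_panAlgorithm]
  refine Close.bind_right seed fun s => ?_
  have h := (close_tableOf (hidesShift_dlap (ratio ε hε)) (loc s) hS).map fun x => (s, x)
  rw [ratioInv_pow_four] at h
  rw [PMF.map_comp, PMF.map_comp] at h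
  exact h.mono le_rfl (by simp)

/-- The multiset of messages in which the message `(b, true)` occurs `(N b).1` times and
`(b, false)` occurs `(N b).2` times. -/
def encode : (ι → ℕ × ℕ) →+ Multiset (ι × Bool) where
  toFun N := ∑ b, ((N b).1 • {(b, true)} + (N b).2 • {(b, false)})
  map_zero' := by simp
  map_add' N N' := by
    rw [← Finset.sum_add_distrib]
    refine Finset.sum_congr rfl fun b _ => ?_
    simp only [Pi.add_apply, Prod.fst_add, Prod.snd_add, add_smul]
    abel

/-- The number of messages `(b, true)` minus the number of messages `(b, false)`. -/
def decode (m : Multiset (ι × Bool)) (b : ι) : ℤ := m.count (b, true) - m.count (b, false)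

theorem decode_encode (N : ι → ℕ × ℕ) : decode (encode N) = fun b => ((N b).1 : ℤ) - (N b).2 := by
  funext b
  have h : ∀ c : Bool, (encode N).count (b, c) = if c then (N b).1 else (N b).2 := by
    intro c
    simp only [encode, AddMonoidHom.coe_mk, ZeroHom.coe_mk, Multiset.count_sum',
      Multiset.count_add, Multiset.count_nsmul, Multiset.count_singleton, Prod.mk.injEq]
    rw [Finset.sum_eq_single b]
    · cases c <;> simp
    · intro b' _ hb'
      simp [hb'.symm]
    · simp
  simp [decode, h]

/-- The shuffle protocol in which each user encodes their row of the table after adding noise to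
it, with noise laws `p` (the share of the two-sided noise) and `p'` (the flooding). -/
abbrev shuffleProtocol (seed : PMF Seed) (loc : Seed → Z → ι × ι) (p p' : PMF ℕ)
    (analysis : Seed → (ι → ℤ) → Out) : ShuffleProtocol Z Out where
  Seed := Seed
  seed := seed
  Msg := ι × Bool
  randomizer s z := (piPMF fun _ => floodedPair p p').map fun N =>
    encode (itemVec (1, 0) (loc s z) + N)
  analyzer s m := PMF.pure (analysis s (decode m))

theorem shuffled_shuffleProtocol (seed : PMF Seed) (loc : Seed → Z → ι × ι) (p p' : PMF ℕ)
    (analysis : Seed → (ι → ℤ) → Out) (s : Seed) {n : ℕ} (S : Fin n → Z) :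
    (shuffleProtocol seed loc p p' analysis).shuffled s S =
      (piPMF fun _ => floodedPair (nconv p n) (nconv p' n)).map fun N =>
        encode (tableOf (1, 0) (loc s) S + N) := by
  have key : ∀ zs : List Z,
      (runAll ((shuffleProtocol seed loc p p' analysis).randomizer s) zs).map shuffler =
        (nconv (piPMF fun _ => floodedPair p p') zs.length).map fun N =>
          encode ((zs.map fun z => itemVec (1, 0) (loc s z)).sum + N) := by
    intro zs
    induction zs with
    | nil =>
      simp only [runAll, nconv, PMF.pure_map, shuffler, List.map_nil, List.sum_nil, add_zero,
        map_zero, List.length_nil]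
    | cons z zs ih =>
      have e : (runAll ((shuffleProtocol seed loc p p' analysis).randomizer s) (z :: zs)).map
          shuffler = ((shuffleProtocol seed loc p p' analysis).randomizer s z).bind fun m =>
            ((runAll ((shuffleProtocol seed loc p p' analysis).randomizer s) zs).map
              shuffler).map (m + ·) := by
        simp only [runAll, PMF.map_bind, PMF.map_comp]
        refine congrArg _ (funext fun m => congrArg (PMF.map · _) (funext fun ms => ?_))
        simp [shuffler]
      rw [e, ih, List.length_cons, nconv]
      simp only [shuffleProtocol, PMF.map, PMF.bind_bind, PMF.pure_bind, Function.comp_def,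
        List.map_cons, List.sum_cons]
      refine congrArg _ (funext fun a => congrArg _ (funext fun N => congrArg _ ?_))
      rw [add_add_add_comm]
      exact (map_add encode _ _).symm
  rw [ShuffleProtocol.shuffled, key, nconv_piPMF, nconv_floodedPair]
  simp [tableOf, List.map_ofFn, List.sum_ofFn]

/-- If the noise shares add up to a geometric variable then the analyzer sees the noisy table: the
flooding cancels in the difference of the two kinds of messages. -/
theorem run_shuffleProtocol (seed : PMF Seed) (loc : Seed → Z → ι × ι) (q : Set.Ioo (0 : ℝ) 1)
    (p p' : PMF ℕ) (analysis : Seed → (ι → ℤ) → Out) {n : ℕ} (hp : nconv p n = geo q)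
    (S : Fin n → Z) :
    (shuffleProtocol seed loc p p' analysis).run S = tableLaw seed loc q analysis S := by
  rw [ShuffleProtocol.run, tableLaw]
  refine congrArg _ (funext fun s => ?_)
  rw [shuffled_shuffleProtocol, hp, ← map_sub_floodedPair q (nconv p' n),
    piPMF_map (fun _ => floodedPair (geo q) (nconv p' n)) fun _ x => (x.1 : ℤ) - x.2,
    PMF.map_comp]
  simp only [shuffleProtocol, PMF.map, PMF.bind_bind, PMF.pure_bind, Function.comp_def,
    decode_encode]
  have ht : ∀ b, ((tableOf ((1, 0) : ℕ × ℕ) (loc s) S b).1 : ℤ) = tableOf (1 : ℤ) (loc s) S b ∧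
      (tableOf ((1, 0) : ℕ × ℕ) (loc s) S b).2 = 0 := by
    intro b
    simp only [tableOf, Finset.sum_apply, itemVec, Pi.add_apply, Prod.fst_sum, Prod.snd_sum,
      Pi.single_apply]
    constructor
    · push_cast
      refine Finset.sum_congr rfl fun i _ => ?_
      split_ifs <;> simp
    · refine Finset.sum_eq_zero fun i _ => ?_
      split_ifs <;> simp
  refine congrArg _ (funext fun N => congrArg _ (congrArg _ (funext fun b => ?_)))
  simp only [Pi.add_apply, Prod.fst_add, Prod.snd_add, ← (ht b).1, (ht b).2]
  push_cast
  ring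

/-- The noise shares can be chosen so that the shuffle protocol is `(ε, δ)`-private and its
output law does not depend on `δ`. -/
theorem exists_shuffleProtocol (seed : PMF Seed) (loc : Seed → Z → ι × ι) {ε : ℝ} (hε : 0 < ε)
    {δ : ℝ} (hδ : 0 < δ) (analysis : Seed → (ι → ℤ) → Out) {n : ℕ} (hn : n ≠ 0) :
    ∃ P : ShuffleProtocol Z Out, P.IsShuffleDP n ε δ ∧
      ∀ S : Fin n → Z, P.run S = tableLaw seed loc (ratio ε hε) analysis S := by
  obtain ⟨p, hp⟩ := exists_nconv_eq_geo (ratio ε hε) hn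
  set C := ratioInv (ratio ε hε) with hC
  have hCtop : (1 + C) * (1 + C * C) ≠ ⊤ := by
    have : C ≠ ⊤ := ENNReal.ofReal_ne_top
    finiteness
  have hδ' : ENNReal.ofReal δ ≠ 0 := by simpa using hδ
  obtain ⟨K, hK⟩ := ENNReal.exists_nat_gt (ENNReal.div_ne_top hCtop hδ')
  refine ⟨shuffleProtocol seed loc p (unifUpTo K) analysis,
    fun s => isDP_of_close fun S S' hS => ?_,
    fun S => run_shuffleProtocol seed loc _ p _ analysis hp S⟩
  rw [shuffled_shuffleProtocol, shuffled_shuffleProtocol, hp]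
  have h := (close_tableOf (hidesShift_floodedPair (ratio ε hε)
    (close_nconv_shift (close_unifUpTo_shift K) hn)) (loc s) hS).map encode
  rw [PMF.map_comp, PMF.map_comp, ratioInv_pow_four] at h
  refine h.mono le_rfl ?_
  have hle : (1 + C) * (1 + C * C) ≤ ENNReal.ofReal δ * (K + 1 : ℕ) := by
    have := (ENNReal.div_lt_iff (Or.inl hδ') (Or.inl ENNReal.ofReal_ne_top)).1 hK
    rw [mul_comm (K : ℝ≥0∞)] at this
    refine this.le.trans ?_
    gcongr
    omega
  calc _ = (1 + C) * (1 + C * C) * ((K + 1 : ℕ) : ℝ≥0∞)⁻¹ := by rw [← hC]; ring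
    _ ≤ ENNReal.ofReal δ * (K + 1 : ℕ) * ((K + 1 : ℕ) : ℝ≥0∞)⁻¹ := by gcongr
    _ = ENNReal.ofReal δ := by
      rw [mul_assoc, ENNReal.mul_inv_cancel (by simp) (by finiteness), mul_one]

end Mechanisms

section Denoise

open MeasureTheory ProbabilityTheory

/-! ### Unbiased estimation from noisy counts -/

/-- The function whose expectation at `c + X - Y`, for independent geometric variables `X` and `Y`
with ratio `q`, is `f c`. It inverts first the noise `X` and then the noise `-Y`, each of which is
inverted by a two-point difference operator. -/
def denoise (q : ℝ) (f : ℤ → ℝ) (x : ℤ) : ℝ :=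
  ((f x - q * f (x - 1)) / (1 - q) - q * ((f (x + 1) - q * f x) / (1 - q))) / (1 - q)

/-- A bound for `denoise q f` when `|f| ≤ 1`. -/
def denoiseBound (q : ℝ) : ℝ := ((1 + q) / (1 - q)) ^ 2

theorem abs_denoise_le (q : Set.Ioo (0 : ℝ) 1) {f : ℤ → ℝ} (hf : ∀ x, |f x| ≤ 1) (x : ℤ) :
    |denoise q f x| ≤ denoiseBound q := by
  have h0 := q.2.1
  have h1 : 0 < 1 - (q : ℝ) := by linarith [q.2.2]
  have key : ∀ a b : ℝ, ∀ M, |a| ≤ M → |b| ≤ M →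
      |(a - q * b) / (1 - q)| ≤ (1 + q) / (1 - q) * M := by
    intro a b M ha hb
    rw [abs_div, abs_of_pos h1, div_mul_eq_mul_div]
    gcongr
    calc |a - q * b| ≤ |a| + |q * b| := abs_sub _ _
      _ ≤ M + q * M := by rw [abs_mul, abs_of_pos h0]; gcongr
      _ = _ := by ring
  have := key _ _ _ (key _ _ _ (hf x) (hf (x - 1))) (by simpa using key _ _ _ (hf (x + 1)) (hf x))
  rw [denoise, denoiseBound, sq]
  simpa using this

theorem denoise_zero (q : ℝ) (x : ℤ) : denoise q (fun _ => 0) x = 0 := by simp [denoise]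

theorem denoise_of_eq (q : Set.Ioo (0 : ℝ) 1) {f : ℤ → ℝ} {x : ℤ} {a : ℝ} (h : f x = a)
    (hl : f (x - 1) = a) (hr : f (x + 1) = a) : denoise q f x = a := by
  have h1 : (1 - (q : ℝ)) ≠ 0 := by linarith [q.2.2]
  rw [denoise, h, hl, hr]
  field_simp

theorem toMeasure_pairPMF {α β : Type*} [Countable α] [Countable β] [MeasurableSpace α]
    [MeasurableSpace β] [MeasurableSingletonClass α] [MeasurableSingletonClass β] (p : PMF α)
    (p' : PMF β) : (pairPMF p p').toMeasure = p.toMeasure.prod p'.toMeasure := by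
  classical
  refine Measure.ext_of_singleton fun x => ?_
  obtain ⟨a, b⟩ := x
  rw [PMF.toMeasure_apply_singleton _ _ (measurableSet_singleton _), ← Set.singleton_prod_singleton,
    Measure.prod_prod, PMF.toMeasure_apply_singleton _ _ (measurableSet_singleton _),
    PMF.toMeasure_apply_singleton _ _ (measurableSet_singleton _), pairPMF, PMF.bind_apply,
    tsum_eq_single a]
  · rw [PMF.map_apply]
    congr 1
    refine (tsum_eq_single b fun b' hb' => ?_).trans (by simp)
    simp [hb'.symm]
  · intro a' ha'
    rw [PMF.map_apply, ENNReal.tsum_eq_zero.2, mul_zero]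
    intro b'
    simp [ha'.symm]

theorem toMeasure_dlap (q : Set.Ioo (0 : ℝ) 1) : (dlap q).toMeasure =
    ((geo q).toMeasure.prod (geo q).toMeasure).map fun x => (x.1 : ℤ) - x.2 := by
  rw [← toMeasure_pairPMF]
  exact (PMF.toMeasure_map _ _ (.of_discrete)).symm

theorem integrable_of_abs_le {α : Type*} [MeasurableSpace α] [DiscreteMeasurableSpace α]
    (μ : Measure α) [IsFiniteMeasure μ] [Countable α] {f : α → ℝ} {M : ℝ} (hf : ∀ x, |f x| ≤ M) :
    Integrable f μ :=
  Integrable.of_bound (Measurable.of_discrete.aestronglyMeasurable) M (ae_of_all _ hf)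

/-- The two-point difference operator that inverts geometric noise: the series telescopes. -/
theorem integral_geo (q : Set.Ioo (0 : ℝ) 1) {g : ℕ → ℝ} {M : ℝ} (hg : ∀ k, |g k| ≤ M) :
    ∫ k, (g k - q * g (k + 1)) / (1 - q) ∂(geo q).toMeasure = g 0 := by
  have h0 := q.2.1
  have h1 : 0 < 1 - (q : ℝ) := by linarith [q.2.2]
  have hs : Summable fun k => (q : ℝ) ^ k * g k := by
    refine Summable.of_norm_bounded
      ((summable_geometric_of_lt_one h0.le q.2.2).mul_right M) fun k => ?_
    rw [Real.norm_eq_abs, abs_mul, abs_of_pos (pow_pos h0 k)]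
    gcongr
    exact hg k
  rw [PMF.integral_eq_tsum]
  · have h2 := hs.tsum_eq_zero_add
    have h3 : Summable fun k => (q : ℝ) ^ (k + 1) * g (k + 1) :=
      hs.comp_injective (add_left_injective 1)
    have h4 : ∀ k, (geo q k).toReal • ((g k - q * g (k + 1)) / (1 - q)) =
        (q : ℝ) ^ k * g k - q ^ (k + 1) * g (k + 1) := by
      intro k
      rw [geo_apply, ENNReal.toReal_ofReal (by positivity), smul_eq_mul]
      field_simp
      ring
    rw [tsum_congr h4, hs.tsum_sub h3, h2]
    simp
  · refine integrable_of_abs_le (M := (M + q * M) / (1 - q)) _ fun k => ?_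
    rw [abs_div, abs_of_pos h1]
    gcongr
    calc |g k - q * g (k + 1)| ≤ |g k| + |q * g (k + 1)| := abs_sub _ _
      _ ≤ M + q * M := by
        rw [abs_mul, abs_of_pos h0]
        gcongr
        · exact hg k
        · exact hg _

/-- `denoise q f` of the noisy count is an unbiased estimator of `f` of the count. -/
theorem integral_denoise (q : Set.Ioo (0 : ℝ) 1) {f : ℤ → ℝ} (hf : ∀ x, |f x| ≤ 1) (c : ℤ) :
    ∫ x, denoise q f (c + x) ∂(dlap q).toMeasure = f c := by
  have h0 := q.2.1
  have h1 : 0 < 1 - (q : ℝ) := by linarith [q.2.2]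
  rw [toMeasure_dlap, integral_map (Measurable.of_discrete.aemeasurable)
    (Measurable.of_discrete.aestronglyMeasurable), integral_prod_symm]
  · have key : ∀ y : ℕ, ∫ x : ℕ, denoise q f (c + ((x : ℤ) - y)) ∂(geo q).toMeasure =
        (f (c - (y : ℕ)) - q * f (c - (y + 1 : ℕ))) / (1 - q) := by
      intro y
      have hb : ∀ k : ℕ, |(f (c - y + k) - q * f (c - y + k - 1)) / (1 - q)| ≤
          (1 + q) / (1 - q) := by
        intro k
        rw [abs_div, abs_of_pos h1]
        gcongr
        refine (abs_sub _ _).trans ?_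
        rw [abs_mul, abs_of_pos h0]
        nlinarith [hf (c - y + k), hf (c - y + k - 1)]
      have h := integral_geo q hb
      have e : ∀ x : ℕ, denoise q f (c + ((x : ℤ) - y)) =
          ((f (c - y + x) - q * f (c - y + x - 1)) / (1 - q) - q *
            ((f (c - y + (x + 1 : ℕ)) - q * f (c - y + (x + 1 : ℕ) - 1)) / (1 - q))) / (1 - q) := by
        intro x
        rw [denoise]
        push_cast
        ring_nf
      simp only [e]
      rw [h]
      push_cast
      ring_nf
    simp only [key]
    rw [integral_geo q (g := fun y => f (c - (y : ℕ))) fun y => hf _]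
    simp
  · exact integrable_of_abs_le _ fun x => abs_denoise_le q hf _

theorem geo_tail (q : Set.Ioo (0 : ℝ) 1) (t : ℕ) :
    (geo q).toMeasure {k | t ≤ k} ≤ ENNReal.ofReal ((q : ℝ) ^ t) := by
  have h0 := q.2.1
  have h1 : 0 < 1 - (q : ℝ) := by linarith [q.2.2]
  rw [PMF.toMeasure_apply_eq_tsum, ← (add_left_injective t).tsum_eq]
  · have : ∀ k, Set.indicator {k | t ≤ k} (geo q) (k + t) =
        ENNReal.ofReal ((q : ℝ) ^ t) * geo q k := by
      intro k
      rw [Set.indicator_of_mem (by simp), geo_apply, geo_apply,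
        ← ENNReal.ofReal_mul (by positivity)]
      congr 1
      ring
    rw [tsum_congr this, ENNReal.tsum_mul_left, PMF.tsum_coe, mul_one]
  · intro k hk
    have : t ≤ k := by
      by_contra h
      exact hk (Set.indicator_of_notMem h _)
    exact ⟨k - t, by simp; omega⟩

theorem dlap_tail (q : Set.Ioo (0 : ℝ) 1) (t : ℕ) :
    (dlap q).toMeasure {x | (t : ℤ) ≤ |x|} ≤ ENNReal.ofReal (2 * (q : ℝ) ^ t) := by
  have h0 := q.2.1
  rw [toMeasure_dlap, Measure.map_apply .of_discrete .of_discrete]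
  calc _ ≤ ((geo q).toMeasure.prod (geo q).toMeasure)
        ({k | t ≤ k} ×ˢ Set.univ ∪ Set.univ ×ˢ {k | t ≤ k}) := by
        refine measure_mono fun x hx => ?_
        simp only [Set.mem_preimage, Set.mem_ofPred_eq] at hx
        simp only [Set.mem_union, Set.mem_prod, Set.mem_ofPred_eq, Set.mem_univ, and_true, true_and]
        rcases le_abs.1 hx with h | h <;> omega
    _ ≤ _ := measure_union_le _ _
    _ ≤ ENNReal.ofReal ((q : ℝ) ^ t) + ENNReal.ofReal ((q : ℝ) ^ t) := by
        rw [Measure.prod_prod, Measure.prod_prod, measure_univ, mul_one, one_mul]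
        exact add_le_add (geo_tail q t) (geo_tail q t)
    _ = _ := by rw [← ENNReal.ofReal_add (by positivity) (by positivity), two_mul]

/-- A bound for the variance of `denoise q f` of a noisy count when `|f| ≤ 1`. -/
def noiseVar (q : ℝ) : ℝ := (denoiseBound q + 1) ^ 2 * (2 / q)

theorem denoiseBound_nonneg (q : ℝ) : 0 ≤ denoiseBound q := sq_nonneg _

theorem sq_denoise_sub_le (q : Set.Ioo (0 : ℝ) 1) {f : ℤ → ℝ} (hf : ∀ x, |f x| ≤ 1) (x c : ℤ) :
    (denoise q f x - f c) ^ 2 ≤ (denoiseBound q + 1) ^ 2 := by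
  rw [← sq_abs]
  have := denoiseBound_nonneg q
  gcongr
  exact (abs_sub _ _).trans (add_le_add (abs_denoise_le q hf x) (hf c))

theorem integral_sq_denoise_le (q : Set.Ioo (0 : ℝ) 1) {f : ℤ → ℝ} (hf : ∀ x, |f x| ≤ 1) (c : ℤ) :
    ∫ x, (denoise q f (c + x) - f c) ^ 2 ∂(dlap q).toMeasure ≤ noiseVar q := by
  have h0 := q.2.1
  have h := integral_mono (μ := (dlap q).toMeasure) (integrable_of_abs_le _ fun x => by
    rw [abs_of_nonneg (sq_nonneg _)]; exact sq_denoise_sub_le q hf (c + x) c)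
    (integrable_const _) fun x => sq_denoise_sub_le q hf (c + x) c
  refine h.trans ?_
  simp only [integral_const, probReal_univ, smul_eq_mul, one_mul, noiseVar]
  refine le_mul_of_one_le_right (sq_nonneg _) ?_
  rw [le_div_iff₀ h0]
  linarith [q.2.2]

/-- The indicator function of the integers that are at least `r`. -/
def geInd (r : ℕ) (x : ℤ) : ℝ := if (r : ℤ) ≤ x then 1 else 0

theorem abs_geInd_le (r : ℕ) (x : ℤ) : |geInd r x| ≤ 1 := by
  rw [geInd]; split_ifs <;> simp

/-- The estimator of `geInd r c` differs from `geInd r c` only if the noise reaches from `c` to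
`r`, so its variance decays exponentially in the distance. -/
theorem integral_sq_denoise_geInd_le (q : Set.Ioo (0 : ℝ) 1) (r : ℕ) (c : ℤ) :
    ∫ x, (denoise q (geInd r) (c + x) - geInd r c) ^ 2 ∂(dlap q).toMeasure ≤
      noiseVar q * (q : ℝ) ^ (c - r).natAbs := by
  have h0 := q.2.1
  set t : ℕ := (c - r).natAbs - 1 with ht
  have hle : ∀ x : ℤ, (denoise q (geInd r) (c + x) - geInd r c) ^ 2 ≤
      {x : ℤ | (t : ℤ) ≤ |x|}.indicator (fun _ => (denoiseBound q + 1) ^ 2) x := by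
    intro x
    by_cases hx : (t : ℤ) ≤ |x|
    · rw [Set.indicator_of_mem (by exact hx)]
      exact sq_denoise_sub_le q (abs_geInd_le r) _ _
    · rw [Set.indicator_of_notMem (by exact hx)]
      have hx1 := neg_abs_le x
      have hx2 := le_abs_self x
      have : ∀ y : ℤ, |y - (c + x)| ≤ 1 → geInd r y = geInd r c := by
        intro y hy
        rw [abs_le] at hy
        rw [geInd, geInd]
        congr 1
        rw [eq_iff_iff]
        omega
      rw [denoise_of_eq q (this _ (by simp)) (this _ (by simp)) (this _ (by simp))]
      simp
  have hm : MeasurableSet {x : ℤ | (t : ℤ) ≤ |x|} := .of_discrete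
  have h := integral_mono (μ := (dlap q).toMeasure) (integrable_of_abs_le _ fun x => by
    rw [abs_of_nonneg (sq_nonneg _)]; exact sq_denoise_sub_le q (abs_geInd_le r) (c + x) c)
    ((integrable_const _).indicator hm) hle
  refine h.trans ?_
  rw [integral_indicator_const _ hm, smul_eq_mul, mul_comm, noiseVar, mul_assoc]
  gcongr
  refine (ENNReal.toReal_mono ENNReal.ofReal_ne_top (dlap_tail q t)).trans ?_
  rw [ENNReal.toReal_ofReal (by positivity), div_mul_eq_mul_div, le_div_iff₀ h0, mul_assoc,
    ← pow_succ]
  gcongr 2 * ?_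
  exact pow_le_pow_of_le_one h0.le q.2.2.le (by omega)

/-! ### Second moments over independent noise -/

theorem toMeasure_piPMF {ι α : Type*} [Fintype ι] [Countable α] [MeasurableSpace α]
    [MeasurableSingletonClass α] (p : ι → PMF α) :
    (piPMF p).toMeasure = Measure.pi fun i => (p i).toMeasure := by
  refine Measure.ext_of_singleton fun x => ?_
  rw [PMF.toMeasure_apply_singleton _ _ (measurableSet_singleton _), Measure.pi_singleton,
    piPMF_apply]
  exact Finset.prod_congr rfl fun i _ =>
    (PMF.toMeasure_apply_singleton _ _ (measurableSet_singleton _)).symm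

theorem expect_eq_lintegral {α : Type*} [Countable α] [MeasurableSpace α]
    [MeasurableSingletonClass α] (p : PMF α) (f : α → ℝ) :
    expect p f = ∫⁻ a, ENNReal.ofReal (f a) ∂p.toMeasure := by
  rw [lintegral_countable', expect]
  exact tsum_congr fun a => by
    rw [PMF.toMeasure_apply_singleton _ _ (measurableSet_singleton _), mul_comm]

/-- The estimators of different buckets are independent, so their variances add up. -/
theorem expect_sq_sum_denoise_le {ι : Type*} [Fintype ι] (q : Set.Ioo (0 : ℝ) 1) (f : ι → ℤ → ℝ)
    (hf : ∀ b x, |f b x| ≤ 1) (c : ι → ℤ) (v : ι → ℝ)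
    (hv : ∀ b, ∫ x, (denoise q (f b) (c b + x) - f b (c b)) ^ 2 ∂(dlap q).toMeasure ≤ v b) :
    expect (piPMF fun _ : ι => dlap q)
      (fun ξ => (∑ b, denoise q (f b) (c b + ξ b) - ∑ b, f b (c b)) ^ 2) ≤
      ENNReal.ofReal (∑ b, v b) := by
  have hmem : ∀ b, MemLp (fun x => denoise q (f b) (c b + x)) 2 (dlap q).toMeasure := fun b =>
    MemLp.of_bound (Measurable.of_discrete.aestronglyMeasurable) _
      (ae_of_all _ fun x => abs_denoise_le q (hf b) (c b + x))
  have hvar := variance_sum_pi (μ := fun _ : ι => (dlap q).toMeasure) hmem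
  have hint : ∀ b, Integrable (fun ξ : ι → ℤ => denoise q (f b) (c b + ξ b))
      (Measure.pi fun _ : ι => (dlap q).toMeasure) := fun b =>
    integrable_of_abs_le _ fun ξ => abs_denoise_le q (hf b) (c b + ξ b)
  have hmean : ∫ ξ, (∑ b, fun ξ : ι → ℤ => denoise q (f b) (c b + ξ b)) ξ
      ∂(Measure.pi fun _ : ι => (dlap q).toMeasure) = ∑ b, f b (c b) := by
    simp only [Finset.sum_apply]
    rw [integral_finsetSum _ fun b _ => hint b]
    refine Finset.sum_congr rfl fun b _ => ?_
    rw [← integral_denoise q (hf b) (c b)]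
    exact integral_comp_eval (μ := fun _ : ι => (dlap q).toMeasure)
      (f := fun x => denoise q (f b) (c b + x)) (Measurable.of_discrete.aestronglyMeasurable)
  rw [variance_eq_integral Measurable.of_discrete.aemeasurable, hmean] at hvar
  rw [expect_eq_lintegral, toMeasure_piPMF, ← ofReal_integral_eq_lintegral_ofReal]
  · refine ENNReal.ofReal_le_ofReal ?_
    simp only [Finset.sum_apply] at hvar
    rw [hvar]
    refine Finset.sum_le_sum fun b _ => ?_
    rw [variance_eq_integral Measurable.of_discrete.aemeasurable, integral_denoise q (hf b)]
    exact hv b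
  · refine integrable_of_abs_le (M := (∑ _b : ι, (denoiseBound q + 1)) ^ 2) _ fun ξ => ?_
    rw [abs_of_nonneg (sq_nonneg _), ← sq_abs, ← Finset.sum_sub_distrib]
    gcongr
    refine (Finset.abs_sum_le_sum_abs _ _).trans (Finset.sum_le_sum fun b _ => ?_)
    exact (abs_sub _ _).trans (add_le_add (abs_denoise_le q (hf b) _) (hf b _))
  · exact ae_of_all _ fun ξ => sq_nonneg _

/-- The probability that some of the noise variables of a set of buckets is large. -/
theorem expect_exists_le {ι : Type*} [Fintype ι] (q : Set.Ioo (0 : ℝ) 1) (s : Finset ι) (t : ℕ) :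
    expect (piPMF fun _ : ι => dlap q)
      ({ξ : ι → ℤ | ∃ b ∈ s, (t : ℤ) ≤ |ξ b|}.indicator fun _ => 1) ≤
      ENNReal.ofReal (s.card * (2 * (q : ℝ) ^ t)) := by
  have h0 := q.2.1
  have e : {ξ : ι → ℤ | ∃ b ∈ s, (t : ℤ) ≤ |ξ b|} =
      ⋃ b ∈ s, Function.eval b ⁻¹' {x : ℤ | (t : ℤ) ≤ |x|} := by
    ext ξ; simp
  rw [expect_indicator, ← PMF.toMeasure_apply_eq_toOuterMeasure, toMeasure_piPMF, e]
  refine (measure_biUnion_finset_le _ _).trans ?_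
  have h : ∀ b ∈ s, Measure.pi (fun _ : ι => (dlap q).toMeasure)
      (Function.eval b ⁻¹' {x : ℤ | (t : ℤ) ≤ |x|}) ≤ ENNReal.ofReal (2 * (q : ℝ) ^ t) := by
    intro b _
    rw [(measurePreserving_eval (fun _ : ι => (dlap q).toMeasure) b).measure_preimage
      (MeasurableSet.of_discrete).nullMeasurableSet]
    exact dlap_tail q t
  refine (Finset.sum_le_sum h).trans ?_
  rw [Finset.sum_const, nsmul_eq_mul, ENNReal.ofReal_mul (by positivity)]
  simp

end Denoise

/-! ### Random hashing -/

/-- The number of users whose item is hashed to the bucket `b`. -/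
def load {D B : ℕ} (f : Fin D → Fin B) (h : Fin D → ℕ) (b : Fin B) : ℕ :=
  ∑ j, if f j = b then h j else 0

/-- The expectation of `∑ b, u ^ load f h b` over a uniformly random `f`. -/
def charProd {D : ℕ} (B : ℕ) (u : ℂ) (h : Fin D → ℕ) : ℂ :=
  B * ∏ j, (1 + (u ^ h j - 1) / B)

theorem norm_prod_le_one {κ : Type*} (s : Finset κ) {a : κ → ℂ} (ha : ∀ i ∈ s, ‖a i‖ ≤ 1) :
    ‖∏ i ∈ s, a i‖ ≤ 1 := by
  rw [norm_prod]
  exact Finset.prod_le_one (fun i _ => norm_nonneg _) ha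

/-- Products of numbers in the unit disc are Lipschitz in each factor. -/
theorem norm_prod_sub_prod_le {κ : Type*} (s : Finset κ) {a b : κ → ℂ} (ha : ∀ i ∈ s, ‖a i‖ ≤ 1)
    (hb : ∀ i ∈ s, ‖b i‖ ≤ 1) : ‖∏ i ∈ s, a i - ∏ i ∈ s, b i‖ ≤ ∑ i ∈ s, ‖a i - b i‖ := by
  classical
  induction s using Finset.induction_on with
  | empty => simp
  | insert k s hk ih =>
    rw [Finset.prod_insert hk, Finset.prod_insert hk, Finset.sum_insert hk]
    have e : a k * ∏ i ∈ s, a i - b k * ∏ i ∈ s, b i =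
        (a k - b k) * ∏ i ∈ s, a i + b k * (∏ i ∈ s, a i - ∏ i ∈ s, b i) := by ring
    have h1 := ih (fun i hi => ha i (Finset.mem_insert_of_mem hi))
      fun i hi => hb i (Finset.mem_insert_of_mem hi)
    rw [e]
    refine (norm_add_le _ _).trans ?_
    rw [norm_mul, norm_mul]
    refine add_le_add ?_ ?_
    · exact mul_le_of_le_one_right (norm_nonneg _)
        (norm_prod_le_one s fun i hi => ha i (Finset.mem_insert_of_mem hi))
    · exact (mul_le_of_le_one_left (norm_nonneg _) (hb k (Finset.mem_insert_self k s))).trans h1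

section HashMoment

variable {D B : ℕ} {u : ℂ} {h : Fin D → ℕ}

theorem pow_load (f : Fin D → Fin B) (b : Fin B) :
    u ^ load f h b = ∏ j, if f j = b then u ^ h j else 1 := by
  rw [load, ← Finset.prod_pow_eq_pow_sum]
  exact Finset.prod_congr rfl fun j _ => by split_ifs <;> simp

/-- The expectation of a product of functions of the independent values `f j`. -/
theorem sum_prod_hash (g : Fin D → Fin B → ℂ) (hB : B ≠ 0) :
    ∑ f : Fin D → Fin B, ∏ j, g j (f j) = (B : ℂ) ^ D * ∏ j, ((∑ y, g j y) / B) := by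
  have : (B : ℂ) ≠ 0 := by exact_mod_cast hB
  rw [← Fintype.prod_sum, Finset.prod_div_distrib]
  simp
  field_simp

theorem norm_one_add_le (hu : ‖u‖ = 1) (hB : B ≠ 0) (k : ℕ) : ‖1 + (u ^ k - 1) / B‖ ≤ 1 := by
  have hB1 : (1 : ℝ) ≤ B := by exact_mod_cast Nat.one_le_iff_ne_zero.2 hB
  have hB' : (B : ℂ) ≠ 0 := by exact_mod_cast hB
  have e : 1 + (u ^ k - 1) / (B : ℂ) = (((B - 1 : ℝ) : ℂ) + u ^ k) / B := by
    push_cast; field_simp; ring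
  rw [e, norm_div, Complex.norm_natCast, div_le_one (by linarith)]
  refine (norm_add_le _ _).trans ?_
  rw [norm_pow, hu, one_pow, Complex.norm_real, Real.norm_of_nonneg (by linarith)]
  linarith

theorem norm_pow_sub_one_sq_le (hu : ‖u‖ = 1) (k : ℕ) :
    ‖(u ^ k - 1) * ((starRingEnd ℂ) u ^ k - 1)‖ ≤ if k = 0 then 0 else 4 := by
  split_ifs with hk
  · simp [hk]
  · rw [norm_mul]
    have h1 : ‖u ^ k - 1‖ ≤ 2 := by
      refine (norm_sub_le _ _).trans ?_
      rw [norm_pow, hu]; norm_num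
    have h2 : ‖(starRingEnd ℂ) u ^ k - 1‖ ≤ 2 := by
      refine (norm_sub_le _ _).trans ?_
      rw [norm_pow, RCLike.norm_conj, hu]; norm_num
    calc _ ≤ (2 : ℝ) * 2 := by gcongr
      _ = 4 := by norm_num

theorem sum_hash_pow_load (hB : B ≠ 0) (b : Fin B) :
    ∑ f : Fin D → Fin B, u ^ load f h b = (B : ℂ) ^ D * ∏ j, (1 + (u ^ h j - 1) / B) := by
  have hB' : (B : ℂ) ≠ 0 := by exact_mod_cast hB
  simp only [pow_load]
  rw [sum_prod_hash (fun j y => if y = b then u ^ h j else 1) hB]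
  congr 1
  refine Finset.prod_congr rfl fun j _ => ?_
  have : ∑ y : Fin B, (if y = b then u ^ h j else 1) = (u ^ h j - 1) + B := by
    have : ∀ y : Fin B, (if y = b then u ^ h j else 1) = (if y = b then u ^ h j - 1 else 0) + 1 :=
      fun y => by split_ifs <;> ring
    simp [this, Finset.sum_add_distrib]
  rw [this]
  field_simp
  ring

/-- Two distinct buckets are nearly independent. -/
theorem norm_sum_hash_pair_le (hu : ‖u‖ = 1) (hB : 2 ≤ B) {b b' : Fin B} (hb : b ≠ b') :
    ‖∑ f : Fin D → Fin B, u ^ load f h b * (starRingEnd ℂ) (u ^ load f h b') -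
      (B : ℂ) ^ D * ((∏ j, (1 + (u ^ h j - 1) / B)) *
        (starRingEnd ℂ) (∏ j, (1 + (u ^ h j - 1) / B)))‖ ≤
      (B : ℝ) ^ D * (4 * (Finset.univ.filter fun j => h j ≠ 0).card / B ^ 2) := by
  have hB0 : B ≠ 0 := by omega
  have hB' : (B : ℂ) ≠ 0 := by exact_mod_cast hB0
  have hBr : (2 : ℝ) ≤ B := by exact_mod_cast hB
  set w := (starRingEnd ℂ) u with hw
  have hwn : ‖w‖ = 1 := by rw [hw, RCLike.norm_conj, hu]
  have e1 : ∑ f : Fin D → Fin B, u ^ load f h b * (starRingEnd ℂ) (u ^ load f h b') =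
      (B : ℂ) ^ D * ∏ j, (1 + (u ^ h j - 1) / B + (w ^ h j - 1) / B) := by
    have hc : ∀ k, (starRingEnd ℂ) (u ^ k) = w ^ k := fun k => map_pow _ _ _
    simp only [hc]
    simp only [pow_load, ← Finset.prod_mul_distrib]
    rw [sum_prod_hash (fun j y => (if y = b then u ^ h j else 1) *
      (if y = b' then w ^ h j else 1)) hB0]
    congr 1
    refine Finset.prod_congr rfl fun j _ => ?_
    have : ∑ y : Fin B, ((if y = b then u ^ h j else 1) * (if y = b' then w ^ h j else 1)) =
        (u ^ h j - 1) + (w ^ h j - 1) + B := by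
      have : ∀ y : Fin B, (if y = b then u ^ h j else 1) * (if y = b' then w ^ h j else 1) =
          (if y = b then u ^ h j - 1 else 0) + (if y = b' then w ^ h j - 1 else 0) + 1 := by
        intro y
        by_cases h1 : y = b
        · have h2 : y ≠ b' := h1 ▸ hb
          simp [h1, hb]
        · simp only [h1, if_false]
          split_ifs <;> ring
      simp [this, Finset.sum_add_distrib]
    rw [this]
    field_simp
    ring
  have e2 : (∏ j, (1 + (u ^ h j - 1) / (B : ℂ))) *
      (starRingEnd ℂ) (∏ j, (1 + (u ^ h j - 1) / (B : ℂ))) =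
      ∏ j, ((1 + (u ^ h j - 1) / B) * (1 + (w ^ h j - 1) / B)) := by
    rw [map_prod, ← Finset.prod_mul_distrib]
    refine Finset.prod_congr rfl fun j _ => ?_
    simp [hw]
  rw [e1, e2, ← mul_sub, norm_mul, norm_pow, Complex.norm_natCast]
  gcongr
  refine (norm_prod_sub_prod_le _ (fun j _ => ?_) fun j _ => ?_).trans ?_
  · have e : 1 + (u ^ h j - 1) / (B : ℂ) + (w ^ h j - 1) / B =
        (((B - 2 : ℝ) : ℂ) + u ^ h j + w ^ h j) / B := by
      push_cast; field_simp; ring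
    rw [e, norm_div, Complex.norm_natCast, div_le_one (by linarith)]
    refine (norm_add₃_le).trans ?_
    rw [norm_pow, norm_pow, hu, hwn, one_pow, Complex.norm_real,
      Real.norm_of_nonneg (by linarith)]
    linarith
  · rw [norm_mul]
    exact mul_le_one₀ (norm_one_add_le hu hB0 _) (norm_nonneg _) (norm_one_add_le hwn hB0 _)
  · have : ∀ j, ‖1 + (u ^ h j - 1) / (B : ℂ) + (w ^ h j - 1) / B -
        (1 + (u ^ h j - 1) / B) * (1 + (w ^ h j - 1) / B)‖ ≤
        if h j = 0 then 0 else 4 / (B : ℝ) ^ 2 := by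
      intro j
      have e : 1 + (u ^ h j - 1) / (B : ℂ) + (w ^ h j - 1) / B -
        (1 + (u ^ h j - 1) / B) * (1 + (w ^ h j - 1) / B) =
          -((u ^ h j - 1) * (w ^ h j - 1)) / B ^ 2 := by ring
      rw [e, norm_div, norm_neg, norm_pow, Complex.norm_natCast]
      have h3 := norm_pow_sub_one_sq_le hu (h j)
      split_ifs with hj
      · simp [hj]
      · rw [if_neg hj] at h3
        gcongr
    refine (Finset.sum_le_sum fun j _ => this j).trans (le_of_eq ?_)
    rw [Finset.sum_ite, Finset.sum_const_zero, zero_add, Finset.sum_const, nsmul_eq_mul]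
    ring

/-- The variance of `∑ b, u ^ load f h b` over a uniformly random `f`. -/
theorem sum_hash_sq_le (hu : ‖u‖ = 1) (hB : 2 ≤ B) :
    ∑ f : Fin D → Fin B, ‖∑ b, u ^ load f h b - charProd B u h‖ ^ 2 ≤
      (B : ℝ) ^ D * (B + 4 * (Finset.univ.filter fun j => h j ≠ 0).card) := by
  have hB0 : B ≠ 0 := by omega
  have hBr : (0 : ℝ) < B := by exact_mod_cast Nat.pos_of_ne_zero hB0
  set P : ℂ := ∏ j, (1 + (u ^ h j - 1) / (B : ℂ)) with hP
  set m : ℝ := ((Finset.univ.filter fun j => h j ≠ 0).card : ℝ) with hm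
  have hPn : ‖P‖ ≤ 1 := norm_prod_le_one _ fun j _ => norm_one_add_le hu hB0 _
  have hsum : ∀ b, ∑ f : Fin D → Fin B, u ^ load f h b = (B : ℂ) ^ D * P := sum_hash_pow_load hB0
  have hsum' : ∀ b, ∑ f : Fin D → Fin B, (starRingEnd ℂ) (u ^ load f h b) =
      (B : ℂ) ^ D * (starRingEnd ℂ) P := fun b => by
    rw [← map_sum, hsum, map_mul, map_pow, Complex.conj_natCast]
  have expand : ((∑ f : Fin D → Fin B, ‖∑ b, u ^ load f h b - charProd B u h‖ ^ 2 : ℝ) : ℂ) =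
      ∑ b, ∑ b', (∑ f : Fin D → Fin B, u ^ load f h b * (starRingEnd ℂ) (u ^ load f h b') -
        (B : ℂ) ^ D * (P * (starRingEnd ℂ) P)) := by
    have e1 : ∀ f : Fin D → Fin B, ((‖∑ b, u ^ load f h b - charProd B u h‖ ^ 2 : ℝ) : ℂ) =
        ∑ b, ∑ b', (u ^ load f h b - P) *
          ((starRingEnd ℂ) (u ^ load f h b') - (starRingEnd ℂ) P) := by
      intro f
      have e2 : ∑ b, u ^ load f h b - charProd B u h = ∑ b : Fin B, (u ^ load f h b - P) := by
        simp [Finset.sum_sub_distrib, charProd, hP]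
      rw [← Finset.sum_mul_sum, e2, Complex.ofReal_pow, ← Complex.mul_conj', map_sum]
      simp only [map_sub]
    rw [Complex.ofReal_sum, Finset.sum_congr rfl fun f _ => e1 f, Finset.sum_comm]
    refine Finset.sum_congr rfl fun b _ => ?_
    rw [Finset.sum_comm]
    refine Finset.sum_congr rfl fun b' _ => ?_
    simp only [sub_mul, mul_sub, Finset.sum_sub_distrib, ← Finset.sum_mul, ← Finset.mul_sum,
      hsum, hsum']
    simp
    ring
  have bound : ∀ b b' : Fin B,
      ‖∑ f : Fin D → Fin B, u ^ load f h b * (starRingEnd ℂ) (u ^ load f h b') -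
        (B : ℂ) ^ D * (P * (starRingEnd ℂ) P)‖ ≤
        (B : ℝ) ^ D * (4 * m / B ^ 2) + if b = b' then (B : ℝ) ^ D else 0 := by
    intro b b'
    by_cases hb : b = b'
    · subst hb
      have e : ∀ f : Fin D → Fin B, u ^ load f h b * (starRingEnd ℂ) (u ^ load f h b) = 1 := by
        intro f
        rw [Complex.mul_conj', norm_pow, hu]
        simp
      have hP2 : ‖P‖ ^ 2 ≤ 1 := pow_le_one₀ (norm_nonneg _) hPn
      have hpos : (0 : ℝ) ≤ (B : ℝ) ^ D * (4 * m / B ^ 2) := by positivity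
      rw [Finset.sum_congr rfl fun f _ => e f, Complex.mul_conj', if_pos rfl]
      have e2 : (∑ _f : Fin D → Fin B, (1 : ℂ)) - (B : ℂ) ^ D * (‖P‖ : ℂ) ^ 2 =
          (((B : ℝ) ^ D * (1 - ‖P‖ ^ 2) : ℝ) : ℂ) := by
        simp; ring
      rw [e2, Complex.norm_real, Real.norm_of_nonneg (mul_nonneg (by positivity) (by linarith))]
      have : (B : ℝ) ^ D * (1 - ‖P‖ ^ 2) ≤ (B : ℝ) ^ D * 1 := by
        gcongr
        linarith [sq_nonneg ‖P‖]
      linarith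
    · rw [if_neg hb, add_zero]
      exact norm_sum_hash_pair_le hu hB hb
  have hfin := congrArg norm expand
  rw [Complex.norm_real, Real.norm_of_nonneg (Finset.sum_nonneg fun f _ => sq_nonneg _)] at hfin
  rw [hfin]
  calc _ ≤ ∑ b : Fin B, ∑ b' : Fin B,
        ((B : ℝ) ^ D * (4 * m / B ^ 2) + if b = b' then (B : ℝ) ^ D else 0) :=
        (norm_sum_le _ _).trans (Finset.sum_le_sum fun b _ =>
          (norm_sum_le _ _).trans (Finset.sum_le_sum fun b' _ => bound b b'))
    _ = _ := by
      simp [Finset.sum_add_distrib]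
      field_simp
      ring

end HashMoment

/-- A uniformly random function. -/
def uniformHash (D B : ℕ) [NeZero B] : PMF (Fin D → Fin B) := PMF.uniformOfFintype _

theorem expect_uniformHash {D B : ℕ} [NeZero B] {g : (Fin D → Fin B) → ℝ} (hg : ∀ f, 0 ≤ g f) :
    expect (uniformHash D B) g = ENNReal.ofReal ((∑ f, g f) / (B : ℝ) ^ D) := by
  have hB : (0 : ℝ) < B := by exact_mod_cast NeZero.pos B
  rw [expect, tsum_fintype]
  simp only [uniformHash, PMF.uniformOfFintype_apply]
  rw [← Finset.mul_sum, ← ENNReal.ofReal_sum_of_nonneg fun f _ => hg f, div_eq_inv_mul,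
    ENNReal.ofReal_mul (by positivity), ENNReal.ofReal_inv_of_pos (by positivity)]
  congr 2
  simp

theorem expect_hash_sq_le {D B : ℕ} [NeZero B] {u : ℂ} {h : Fin D → ℕ} (hu : ‖u‖ = 1)
    (hB : 2 ≤ B) :
    expect (uniformHash D B) (fun f => ‖∑ b, u ^ load f h b - charProd B u h‖ ^ 2) ≤
      ENNReal.ofReal (B + 4 * (Finset.univ.filter fun j => h j ≠ 0).card) := by
  have hBr : (0 : ℝ) < B := by exact_mod_cast NeZero.pos B
  rw [expect_uniformHash fun f => sq_nonneg _]
  refine ENNReal.ofReal_le_ofReal ?_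
  rw [div_le_iff₀ (by positivity), mul_comm]
  exact sum_hash_sq_le hu hB

/-- Redefining a hash function with `f j = f j'` arbitrarily at `j'` loses no information. -/
theorem card_collision_le {D B : ℕ} {j j' : Fin D} (hj : j ≠ j') :
    (Finset.univ.filter fun f : Fin D → Fin B => f j = f j').card * B ≤ B ^ D := by
  have h := Finset.card_le_card_of_injOn
    (s := (Finset.univ.filter fun f : Fin D → Fin B => f j = f j') ×ˢ
      (Finset.univ : Finset (Fin B)))
    (t := Finset.univ) (fun x => Function.update x.1 j' x.2) (fun _ _ => by simp) (by
      rintro ⟨f, y⟩ hf ⟨f', y'⟩ hf' he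
      simp only [Finset.coe_product, Set.mem_prod, Finset.mem_coe, Finset.mem_filter,
        Finset.mem_univ, true_and, and_true] at hf hf'
      have hy : y = y' := by simpa using congrFun he j'
      have hne : ∀ i, i ≠ j' → f i = f' i := fun i hi => by simpa [hi] using congrFun he i
      refine Prod.ext (funext fun i => ?_) hy
      by_cases hi : i = j'
      · subst hi
        exact (hf.symm.trans (hne j hj)).trans hf'
      · exact hne i hi)
  simpa using h

/-- A union bound for the collisions of a random hash function. -/
theorem expect_not_injOn_le {D B : ℕ} [NeZero B] (s : Finset (Fin D)) :
    expect (uniformHash D B) ({f | ¬ Set.InjOn f s}.indicator fun _ => 1) ≤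
      ENNReal.ofReal (s.card ^ 2 / B) := by
  classical
  have hBr : (0 : ℝ) < B := by exact_mod_cast NeZero.pos B
  rw [expect_uniformHash fun f => Set.indicator_nonneg (fun _ _ => zero_le_one) f]
  refine ENNReal.ofReal_le_ofReal ?_
  have h1 : ∀ f : Fin D → Fin B, ({f | ¬ Set.InjOn f s}.indicator (fun _ => (1 : ℝ)) f) ≤
      ∑ x ∈ s.offDiag, if f x.1 = f x.2 then (1 : ℝ) else 0 := by
    intro f
    by_cases hf : Set.InjOn f s
    · rw [Set.indicator_of_notMem (by simpa using hf)]
      exact Finset.sum_nonneg fun x _ => by split_ifs <;> simp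
    · rw [Set.indicator_of_mem (by exact hf)]
      simp only [Set.InjOn, not_forall] at hf
      obtain ⟨j, hj, j', hj', he, hne⟩ := hf
      refine le_trans ?_ (Finset.single_le_sum (f := fun x => if f x.1 = f x.2 then (1 : ℝ) else 0)
        (fun x _ => by split_ifs <;> simp)
        (Finset.mem_offDiag.2 ⟨hj, hj', hne⟩ : (j, j') ∈ s.offDiag))
      simp [he]
  have h2 : ∀ x ∈ s.offDiag, ∑ f : Fin D → Fin B, (if f x.1 = f x.2 then (1 : ℝ) else 0) ≤
      (B : ℝ) ^ D / B := by
    intro x hx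
    have := card_collision_le (B := B) (Finset.mem_offDiag.1 hx).2.2
    rw [le_div_iff₀ hBr]
    simp only [Finset.sum_boole]
    exact_mod_cast this
  have h3 : ∑ f : Fin D → Fin B, ({f | ¬ Set.InjOn f s}.indicator (fun _ => (1 : ℝ)) f) ≤
      s.card ^ 2 * ((B : ℝ) ^ D / B) := by
    refine (Finset.sum_le_sum fun f _ => h1 f).trans ?_
    rw [Finset.sum_comm]
    refine (Finset.sum_le_sum h2).trans ?_
    rw [Finset.sum_const, nsmul_eq_mul]
    gcongr
    rw [Finset.offDiag_card, sq]
    exact_mod_cast Nat.sub_le _ _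
  rw [div_le_div_iff₀ (by positivity) hBr]
  calc _ ≤ s.card ^ 2 * ((B : ℝ) ^ D / B) * B := by gcongr
    _ = _ := by field_simp

/-! ### Anonymized histograms through their counts -/

/-- The number of entries of `v` that are at least `r`. -/
def numGE {κ : Type*} [Fintype κ] (r : ℕ) (v : κ → ℕ) : ℕ :=
  (Finset.univ.filter fun j => r ≤ v j).card

/-- The number of entries of `v` that are equal to `r`. -/
def numEq {κ : Type*} [Fintype κ] (r : ℕ) (v : κ → ℕ) : ℕ :=
  (Finset.univ.filter fun j => v j = r).card

section Counts

variable {D : ℕ}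

theorem numGE_eq_sum {κ : Type*} [Fintype κ] (r : ℕ) (v : κ → ℕ) :
    (numGE r v : ℝ) = ∑ j, if r ≤ v j then (1 : ℝ) else 0 := by
  simp [numGE]

theorem numEq_eq_sum {κ : Type*} [Fintype κ] (r : ℕ) (v : κ → ℕ) :
    (numEq r v : ℝ) = ∑ j, if v j = r then (1 : ℝ) else 0 := by
  simp [numEq]

theorem numGE_eq_zero {κ : Type*} [Fintype κ] {r n : ℕ} {v : κ → ℕ} (hv : ∀ j, v j ≤ n)
    (hr : n < r) : numGE r v = 0 := by
  rw [numGE, Finset.card_eq_zero, Finset.filter_eq_empty_iff]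
  intro j _
  have := hv j
  omega

theorem numEq_eq_zero {κ : Type*} [Fintype κ] {r n : ℕ} {v : κ → ℕ} (hv : ∀ j, v j ≤ n)
    (hr : n < r) : numEq r v = 0 := by
  rw [numEq, Finset.card_eq_zero, Finset.filter_eq_empty_iff]
  intro j _
  have := hv j
  omega

theorem numGE_eq_add {κ : Type*} [Fintype κ] (r : ℕ) (v : κ → ℕ) :
    (numGE r v : ℝ) = numEq r v + numGE (r + 1) v := by
  rw [numGE_eq_sum, numGE_eq_sum, numEq_eq_sum, ← Finset.sum_add_distrib]
  refine Finset.sum_congr rfl fun j _ => ?_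
  rcases lt_trichotomy (v j) r with h | h | h
  · rw [if_neg (by omega), if_neg (by omega), if_neg (by omega)]; simp
  · rw [if_pos (by omega), if_pos (by omega), if_neg (by omega)]; simp
  · rw [if_pos (by omega), if_neg (by omega), if_pos (by omega)]; simp

theorem sum_ite_le_eq {n a : ℕ} (ha : a ≤ n) :
    ∑ r ∈ Finset.Icc 1 n, (if r ≤ a then (1 : ℝ) else 0) = a := by
  have : (Finset.Icc 1 n).filter (fun r => r ≤ a) = Finset.Icc 1 a := by
    ext r; simp; omega
  simp [this]

/-- For non-increasing vectors the sets `{j | r ≤ u j}` and `{j | r ≤ v j}` are nested, so the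
`ℓ₁`-error is read off from their sizes. -/
theorem l1Error_le_sum_numGE {n : ℕ} (u v : AnonHist D) (hu : ∀ j, u.1 j ≤ n)
    (hv : ∀ j, v.1 j ≤ n) :
    l1Error u v ≤ ∑ r ∈ Finset.Icc 1 n, |(numGE r u.1 : ℝ) - numGE r v.1| := by
  have h1 : l1Error u v ≤ ∑ j, ∑ r ∈ Finset.Icc 1 n,
      |(if r ≤ u.1 j then (1 : ℝ) else 0) - if r ≤ v.1 j then (1 : ℝ) else 0| := by
    refine Finset.sum_le_sum fun j _ => ?_
    rw [← sum_ite_le_eq (hu j), ← sum_ite_le_eq (hv j), ← Finset.sum_sub_distrib]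
    exact Finset.abs_sum_le_sum_abs _ _
  refine h1.trans (le_of_eq ?_)
  rw [Finset.sum_comm]
  refine Finset.sum_congr rfl fun r _ => ?_
  rw [numGE_eq_sum, numGE_eq_sum, ← Finset.sum_sub_distrib]
  have nested : (∀ j, r ≤ u.1 j → r ≤ v.1 j) ∨ ∀ j, r ≤ v.1 j → r ≤ u.1 j := by
    by_contra! h
    obtain ⟨⟨j, hj, hj'⟩, i, hi, hi'⟩ := h
    rcases le_total i j with hij | hij
    · exact absurd (hj.trans (u.2 hij)) (by omega)
    · exact absurd (hi.trans (v.2 hij)) (by omega)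
  rcases nested with h | h
  · have h2 : ∀ j, (if r ≤ u.1 j then (1 : ℝ) else 0) - (if r ≤ v.1 j then (1 : ℝ) else 0) ≤ 0 := by
      intro j
      have := h j
      split_ifs with h3 h4 <;> simp_all
    rw [abs_of_nonpos (Finset.sum_nonpos fun j _ => h2 j), ← Finset.sum_neg_distrib]
    exact Finset.sum_congr rfl fun j _ => abs_of_nonpos (h2 j)
  · have h2 : ∀ j, 0 ≤ (if r ≤ u.1 j then (1 : ℝ) else 0) - (if r ≤ v.1 j then (1 : ℝ) else 0) := by
      intro j
      have := h j
      split_ifs with h3 h4 <;> simp_all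
    rw [abs_of_nonneg (Finset.sum_nonneg fun j _ => h2 j)]
    exact Finset.sum_congr rfl fun j _ => abs_of_nonneg (h2 j)

/-- A comparison of the numbers of large entries gives one of the sorted entries. -/
theorem le_add_of_numGE_le {T : ℕ} (u v : AnonHist D)
    (h : ∀ r, 1 ≤ r → numGE (r + T) v.1 ≤ numGE r u.1) (j : Fin D) : v.1 j ≤ u.1 j + T := by
  by_contra! hlt
  have h1 := h (u.1 j + 1) (by omega)
  have h2 : (Finset.Iic j).card ≤ numGE (u.1 j + 1 + T) v.1 := Finset.card_le_card fun i hi => by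
    have := v.2 (Finset.mem_Iic.1 hi)
    simp only [Finset.mem_filter, Finset.mem_univ, true_and]
    omega
  have h3 : numGE (u.1 j + 1) u.1 ≤ (Finset.Iio j).card := Finset.card_le_card fun i hi => by
    rw [Finset.mem_Iio]
    by_contra! hij
    have := u.2 hij
    simp only [Finset.mem_filter, Finset.mem_univ, true_and] at hi
    omega
  rw [Fin.card_Iic] at h2
  rw [Fin.card_Iio] at h3
  omega

theorem l2SqError_le_mul_l1Error {T : ℝ} (u v : AnonHist D)
    (h : ∀ j, |(u.1 j : ℝ) - v.1 j| ≤ T) : l2SqError u v ≤ T * l1Error u v := by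
  rw [l2SqError, l1Error, Finset.mul_sum]
  refine Finset.sum_le_sum fun j _ => ?_
  rw [← sq_abs, sq]
  exact mul_le_mul_of_nonneg_right (h j) (abs_nonneg _)

theorem l1Error_le_two_mul {n : ℕ} (u v : AnonHist D) (hu : ∑ j, u.1 j = n)
    (hv : ∑ j, v.1 j = n) : l1Error u v ≤ 2 * n := by
  have hu' : ∑ j, (u.1 j : ℝ) = n := by exact_mod_cast hu
  have hv' : ∑ j, (v.1 j : ℝ) = n := by exact_mod_cast hv
  calc l1Error u v ≤ ∑ j, ((u.1 j : ℝ) + v.1 j) := Finset.sum_le_sum fun j _ => by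
        refine (abs_sub _ _).trans ?_
        rw [Nat.abs_cast, Nat.abs_cast]
    _ = 2 * n := by rw [Finset.sum_add_distrib, hu', hv']; ring

theorem le_of_sum_eq {n : ℕ} {v : Fin D → ℕ} (hv : ∑ j, v j = n) (j : Fin D) : v j ≤ n :=
  hv ▸ Finset.single_le_sum (f := v) (fun _ _ => Nat.zero_le _) (Finset.mem_univ j)

theorem card_ne_zero_le {n : ℕ} {v : Fin D → ℕ} (hv : ∑ j, v j = n) :
    (Finset.univ.filter fun j => v j ≠ 0).card ≤ n := by
  rw [Finset.card_eq_sum_ones, ← hv, Finset.sum_filter]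
  refine Finset.sum_le_sum fun j _ => ?_
  split_ifs with h <;> omega

theorem exists_perm_anonymize (h : Fin D → ℕ) :
    ∃ σ : Equiv.Perm (Fin D), (anonymize h).1 = h ∘ σ :=
  ⟨Fin.revPerm.trans (Tuple.sort h), rfl⟩

theorem numGE_anonymize (r : ℕ) (h : Fin D → ℕ) : numGE r (anonymize h).1 = numGE r h := by
  obtain ⟨σ, hσ⟩ := exists_perm_anonymize h
  have : (numGE r (anonymize h).1 : ℝ) = numGE r h := by
    rw [hσ, numGE_eq_sum, numGE_eq_sum]
    exact Equiv.sum_comp σ fun j => if r ≤ h j then (1 : ℝ) else 0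
  exact_mod_cast this

theorem charProd_anonymize (B : ℕ) (u : ℂ) (h : Fin D → ℕ) :
    charProd B u (anonymize h).1 = charProd B u h := by
  obtain ⟨σ, hσ⟩ := exists_perm_anonymize h
  rw [hσ, charProd, charProd]
  congr 1
  exact Equiv.prod_comp σ fun j => 1 + (u ^ h j - 1) / (B : ℂ)

theorem sum_anonymize (h : Fin D → ℕ) : ∑ j, (anonymize h).1 j = ∑ j, h j := by
  obtain ⟨σ, hσ⟩ := exists_perm_anonymize h
  rw [hσ]
  exact Equiv.sum_comp σ h

theorem sum_histogram {n : ℕ} (z : Fin n → Fin D) : ∑ j, histogram z j = n := by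
  simp only [histogram]
  rw [← Finset.card_eq_sum_card_fiberwise fun i _ => Finset.mem_coe.2 (Finset.mem_univ (z i))]
  simp

end Counts

/-! ### Stability of the logarithm of the hashed characteristic function -/

/-- The primitive root of unity `exp (2 π i / M)`. -/
def rootU (M : ℕ) : ℂ := Complex.exp (2 * Real.pi * Complex.I / M)

theorem norm_rootU_pow (M k : ℕ) : ‖rootU M ^ k‖ = 1 := by
  have : rootU M = Complex.exp (((2 * Real.pi / M : ℝ) : ℂ) * Complex.I) := by
    rw [rootU]; congr 1; push_cast; ring
  rw [norm_pow, this, Complex.norm_exp_ofReal_mul_I, one_pow]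

theorem sum_rootU_pow {M : ℕ} (hM : M ≠ 0) (m : ℕ) :
    ∑ k ∈ Finset.range M, (rootU M ^ k) ^ m = if M ∣ m then (M : ℂ) else 0 := by
  have hprim : IsPrimitiveRoot (rootU M) M := Complex.isPrimitiveRoot_exp M hM
  have h : ∀ k, (rootU M ^ k) ^ m = (rootU M ^ m) ^ k := fun k => by rw [← pow_mul, ← pow_mul']
  simp only [h]
  split_ifs with hd
  · rw [(hprim.pow_eq_one_iff_dvd m).2 hd]; simp
  · have hne : rootU M ^ m ≠ 1 := fun h1 => hd ((hprim.pow_eq_one_iff_dvd m).1 h1)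
    rw [geom_sum_eq hne, ← pow_mul, mul_comm, pow_mul, hprim.pow_eq_one, one_pow, sub_self,
      zero_div]

/-- The sum `∑ j, (u ^ v j - 1)`, the first order part of `charProd B u v - B`. -/
def charSum {D : ℕ} (u : ℂ) (v : Fin D → ℕ) : ℂ := ∑ j, (u ^ v j - 1)

/-- Fourier inversion: the numbers `numEq r v` are averages of the character sums. -/
theorem numEq_eq_sum_charSum {D n r : ℕ} {v : Fin D → ℕ} (hv : ∀ j, v j ≤ n) (hr : 1 ≤ r)
    (hrn : r ≤ n) : ((n + 1 : ℕ) : ℂ) * numEq r v = ∑ k ∈ Finset.range (n + 1),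
      (rootU (n + 1) ^ k) ^ (n + 1 - r) * charSum (rootU (n + 1) ^ k) v := by
  have h1 : ∀ k, (rootU (n + 1) ^ k) ^ (n + 1 - r) * charSum (rootU (n + 1) ^ k) v =
      ∑ j, ((rootU (n + 1) ^ k) ^ (n + 1 - r + v j) - (rootU (n + 1) ^ k) ^ (n + 1 - r)) := by
    intro k
    rw [charSum, Finset.mul_sum]
    exact Finset.sum_congr rfl fun j _ => by rw [mul_sub, pow_add, mul_one]
  have h0 : ¬ n + 1 ∣ n + 1 - r := Nat.not_dvd_of_pos_of_lt (by omega) (by omega)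
  simp only [h1]
  rw [Finset.sum_comm]
  have h2 : ∀ j, ∑ k ∈ Finset.range (n + 1), ((rootU (n + 1) ^ k) ^ (n + 1 - r + v j) -
      (rootU (n + 1) ^ k) ^ (n + 1 - r)) = if v j = r then ((n + 1 : ℕ) : ℂ) else 0 := by
    intro j
    rw [Finset.sum_sub_distrib, sum_rootU_pow n.add_one_ne_zero,
      sum_rootU_pow n.add_one_ne_zero, if_neg h0, sub_zero]
    have hj := hv j
    congr 1
    rw [eq_iff_iff]
    constructor
    · rintro ⟨c, hc⟩
      have hc1 : c = 1 := by
        have hlt : c < 2 := by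
          by_contra! h
          have := Nat.mul_le_mul_left (n + 1) h
          omega
        have : c ≠ 0 := by rintro rfl; omega
        omega
      subst hc1
      omega
    · rintro rfl
      exact ⟨1, by omega⟩
  simp only [h2, numEq, ← Finset.sum_filter, Finset.sum_const, nsmul_eq_mul]
  ring

section Stability

variable {D B n : ℕ} {u : ℂ} {v w : Fin D → ℕ}

/-- The factors of `charProd` are close to exponentials, and the exponents are small since at most
`n` of the entries are positive and `B` is large compared with `n`. -/
theorem norm_exp_sum_sub_prod_le (hu : ‖u‖ = 1) (hB : 16 * (n + 1) ≤ B) (hv : ∑ j, v j = n) :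
    ‖Complex.exp (charSum u v / B) - ∏ j, (1 + (u ^ v j - 1) / B)‖ ≤ 4 * n / (B : ℝ) ^ 2 ∧
      ‖charSum u v / B‖ ≤ 1 / 8 := by
  have hB0 : B ≠ 0 := by omega
  have hBr : (16 : ℝ) * (n + 1) ≤ B := by exact_mod_cast hB
  have hn : (0 : ℝ) ≤ n := Nat.cast_nonneg n
  have hBpos : (0 : ℝ) < B := by linarith
  have hcard : ((Finset.univ.filter fun j => v j ≠ 0).card : ℝ) ≤ n := by
    exact_mod_cast card_ne_zero_le hv
  have hx : ∀ j, ‖(u ^ v j - 1) / (B : ℂ)‖ ≤ if v j ≠ 0 then 2 / (B : ℝ) else 0 := by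
    intro j
    split_ifs with hj
    · rw [norm_div, Complex.norm_natCast]
      gcongr
      refine (norm_sub_le _ _).trans ?_
      rw [norm_pow, hu]; norm_num
    · simp [not_ne_iff.1 hj]
  have hsum : ∀ c : ℝ, 0 ≤ c → ∑ j, (if v j ≠ 0 then c else 0) ≤ n * c := by
    intro c hc
    rw [← Finset.sum_filter, Finset.sum_const, nsmul_eq_mul]
    gcongr
  have e : charSum u v / B = ∑ j, (u ^ v j - 1) / (B : ℂ) := by rw [charSum, Finset.sum_div]
  constructor
  · rw [e, Complex.exp_sum]
    refine (norm_prod_sub_prod_le _ (fun j _ => ?_) fun j _ => norm_one_add_le hu hB0 _).trans ?_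
    · rw [Complex.norm_exp, Real.exp_le_one_iff, Complex.div_natCast_re]
      refine div_nonpos_of_nonpos_of_nonneg ?_ hBpos.le
      have := Complex.re_le_norm (u ^ v j)
      rw [norm_pow, hu, one_pow] at this
      simpa using this
    · have : ∀ j, ‖Complex.exp ((u ^ v j - 1) / (B : ℂ)) - (1 + (u ^ v j - 1) / B)‖ ≤
          if v j ≠ 0 then (2 / (B : ℝ)) ^ 2 else 0 := by
        intro j
        have h1 := hx j
        split_ifs at h1 ⊢ with hj
        · rw [← sub_sub]
          refine (Complex.norm_exp_sub_one_sub_id_le (h1.trans ?_)).trans (by gcongr)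
          rw [div_le_one hBpos]; linarith
        · simp [not_ne_iff.1 hj]
      refine (Finset.sum_le_sum fun j _ => this j).trans ((hsum _ (by positivity)).trans ?_)
      apply le_of_eq; ring
  · rw [e]
    refine (norm_sum_le _ _).trans ((Finset.sum_le_sum fun j _ => hx j).trans
      ((hsum _ (by positivity)).trans ?_))
    rw [mul_div_assoc', div_le_iff₀ hBpos]
    linarith

theorem norm_sub_le_two_mul_norm_exp_sub {a b : ℂ} (ha : ‖a‖ ≤ 1 / 8) (hb : ‖b‖ ≤ 1 / 8) :
    ‖a - b‖ ≤ 2 * ‖Complex.exp a - Complex.exp b‖ := by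
  have hab : ‖a - b‖ ≤ 1 / 4 := (norm_sub_le _ _).trans (by linarith)
  have e : Complex.exp a - Complex.exp b = Complex.exp b * (Complex.exp (a - b) - 1) := by
    rw [mul_sub, ← Complex.exp_add]; ring_nf
  have h1 := Complex.norm_exp_sub_one_sub_id_le (hab.trans (by norm_num))
  have h2 : ‖a - b‖ - ‖a - b‖ ^ 2 ≤ ‖Complex.exp (a - b) - 1‖ := by
    have h3 := norm_sub_norm_le (a - b) (a - b - (Complex.exp (a - b) - 1))
    rw [sub_sub_cancel, ← norm_neg (a - b - _)] at h3
    have : -(a - b - (Complex.exp (a - b) - 1)) = Complex.exp (a - b) - 1 - (a - b) := by ring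
    rw [this] at h3
    linarith
  have h4 : (7 / 8 : ℝ) ≤ ‖Complex.exp b‖ := by
    rw [Complex.norm_exp]
    have := Real.add_one_le_exp b.re
    have := (abs_le.1 (Complex.abs_re_le_norm b)).1
    linarith
  rw [e, norm_mul]
  have h5 : 3 / 4 * ‖a - b‖ ≤ ‖Complex.exp (a - b) - 1‖ := by nlinarith [norm_nonneg (a - b)]
  calc ‖a - b‖ ≤ 2 * (7 / 8 * (3 / 4 * ‖a - b‖)) := by nlinarith [norm_nonneg (a - b)]
    _ ≤ _ := by gcongr

/-- The products `charProd` of two histograms of total `n` determine their character sums up to a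
constant: as `B` is large compared with `n`, taking the logarithm is a well-conditioned map. -/
theorem norm_charSum_sub_le (hu : ‖u‖ = 1) (hB : 16 * (n + 1) ≤ B) (hv : ∑ j, v j = n)
    (hw : ∑ j, w j = n) :
    ‖charSum u v - charSum u w‖ ≤ 2 * ‖charProd B u v - charProd B u w‖ + 1 := by
  have hBr : (16 : ℝ) * (n + 1) ≤ B := by exact_mod_cast hB
  have hn : (0 : ℝ) ≤ n := Nat.cast_nonneg n
  have hBpos : (0 : ℝ) < B := by linarith
  have hBc : (B : ℂ) ≠ 0 := by exact_mod_cast hBpos.ne'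
  obtain ⟨hv1, hv2⟩ := norm_exp_sum_sub_prod_le hu hB hv
  obtain ⟨hw1, hw2⟩ := norm_exp_sum_sub_prod_le hu hB hw
  have h1 := norm_sub_le_two_mul_norm_exp_sub hv2 hw2
  set Pv := ∏ j, (1 + (u ^ v j - 1) / (B : ℂ))
  set Pw := ∏ j, (1 + (u ^ w j - 1) / (B : ℂ))
  have h2 : ‖Complex.exp (charSum u v / B) - Complex.exp (charSum u w / B)‖ ≤
      ‖Pv - Pw‖ + 8 * n / (B : ℝ) ^ 2 := by
    have e : Complex.exp (charSum u v / B) - Complex.exp (charSum u w / B) =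
        (Pv - Pw) + (Complex.exp (charSum u v / B) - Pv) -
          (Complex.exp (charSum u w / B) - Pw) := by ring
    rw [e]
    refine (norm_sub_le _ _).trans ((add_le_add_left (norm_add_le _ _) _).trans ?_)
    have : 8 * n / (B : ℝ) ^ 2 = 4 * n / (B : ℝ) ^ 2 + 4 * n / (B : ℝ) ^ 2 := by ring
    linarith
  have e1 : ‖charSum u v - charSum u w‖ = B * ‖charSum u v / B - charSum u w / B‖ := by
    rw [← sub_div, norm_div, Complex.norm_natCast]
    field_simp
  have e2 : ‖charProd B u v - charProd B u w‖ = B * ‖Pv - Pw‖ := by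
    rw [charProd, charProd, ← mul_sub, norm_mul, Complex.norm_natCast]
  rw [e1, e2]
  calc B * ‖charSum u v / B - charSum u w / B‖ ≤
        B * (2 * (‖Pv - Pw‖ + 8 * n / (B : ℝ) ^ 2)) := by gcongr; exact h1.trans (by gcongr)
    _ = 2 * (B * ‖Pv - Pw‖) + 16 * n / B := by field_simp; ring
    _ ≤ _ := by
      gcongr
      rw [div_le_one hBpos]
      linarith

/-- Close products `charProd` at all roots of unity of order `n + 1` imply close numbers of entries
equal to `r`. The value `r = 0` is excluded as it is not seen by the character sums. -/
theorem abs_numEq_sub_le (hB : 16 * (n + 1) ≤ B) (hv : ∑ j, v j = n) (hw : ∑ j, w j = n) {r : ℕ}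
    (hr : 1 ≤ r) :
    |(numEq r v : ℝ) - numEq r w| ≤ 2 * ((∑ k ∈ Finset.range (n + 1),
      ‖charProd B (rootU (n + 1) ^ k) v - charProd B (rootU (n + 1) ^ k) w‖) / (n + 1)) + 1 := by
  have hpos : (0 : ℝ) < (n : ℝ) + 1 := by positivity
  by_cases hrn : r ≤ n
  · have h1 : ((n + 1 : ℕ) : ℂ) * (((numEq r v : ℝ) - numEq r w : ℝ) : ℂ) =
        ∑ k ∈ Finset.range (n + 1), (rootU (n + 1) ^ k) ^ (n + 1 - r) *
          (charSum (rootU (n + 1) ^ k) v - charSum (rootU (n + 1) ^ k) w) := by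
      simp only [mul_sub, Finset.sum_sub_distrib]
      rw [← numEq_eq_sum_charSum (le_of_sum_eq hv) hr hrn,
        ← numEq_eq_sum_charSum (le_of_sum_eq hw) hr hrn]
      push_cast
      ring
    have h2 := congrArg norm h1
    rw [norm_mul, Complex.norm_natCast, Complex.norm_real, Real.norm_eq_abs] at h2
    have h3 : ((n + 1 : ℕ) : ℝ) * |(numEq r v : ℝ) - numEq r w| ≤
        ∑ k ∈ Finset.range (n + 1), (2 *
          ‖charProd B (rootU (n + 1) ^ k) v - charProd B (rootU (n + 1) ^ k) w‖ + 1) := by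
      rw [h2]
      refine (norm_sum_le _ _).trans (Finset.sum_le_sum fun k _ => ?_)
      rw [norm_mul, norm_pow, norm_rootU_pow, one_pow, one_mul]
      exact norm_charSum_sub_le (norm_rootU_pow _ _) hB hv hw
    rw [Finset.sum_add_distrib, ← Finset.mul_sum] at h3
    rw [← mul_div_assoc, ← sub_le_iff_le_add, le_div_iff₀ hpos]
    simp at h3
    linarith
  · rw [numEq_eq_zero (le_of_sum_eq hv) (by omega), numEq_eq_zero (le_of_sum_eq hw) (by omega)]
    simp only [Nat.cast_zero, sub_self, abs_zero]
    positivity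

/-- The `ℓ₁`-error is controlled by the light statistics `charProd`, which determine the numbers
`numEq r` for `r ≤ T`, and the heavy statistics `numGE r` for `r > T`. -/
theorem l1Error_le_statistics {T : ℕ} (hT : 1 ≤ T) (hB : 16 * (n + 1) ≤ B) (v w : AnonHist D)
    (hv : ∑ j, v.1 j = n) (hw : ∑ j, w.1 j = n) :
    l1Error v w ≤ (T : ℝ) ^ 2 * (2 * ((∑ k ∈ Finset.range (n + 1),
      ‖charProd B (rootU (n + 1) ^ k) v.1 - charProd B (rootU (n + 1) ^ k) w.1‖) / (n + 1)) +
      2 * (∑ r ∈ Finset.Ioc T n, |(numGE r v.1 : ℝ) - numGE r w.1|) + 1) := by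
  set X := (∑ k ∈ Finset.range (n + 1),
      ‖charProd B (rootU (n + 1) ^ k) v.1 - charProd B (rootU (n + 1) ^ k) w.1‖) / ((n : ℝ) + 1)
  set Y := ∑ r ∈ Finset.Ioc T n, |(numGE r v.1 : ℝ) - numGE r w.1|
  have hX : 0 ≤ X := by positivity
  have hY : 0 ≤ Y := Finset.sum_nonneg fun r _ => abs_nonneg _
  have htop : |(numGE (T + 1) v.1 : ℝ) - numGE (T + 1) w.1| ≤ Y := by
    by_cases h : T + 1 ≤ n
    · exact Finset.single_le_sum (f := fun r => |(numGE r v.1 : ℝ) - numGE r w.1|)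
        (fun r _ => abs_nonneg _) (Finset.mem_Ioc.2 ⟨by omega, h⟩)
    · rw [numGE_eq_zero (le_of_sum_eq hv) (by omega), numGE_eq_zero (le_of_sum_eq hw) (by omega)]
      simpa using hY
  have hlow : ∀ d, d < T → |(numGE (T - d) v.1 : ℝ) - numGE (T - d) w.1| ≤
      (d + 1 : ℕ) * (2 * X + 1) + Y := by
    intro d
    induction d with
    | zero =>
      intro _
      rw [numGE_eq_add, numGE_eq_add (T - 0) w.1]
      have h1 := abs_numEq_sub_le hB hv hw (r := T - 0) (by omega)
      have e : (numEq (T - 0) v.1 + numGE (T - 0 + 1) v.1 : ℝ) -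
          (numEq (T - 0) w.1 + numGE (T - 0 + 1) w.1) =
          ((numEq (T - 0) v.1 : ℝ) - numEq (T - 0) w.1) +
          ((numGE (T + 1) v.1 : ℝ) - numGE (T + 1) w.1) := by simp; ring
      rw [e]
      refine (abs_add_le _ _).trans ?_
      push_cast
      linarith
    | succ d ih =>
      intro hd
      rw [numGE_eq_add, numGE_eq_add (T - (d + 1)) w.1]
      have h1 := abs_numEq_sub_le hB hv hw (r := T - (d + 1)) (by omega)
      have h2 := ih (by omega)
      have e0 : T - (d + 1) + 1 = T - d := by omega
      rw [e0]
      have e : (numEq (T - (d + 1)) v.1 + numGE (T - d) v.1 : ℝ) -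
          (numEq (T - (d + 1)) w.1 + numGE (T - d) w.1) =
          ((numEq (T - (d + 1)) v.1 : ℝ) - numEq (T - (d + 1)) w.1) +
          ((numGE (T - d) v.1 : ℝ) - numGE (T - d) w.1) := by ring
      rw [e]
      refine (abs_add_le _ _).trans ?_
      push_cast at h2 ⊢
      linarith
  have hlow' : ∀ r ∈ Finset.Icc 1 T, |(numGE r v.1 : ℝ) - numGE r w.1| ≤ T * (2 * X + 1) + Y := by
    intro r hr
    rw [Finset.mem_Icc] at hr
    have h1 := hlow (T - r) (by omega)
    rw [Nat.sub_sub_self hr.2] at h1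
    refine h1.trans ?_
    gcongr
    omega
  have hTr : (1 : ℝ) ≤ T := by exact_mod_cast hT
  calc l1Error v w ≤ ∑ r ∈ Finset.Icc 1 n, |(numGE r v.1 : ℝ) - numGE r w.1| :=
        l1Error_le_sum_numGE v w (le_of_sum_eq hv) (le_of_sum_eq hw)
    _ ≤ ∑ r ∈ Finset.Icc 1 T ∪ Finset.Ioc T n, |(numGE r v.1 : ℝ) - numGE r w.1| := by
        refine Finset.sum_le_sum_of_subset_of_nonneg (fun r hr => ?_) fun r _ _ => abs_nonneg _
        simp only [Finset.mem_union, Finset.mem_Icc, Finset.mem_Ioc] at hr ⊢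
        omega
    _ = ∑ r ∈ Finset.Icc 1 T, |(numGE r v.1 : ℝ) - numGE r w.1| + Y := by
        refine Finset.sum_union (Finset.disjoint_left.2 fun r hr hr' => ?_)
        simp only [Finset.mem_Icc, Finset.mem_Ioc] at hr hr'
        omega
    _ ≤ T * (T * (2 * X + 1) + Y) + Y := by
        gcongr
        refine (Finset.sum_le_sum hlow').trans (le_of_eq ?_)
        rw [Finset.sum_const, nsmul_eq_mul, Nat.card_Icc, Nat.add_sub_cancel]
    _ ≤ _ := by
        have h1 : Y ≤ T ^ 2 * Y := le_mul_of_one_le_left hY (one_le_pow₀ hTr)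
        have h2 : T * Y ≤ T ^ 2 * Y := by
          gcongr
          exact le_self_pow₀ hTr two_ne_zero
        linarith

end Stability

section Statistics

/-! ### First moments from second moments -/

/-- The first moment is bounded by the second one through `2 |g| ≤ a g ^ 2 + 1 / a`, with a weight
`a` that is free to be chosen. -/
theorem expect_abs_le {α : Type*} (p : PMF α) {g : α → ℝ} {V a : ℝ} (hV : 0 ≤ V) (ha : 0 < a)
    (h : expect p (fun x => g x ^ 2) ≤ ENNReal.ofReal V) :
    expect p (fun x => |g x|) ≤ ENNReal.ofReal ((a * V + 1 / a) / 2) := by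
  have h1 : ∀ x, |g x| ≤ a / 2 * g x ^ 2 + 1 / (2 * a) := by
    intro x
    have h2 : 0 ≤ (a * |g x| - 1) ^ 2 / (2 * a) := by positivity
    have h3 : (a * |g x| - 1) ^ 2 / (2 * a) = a / 2 * |g x| ^ 2 + 1 / (2 * a) - |g x| := by
      field_simp; ring
    rw [h3, sq_abs] at h2
    linarith
  calc expect p (fun x => |g x|) ≤ expect p (fun x => a / 2 * g x ^ 2 + 1 / (2 * a)) :=
        expect_mono p h1
    _ = ENNReal.ofReal (a / 2) * expect p (fun x => g x ^ 2) + ENNReal.ofReal (1 / (2 * a)) := by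
        rw [expect_add p (fun x => by positivity) (fun x => by positivity),
          expect_const_mul p (by positivity), expect_const]
    _ ≤ ENNReal.ofReal (a / 2) * ENNReal.ofReal V + ENNReal.ofReal (1 / (2 * a)) := by gcongr
    _ = _ := by
        rw [← ENNReal.ofReal_mul (by positivity), ← ENNReal.ofReal_add (by positivity)
          (by positivity)]
        congr 1
        field_simp

theorem expect_pairPMF {α β : Type*} (p : PMF α) (p' : PMF β) (g : α × β → ℝ) :
    expect (pairPMF p p') g = ∑' a, p a * expect p' fun b => g (a, b) := by
  rw [pairPMF, expect_bind]
  exact tsum_congr fun a => by rw [expect_map]; rfl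

theorem expect_pairPMF_le {α β : Type*} (p : PMF α) (p' : PMF β) {g : α × β → ℝ} {c : ℝ≥0∞}
    (h : ∀ a, expect p' (fun b => g (a, b)) ≤ c) : expect (pairPMF p p') g ≤ c := by
  rw [expect_pairPMF]
  calc _ ≤ ∑' a, p a * c := ENNReal.tsum_le_tsum fun a => by gcongr; exact h a
    _ = c := by rw [ENNReal.tsum_mul_right, p.tsum_coe, one_mul]

theorem expect_pairPMF_fst {α β : Type*} (p : PMF α) (p' : PMF β) (g : α → ℝ) :
    expect (pairPMF p p') (fun x => g x.1) = expect p g := by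
  rw [expect_pairPMF]
  simp only [expect_const]
  rfl

theorem expect_pairPMF_snd_le {α β : Type*} (p : PMF α) (p' : PMF β) {g : β → ℝ} {c : ℝ≥0∞}
    (h : expect p' g ≤ c) : expect (pairPMF p p') (fun x => g x.2) ≤ c :=
  expect_pairPMF_le p p' fun _ => h

/-! ### The statistics of a noisy table -/

variable {D : ℕ}

/-- The statistic of a noisy table of hashed counts that estimates `charProd B u`. -/
def lightStat {B : ℕ} (q : ℝ) (u : ℂ) (y : Fin B → ℤ) : ℂ :=
  ⟨∑ b, denoise q (fun x => (u ^ x).re) (y b), ∑ b, denoise q (fun x => (u ^ x).im) (y b)⟩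

/-- The statistic of a noisy table of collision-free counts that estimates `numGE r`. -/
def heavyStat {B : ℕ} (q : ℝ) (r : ℕ) (y : Fin B → ℤ) : ℝ := ∑ b, denoise q (geInd r) (y b)

theorem noiseVar_nonneg (q : Set.Ioo (0 : ℝ) 1) : 0 ≤ noiseVar q := by
  have := q.2.1
  rw [noiseVar]
  positivity

theorem expect_piPMF_inl {κ κ' : Type*} [Fintype κ] [Fintype κ'] (q : Set.Ioo (0 : ℝ) 1)
    (f : ℤ → ℝ) (hf : ∀ x, |f x| ≤ 1) (c : κ → ℤ) (v : κ → ℝ)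
    (hv : ∀ b, ∫ x, (denoise q f (c b + x) - f (c b)) ^ 2 ∂(dlap q).toMeasure ≤ v b) :
    expect (piPMF fun _ : κ ⊕ κ' => dlap q)
      (fun ξ => (∑ b, denoise q f (c b + ξ (Sum.inl b)) - ∑ b, f (c b)) ^ 2) ≤
      ENNReal.ofReal (∑ b, v b) := by
  have h := expect_sq_sum_denoise_le (ι := κ ⊕ κ') q (Sum.elim (fun _ => f) fun _ _ => 0)
    (by rintro (b | b) x <;> simp [hf]) (Sum.elim c fun _ => 0) (Sum.elim v fun _ => 0)
    (by rintro (b | b)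
        · exact hv b
        · simp [denoise_zero])
  simpa [Fintype.sum_sum_type, denoise_zero] using h

theorem expect_piPMF_inr {κ κ' : Type*} [Fintype κ] [Fintype κ'] (q : Set.Ioo (0 : ℝ) 1)
    (f : ℤ → ℝ) (hf : ∀ x, |f x| ≤ 1) (c : κ' → ℤ) (v : κ' → ℝ)
    (hv : ∀ b, ∫ x, (denoise q f (c b + x) - f (c b)) ^ 2 ∂(dlap q).toMeasure ≤ v b) :
    expect (piPMF fun _ : κ ⊕ κ' => dlap q)
      (fun ξ => (∑ b, denoise q f (c b + ξ (Sum.inr b)) - ∑ b, f (c b)) ^ 2) ≤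
      ENNReal.ofReal (∑ b, v b) := by
  have h := expect_sq_sum_denoise_le (ι := κ ⊕ κ') q (Sum.elim (fun _ _ => 0) fun _ => f)
    (by rintro (b | b) x <;> simp [hf]) (Sum.elim (fun _ => 0) c) (Sum.elim (fun _ => 0) v)
    (by rintro (b | b)
        · simp [denoise_zero]
        · exact hv b)
  simpa [Fintype.sum_sum_type, denoise_zero] using h

/-- The expected error of the light statistic, over the hash function and the noise. -/
theorem expect_lightStat_le {B : ℕ} [NeZero B] {κ : Type*} [Fintype κ] (q : Set.Ioo (0 : ℝ) 1)
    {u : ℂ} (hu : ‖u‖ = 1) (hB : 2 ≤ B) {n : ℕ} (hn : n ≠ 0) (hBn : B ≤ 32 * n) {h : Fin D → ℕ}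
    (hh : ∑ j, h j = n) :
    expect (pairPMF (uniformHash D B) (piPMF fun _ : κ ⊕ Fin B => dlap q))
      (fun x => ‖lightStat q u (fun b => (load x.1 h b : ℤ) + x.2 (Sum.inr b)) -
        charProd B u h‖) ≤ ENNReal.ofReal ((32 * noiseVar q + 20) * √n) := by
  have hnpos : (0 : ℝ) < n := by exact_mod_cast Nat.pos_of_ne_zero hn
  have hs : 0 < √(n : ℝ) := Real.sqrt_pos.2 hnpos
  have hss : √(n : ℝ) * √(n : ℝ) = n := Real.mul_self_sqrt hnpos.le
  have hnv := noiseVar_nonneg q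
  have hBn' : (B : ℝ) ≤ 32 * n := by exact_mod_cast hBn
  have hz : ∀ x : ℤ, ‖u ^ x‖ = 1 := fun x => by rw [norm_zpow, hu, one_zpow]
  have hre : ∀ x : ℤ, |(u ^ x).re| ≤ 1 := fun x => (Complex.abs_re_le_norm _).trans (hz x).le
  have him : ∀ x : ℤ, |(u ^ x).im| ≤ 1 := fun x => (Complex.abs_im_le_norm _).trans (hz x).le
  -- The error splits into the noise in the real and imaginary parts and the randomness of the hash.
  let a : (Fin D → Fin B) × (κ ⊕ Fin B → ℤ) → ℝ := fun x =>
    ∑ b, denoise q (fun x => (u ^ x).re) (load x.1 h b + x.2 (Sum.inr b)) -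
      ∑ b, (u ^ (load x.1 h b : ℤ)).re
  let a' : (Fin D → Fin B) × (κ ⊕ Fin B → ℤ) → ℝ := fun x =>
    ∑ b, denoise q (fun x => (u ^ x).im) (load x.1 h b + x.2 (Sum.inr b)) -
      ∑ b, (u ^ (load x.1 h b : ℤ)).im
  let w : (Fin D → Fin B) → ℝ := fun f => ‖∑ b, u ^ load f h b - charProd B u h‖
  have hsplit : ∀ x : (Fin D → Fin B) × (κ ⊕ Fin B → ℤ),
      ‖lightStat q u (fun b => (load x.1 h b : ℤ) + x.2 (Sum.inr b)) - charProd B u h‖ ≤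
        (|a x| + |a' x|) + |w x.1| := by
    intro x
    have e : lightStat q u (fun b => (load x.1 h b : ℤ) + x.2 (Sum.inr b)) - charProd B u h =
        (lightStat q u (fun b => (load x.1 h b : ℤ) + x.2 (Sum.inr b)) -
          ∑ b, u ^ load x.1 h b) + (∑ b, u ^ load x.1 h b - charProd B u h) := by ring
    rw [e]
    refine (norm_add_le _ _).trans (add_le_add ?_ (le_abs_self _))
    refine (Complex.norm_le_abs_re_add_abs_im _).trans (le_of_eq ?_)
    simp [a, a', lightStat]
  have hvar : (B : ℝ) * noiseVar q ≤ 32 * noiseVar q * n := by nlinarith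
  have hnoise : ∀ c : ℤ → ℝ, (∀ x, |c x| ≤ 1) →
      expect (pairPMF (uniformHash D B) (piPMF fun _ : κ ⊕ Fin B => dlap q))
        (fun x => |∑ b, denoise q c (load x.1 h b + x.2 (Sum.inr b)) -
          ∑ b, c (load x.1 h b : ℤ)|) ≤
        ENNReal.ofReal ((1 / √n * (32 * noiseVar q * n) + 1 / (1 / √n)) / 2) := by
    intro c hc
    refine expect_pairPMF_le _ _ fun f => expect_abs_le _ (by positivity) (by positivity) ?_
    refine (expect_piPMF_inr q c hc (fun b => (load f h b : ℤ)) (fun _ => noiseVar q)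
      fun b => integral_sq_denoise_le q hc _).trans (ENNReal.ofReal_le_ofReal ?_)
    simpa using hvar
  have hw : expect (pairPMF (uniformHash D B) (piPMF fun _ : κ ⊕ Fin B => dlap q))
      (fun x => |w x.1|) ≤ ENNReal.ofReal ((1 / √n * (36 * n) + 1 / (1 / √n)) / 2) := by
    rw [expect_pairPMF_fst _ _ fun f => |w f|]
    refine expect_abs_le _ (by positivity) (by positivity) ?_
    refine (expect_hash_sq_le hu hB).trans (ENNReal.ofReal_le_ofReal ?_)
    have : ((Finset.univ.filter fun j => h j ≠ 0).card : ℝ) ≤ n := by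
      exact_mod_cast card_ne_zero_le hh
    linarith
  have e1 : (1 / √n * (32 * noiseVar q * n) + 1 / (1 / √n)) / 2 =
      (32 * noiseVar q + 1) / 2 * √n := by
    field_simp
    rw [sq, hss]; ring
  have e2 : (1 / √n * (36 * n) + 1 / (1 / √n)) / 2 = 37 / 2 * √n := by
    field_simp
    rw [sq, hss]; ring
  rw [e1] at hnoise
  rw [e2] at hw
  calc _ ≤ expect (pairPMF (uniformHash D B) (piPMF fun _ : κ ⊕ Fin B => dlap q))
        (fun x => (|a x| + |a' x|) + |w x.1|) := expect_mono _ hsplit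
    _ ≤ ENNReal.ofReal ((32 * noiseVar q + 1) / 2 * √n) +
        ENNReal.ofReal ((32 * noiseVar q + 1) / 2 * √n) + ENNReal.ofReal (37 / 2 * √n) := by
        rw [expect_add _ (fun x => by positivity) fun x => abs_nonneg _,
          expect_add _ (fun x => abs_nonneg _) fun x => abs_nonneg _]
        exact add_le_add (add_le_add (hnoise _ hre) (hnoise _ him)) hw
    _ ≤ _ := by
        rw [← ENNReal.ofReal_add (by positivity) (by positivity),
          ← ENNReal.ofReal_add (by positivity) (by positivity)]
        refine ENNReal.ofReal_le_ofReal ?_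
        nlinarith

/-! ### The heavy statistic -/

theorem load_eq_of_injOn {B : ℕ} {f : Fin D → Fin B} {h : Fin D → ℕ}
    (hf : Set.InjOn f (Finset.univ.filter fun j => h j ≠ 0)) {j : Fin D} (hj : h j ≠ 0) :
    load f h (f j) = h j := by
  rw [load, Finset.sum_eq_single j]
  · simp
  · intro i _ hij
    by_cases hi : h i = 0
    · simp [hi]
    · exact if_neg fun he => hij (hf (by simpa using hi) (by simpa using hj) he)
  · simp

/-- Without collisions the hashed table has the same positive counts as the histogram. -/
theorem numGE_load {B : ℕ} {f : Fin D → Fin B} {h : Fin D → ℕ}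
    (hf : Set.InjOn f (Finset.univ.filter fun j => h j ≠ 0)) {r : ℕ} (hr : 1 ≤ r) :
    numGE r (load f h) = numGE r h := by
  have e : (Finset.univ.filter fun b => r ≤ load f h b) =
      (Finset.univ.filter fun j => r ≤ h j).image f := by
    ext b
    simp only [Finset.mem_filter, Finset.mem_univ, true_and, Finset.mem_image]
    constructor
    · intro hb
      have : load f h b ≠ 0 := by omega
      obtain ⟨j, _, hj⟩ := Finset.exists_ne_zero_of_sum_ne_zero this
      have hjb : f j = b := by
        by_contra hne
        exact hj (if_neg hne)
      rw [if_pos hjb] at hj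
      refine ⟨j, ?_, hjb⟩
      rwa [← load_eq_of_injOn hf hj, hjb]
    · rintro ⟨j, hj, rfl⟩
      rwa [load_eq_of_injOn hf (by omega)]
  rw [numGE, numGE, e, Finset.card_image_of_injOn]
  refine hf.mono fun j hj => ?_
  simp only [Finset.coe_filter, Finset.mem_univ, true_and, Set.mem_ofPred_eq] at hj ⊢
  omega

theorem sum_load {B : ℕ} (f : Fin D → Fin B) (h : Fin D → ℕ) : ∑ b, load f h b = ∑ j, h j := by
  simp only [load]
  rw [Finset.sum_comm]
  simp

theorem sum_comp_le_tsum {s : Finset ℕ} {φ : ℕ → ℕ} (hφ : Set.InjOn φ s) {g : ℕ → ℝ}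
    (hg : ∀ m, 0 ≤ g m) (hs : Summable g) : ∑ r ∈ s, g (φ r) ≤ ∑' m, g m := by
  rw [← Finset.sum_image (f := g) hφ]
  exact hs.sum_le_tsum _ fun m _ => hg m

/-- The contribution of one bucket with count `c` to the variances of all heavy statistics,
weighted by `r`: it is proportional to `c` except for a tiny term, so that the sum over all buckets
is `O (n)`. -/
theorem sum_mul_pow_natAbs_le (q : Set.Ioo (0 : ℝ) 1) (T n c : ℕ) :
    ∑ r ∈ Finset.Ioc T n, (r : ℝ) * (q : ℝ) ^ ((c : ℤ) - r).natAbs ≤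
      2 * c / (1 - q) ^ 2 + n * q ^ T / (1 - q) := by
  have h0 := q.2.1
  have h1 : 0 < 1 - (q : ℝ) := by linarith [q.2.2]
  rcases Nat.eq_zero_or_pos c with rfl | hc
  · -- Empty buckets: the factor `q ^ T` compensates for their large number.
    have hsum : ∑ r ∈ Finset.Ioc T n, (q : ℝ) ^ (r - T) ≤ (1 - (q : ℝ))⁻¹ := by
      rw [← tsum_geometric_of_lt_one h0.le q.2.2]
      refine sum_comp_le_tsum (φ := fun r => r - T) (fun r hr r' hr' he => ?_)
        (fun m => by positivity) (summable_geometric_of_lt_one h0.le q.2.2)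
      simp only [Finset.coe_Ioc, Set.mem_Ioc] at hr hr' he
      omega
    have hle : ∀ r ∈ Finset.Ioc T n, (r : ℝ) * (q : ℝ) ^ (((0 : ℕ) : ℤ) - r).natAbs ≤
        n * (q : ℝ) ^ T * (q : ℝ) ^ (r - T) := by
      intro r hr
      rw [Finset.mem_Ioc] at hr
      rw [mul_assoc, ← pow_add]
      have e1 : (((0 : ℕ) : ℤ) - r).natAbs = r := by omega
      have e2 : T + (r - T) = r := by omega
      rw [e1, e2]
      gcongr
      exact hr.2
    refine (Finset.sum_le_sum hle).trans ?_
    rw [← Finset.mul_sum]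
    simp only [Nat.cast_zero, mul_zero, zero_div, zero_add]
    rw [div_eq_mul_inv]
    gcongr
  · have hsm : Summable fun m : ℕ => ((m : ℝ) + 1) * (q : ℝ) ^ m := by
      have := (hasSum_coe_mul_geometric_of_norm_lt_one (r := (q : ℝ))
        (by rw [Real.norm_of_nonneg h0.le]; exact q.2.2)).summable.add
        (summable_geometric_of_lt_one h0.le q.2.2)
      exact this.congr fun m => by ring
    have htsum : ∑' m : ℕ, ((m : ℝ) + 1) * (q : ℝ) ^ m = 1 / (1 - (q : ℝ)) ^ 2 := by
      have := ((hasSum_coe_mul_geometric_of_norm_lt_one (r := (q : ℝ))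
        (by rw [Real.norm_of_nonneg h0.le]; exact q.2.2)).add
        (hasSum_geometric_of_lt_one h0.le q.2.2)).tsum_eq
      rw [show (1 : ℝ) / (1 - (q : ℝ)) ^ 2 = q / (1 - (q : ℝ)) ^ 2 + (1 - (q : ℝ))⁻¹ by
        field_simp; ring, ← this]
      exact tsum_congr fun m => by ring
    have hpart : ∀ s : Finset ℕ, Set.InjOn (fun r : ℕ => ((c : ℤ) - r).natAbs) s →
        ∑ r ∈ s, (((((c : ℤ) - r).natAbs : ℕ) : ℝ) + 1) * (q : ℝ) ^ ((c : ℤ) - r).natAbs ≤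
          1 / (1 - (q : ℝ)) ^ 2 := by
      intro s hs
      rw [← htsum]
      exact sum_comp_le_tsum (g := fun m : ℕ => ((m : ℝ) + 1) * (q : ℝ) ^ m) hs
        (fun m => by positivity) hsm
    have hle : ∀ r ∈ Finset.Ioc T n, (r : ℝ) * (q : ℝ) ^ ((c : ℤ) - r).natAbs ≤
        c * ((((((c : ℤ) - r).natAbs : ℕ) : ℝ) + 1) * (q : ℝ) ^ ((c : ℤ) - r).natAbs) := by
      intro r _
      rw [← mul_assoc]
      gcongr
      have h2 : r ≤ c * (((c : ℤ) - r).natAbs + 1) := by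
        have h3 : r ≤ c + ((c : ℤ) - r).natAbs := by omega
        nlinarith [Nat.zero_le ((c : ℤ) - r).natAbs]
      exact_mod_cast h2
    refine (Finset.sum_le_sum hle).trans ?_
    rw [← Finset.mul_sum, ← Finset.sum_filter_add_sum_filter_not _ (fun r => r ≤ c)]
    have ha := hpart ((Finset.Ioc T n).filter fun r => r ≤ c) fun r hr r' hr' he => by
      simp only [Finset.coe_filter, Set.mem_ofPred_eq] at hr hr' he
      omega
    have hb := hpart ((Finset.Ioc T n).filter fun r => ¬ r ≤ c) fun r hr r' hr' he => by
      simp only [Finset.coe_filter, Set.mem_ofPred_eq] at hr hr' he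
      omega
    have hpos : 0 ≤ n * (q : ℝ) ^ T / (1 - q) := by positivity
    calc _ ≤ (c : ℝ) * (1 / (1 - (q : ℝ)) ^ 2 + 1 / (1 - (q : ℝ)) ^ 2) := by gcongr
      _ = 2 * c / (1 - (q : ℝ)) ^ 2 := by ring
      _ ≤ _ := le_add_of_nonneg_right hpos

/-- The expected total error of the heavy statistics over the noise, for a hash function without
collisions. First moments are bounded with the weight `r / √n` at threshold `r`, so that the
variance terms are summable by `sum_mul_pow_natAbs_le` and the remaining terms form a
harmonic series. -/
theorem expect_heavyStat_le {B B' n T : ℕ} (q : Set.Ioo (0 : ℝ) 1) (hn : n ≠ 0)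
    (hT : (B' : ℝ) * q ^ T ≤ 1) {h : Fin D → ℕ} (hh : ∑ j, h j = n) {f : Fin D → Fin B'}
    (hf : Set.InjOn f (Finset.univ.filter fun j => h j ≠ 0)) :
    expect (piPMF fun _ : Fin B' ⊕ Fin B => dlap q) (fun ξ => ∑ r ∈ Finset.Ioc T n,
      |heavyStat q r (fun b => (load f h b : ℤ) + ξ (Sum.inl b)) - numGE r h|) ≤
      ENNReal.ofReal ((3 * noiseVar q / (1 - q) ^ 2 + (1 + Real.log n)) / 2 * √n) := by
  have h0 := q.2.1
  have h1 : 0 < 1 - (q : ℝ) := by linarith [q.2.2]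
  have hnpos : (0 : ℝ) < n := by exact_mod_cast Nat.pos_of_ne_zero hn
  have hs : 0 < √(n : ℝ) := Real.sqrt_pos.2 hnpos
  have hss : √(n : ℝ) * √(n : ℝ) = n := Real.mul_self_sqrt hnpos.le
  have hnv := noiseVar_nonneg q
  let V : ℕ → ℝ := fun r => ∑ b, noiseVar q * (q : ℝ) ^ ((load f h b : ℤ) - r).natAbs
  have hV : ∀ r, 0 ≤ V r := fun r => Finset.sum_nonneg fun b _ => by positivity
  have hone : ∀ r ∈ Finset.Ioc T n, expect (piPMF fun _ : Fin B' ⊕ Fin B => dlap q) (fun ξ =>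
      |heavyStat q r (fun b => (load f h b : ℤ) + ξ (Sum.inl b)) - numGE r h|) ≤
      ENNReal.ofReal ((r / √n * V r + 1 / (r / √n)) / 2) := by
    intro r hr
    have hr1 : 1 ≤ r := by rw [Finset.mem_Ioc] at hr; omega
    have hr0 : (0 : ℝ) < r := by exact_mod_cast hr1
    refine expect_abs_le _ (hV r) (by positivity) ?_
    have h2 := expect_piPMF_inl (κ' := Fin B) q (geInd r) (abs_geInd_le r)
      (fun b => (load f h b : ℤ)) _ fun b => integral_sq_denoise_geInd_le q r (load f h b : ℤ)
    have e : ∑ b, geInd r (load f h b : ℤ) = numGE r h := by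
      rw [← numGE_load hf hr1, numGE_eq_sum]
      exact Finset.sum_congr rfl fun b _ => by simp [geInd]
    rw [e] at h2
    exact h2
  rw [expect_sum _ _ fun r ξ => abs_nonneg _]
  refine (Finset.sum_le_sum hone).trans ?_
  rw [← ENNReal.ofReal_sum_of_nonneg fun r _ => by have := hV r; positivity]
  refine ENNReal.ofReal_le_ofReal ?_
  have hharm : ∑ r ∈ Finset.Ioc T n, 1 / (r : ℝ) ≤ 1 + Real.log n := by
    refine le_trans ?_ (harmonic_le_one_add_log n)
    rw [harmonic_eq_sum_Icc]
    push_cast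
    refine (Finset.sum_le_sum_of_subset_of_nonneg (fun r hr => ?_) fun r _ _ => by positivity).trans
      (le_of_eq (Finset.sum_congr rfl fun r _ => one_div _))
    rw [Finset.mem_Ioc] at hr
    rw [Finset.mem_Icc]
    omega
  have hrV : ∑ r ∈ Finset.Ioc T n, (r : ℝ) * V r ≤ 3 * noiseVar q / (1 - q) ^ 2 * n := by
    have e : ∑ r ∈ Finset.Ioc T n, (r : ℝ) * V r = noiseVar q * ∑ b,
        ∑ r ∈ Finset.Ioc T n, (r : ℝ) * (q : ℝ) ^ ((load f h b : ℤ) - r).natAbs := by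
      simp only [V, Finset.mul_sum]
      rw [Finset.sum_comm]
      exact Finset.sum_congr rfl fun b _ => Finset.sum_congr rfl fun r _ => by ring
    have hl : ∑ b, (load f h b : ℝ) = n := by exact_mod_cast (sum_load f h).trans hh
    rw [e]
    calc _ ≤ noiseVar q * ∑ b, (2 * (load f h b : ℝ) / (1 - q) ^ 2 + n * q ^ T / (1 - q)) := by
          gcongr with b
          exact sum_mul_pow_natAbs_le q T n _
      _ = noiseVar q * (2 * n / (1 - q) ^ 2 + n * (B' * q ^ T) / (1 - q)) := by
          rw [Finset.sum_add_distrib, ← Finset.sum_div, ← Finset.mul_sum, hl,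
            Finset.sum_const, Finset.card_univ, Fintype.card_fin, nsmul_eq_mul]
          ring
      _ ≤ noiseVar q * (2 * n / (1 - q) ^ 2 + n * 1 / (1 - q) ^ 2) := by
          gcongr
          exact pow_le_of_le_one h1.le (by linarith) two_ne_zero
      _ = _ := by ring
  have e : ∑ r ∈ Finset.Ioc T n, ((r : ℝ) / √n * V r + 1 / (r / √n)) / 2 =
      (1 / √n * ∑ r ∈ Finset.Ioc T n, (r : ℝ) * V r +
        √n * ∑ r ∈ Finset.Ioc T n, 1 / (r : ℝ)) / 2 := by
    rw [Finset.mul_sum, Finset.mul_sum, ← Finset.sum_add_distrib, Finset.sum_div]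
    refine Finset.sum_congr rfl fun r hr => ?_
    rw [one_div_div]
    ring
  rw [e]
  calc _ ≤ (1 / √n * (3 * noiseVar q / (1 - q) ^ 2 * n) + √n * (1 + Real.log n)) / 2 := by gcongr
    _ = _ := by
      rw [← hss, Real.sqrt_mul_self hs.le]
      field_simp

end Statistics

section Estimator

/-! ### The estimator -/

variable {D B B' : ℕ}

/-- The distance of the statistics of the noisy table `x` from the values expected for `v`. -/
def objective (q : ℝ) (n T : ℕ) (x : Fin B' ⊕ Fin B → ℤ) (v : Fin D → ℕ) : ℝ :=
  (∑ k ∈ Finset.range (n + 1), ‖lightStat q (rootU (n + 1) ^ k) (fun b => x (Sum.inr b)) -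
    charProd B (rootU (n + 1) ^ k) v‖) / (n + 1) +
  ∑ r ∈ Finset.Ioc T n, |heavyStat q r (fun b => x (Sum.inl b)) - numGE r v|

/-- The number of buckets of the first table with noisy count at least `r`. -/
def numNoisyGE (r : ℕ) (x : Fin B' ⊕ Fin B → ℤ) : ℕ :=
  (Finset.univ.filter fun b => (r : ℤ) ≤ x (Sum.inl b)).card

/-- `v` has total `n`, and its sorted entries agree up to `T` with the noisy counts of the
first table, expressed through the numbers of entries above a threshold. -/
def Admissible (n T : ℕ) (x : Fin B' ⊕ Fin B → ℤ) (v : Fin D → ℕ) : Prop :=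
  ∑ j, v j = n ∧
    ∀ r, 1 ≤ r → numGE (r + T) v ≤ numNoisyGE r x ∧ numNoisyGE (r + T) x ≤ numGE r v

theorem finite_sum_eq (D n : ℕ) : {v : AnonHist D | ∑ j, v.1 j = n}.Finite :=
  ((Set.finite_Iic fun _ : Fin D => n).preimage Subtype.val_injective.injOn).subset
    fun _ hv => le_of_sum_eq hv

/-- An admissible minimizer of the objective, or an arbitrary vector of total `n` if there is no
admissible one. -/
theorem exists_estimator (q : ℝ) (n T : ℕ) (x : Fin B' ⊕ Fin B → ℤ) :
    ∃ v : AnonHist D, (∀ w : AnonHist D, ∑ j, w.1 j = n → ∑ j, v.1 j = n) ∧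
      ∀ w : AnonHist D, Admissible n T x w.1 →
        Admissible n T x v.1 ∧ objective q n T x v.1 ≤ objective q n T x w.1 := by
  by_cases h : ∃ w : AnonHist D, Admissible n T x w.1
  · obtain ⟨v, hv, hmin⟩ := Set.exists_min_image {w : AnonHist D | Admissible n T x w.1}
      (fun w => objective q n T x w.1)
      ((finite_sum_eq D n).subset fun w hw => hw.1) h
    exact ⟨v, fun _ _ => hv.1, fun w hw => ⟨hv, hmin w hw⟩⟩
  · by_cases h' : ∃ w : AnonHist D, ∑ j, w.1 j = n
    · obtain ⟨w, hw⟩ := h'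
      exact ⟨w, fun _ _ => hw, fun w' hw' => absurd ⟨w', hw'⟩ h⟩
    · exact ⟨⟨fun _ => 0, fun _ _ _ => le_rfl⟩, fun w hw => absurd ⟨w, hw⟩ h',
        fun w' hw' => absurd ⟨w', hw'⟩ h⟩

/-- The estimator: it fits an anonymized histogram to the statistics of the noisy table. -/
def estimator (D : ℕ) (q : ℝ) (n T : ℕ) (x : Fin B' ⊕ Fin B → ℤ) : AnonHist D :=
  (exists_estimator q n T x).choose

theorem sum_estimator {q : ℝ} {n T : ℕ} {x : Fin B' ⊕ Fin B → ℤ} {w : AnonHist D}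
    (hw : ∑ j, w.1 j = n) : ∑ j, (estimator D q n T x).1 j = n :=
  (exists_estimator q n T x).choose_spec.1 w hw

theorem estimator_spec {q : ℝ} {n T : ℕ} {x : Fin B' ⊕ Fin B → ℤ} {w : AnonHist D}
    (hw : Admissible n T x w.1) : Admissible n T x (estimator D q n T x).1 ∧
      objective q n T x (estimator D q n T x).1 ≤ objective q n T x w.1 :=
  (exists_estimator q n T x).choose_spec.2 w hw

theorem objective_nonneg (q : ℝ) (n T : ℕ) (x : Fin B' ⊕ Fin B → ℤ) (v : Fin D → ℕ) :
    0 ≤ objective q n T x v := by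
  rw [objective]
  positivity

theorem objective_anonymize (q : ℝ) (n T : ℕ) (x : Fin B' ⊕ Fin B → ℤ) (h : Fin D → ℕ) :
    objective q n T x (anonymize h).1 = objective q n T x h := by
  simp only [objective, numGE_anonymize, charProd_anonymize]

/-- Two admissible vectors are both within `T` of the noisy counts. -/
theorem abs_sub_le_of_admissible {n T : ℕ} {x : Fin B' ⊕ Fin B → ℤ} {v w : AnonHist D}
    (hv : Admissible n T x v.1) (hw : Admissible n T x w.1) (j : Fin D) :
    |(v.1 j : ℝ) - w.1 j| ≤ 2 * T := by
  have key : ∀ v w : AnonHist D, Admissible n T x v.1 → Admissible n T x w.1 →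
      v.1 j ≤ w.1 j + (T + T) := fun v w hv hw =>
    le_add_of_numGE_le w v (fun r hr => by
      rw [← add_assoc]
      exact ((hv.2 (r + T) (by omega)).1).trans (hw.2 r hr).2) j
  have h1 : (v.1 j : ℝ) ≤ w.1 j + (T + T) := by exact_mod_cast key v w hv hw
  have h2 : (w.1 j : ℝ) ≤ v.1 j + (T + T) := by exact_mod_cast key w v hw hv
  rw [abs_le]
  constructor <;> linarith

/-- By minimality the statistics of the estimator are within twice the objective of those of `u`. -/
theorem errors_le_of_admissible {q : ℝ} {n T : ℕ} (hT : 1 ≤ T) (hB : 16 * (n + 1) ≤ B)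
    {x : Fin B' ⊕ Fin B → ℤ} {u : AnonHist D} (hu : Admissible n T x u.1) :
    l1Error u (estimator D q n T x) ≤ 2 * T ^ 3 * (4 * objective q n T x u.1 + 1) ∧
      l2SqError u (estimator D q n T x) ≤ 2 * T ^ 3 * (4 * objective q n T x u.1 + 1) := by
  obtain ⟨hv, hmin⟩ := estimator_spec (q := q) hu
  set v := estimator D q n T x
  have hTr : (1 : ℝ) ≤ T := by exact_mod_cast hT
  have h1 := l1Error_le_statistics hT hB u v hu.1 hv.1
  have hX : (∑ k ∈ Finset.range (n + 1), ‖charProd B (rootU (n + 1) ^ k) u.1 -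
      charProd B (rootU (n + 1) ^ k) v.1‖) / ((n : ℝ) + 1) +
      ∑ r ∈ Finset.Ioc T n, |(numGE r u.1 : ℝ) - numGE r v.1| ≤
      objective q n T x u.1 + objective q n T x v.1 := by
    rw [objective, objective, add_add_add_comm, ← add_div, ← Finset.sum_add_distrib,
      ← Finset.sum_add_distrib]
    gcongr with k _ r _
    · rw [norm_sub_rev (lightStat _ _ _) (charProd B _ u.1)]
      exact norm_sub_le_norm_sub_add_norm_sub _ _ _
    · rw [abs_sub_comm (heavyStat _ _ _) (numGE r u.1 : ℝ)]
      exact abs_sub_le _ _ _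
  have hO := objective_nonneg q n T x u.1
  have h2 : l1Error u v ≤ T ^ 2 * (4 * objective q n T x u.1 + 1) := by
    refine h1.trans ?_
    gcongr
    linarith
  have h3 := l2SqError_le_mul_l1Error u v (abs_sub_le_of_admissible hu hv)
  constructor
  · refine h2.trans ?_
    gcongr
    calc (T : ℝ) ^ 2 ≤ T ^ 3 := pow_le_pow_right₀ hTr (by norm_num)
      _ ≤ 2 * T ^ 3 := by linarith [pow_pos (by linarith : (0 : ℝ) < T) 3]
  · calc _ ≤ 2 * T * l1Error u v := h3
      _ ≤ 2 * T * (T ^ 2 * (4 * objective q n T x u.1 + 1)) := by gcongr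
      _ = _ := by ring

theorem errors_le_of_sum_eq {n : ℕ} (hn : 1 ≤ n) (u v : AnonHist D) (hu : ∑ j, u.1 j = n)
    (hv : ∑ j, v.1 j = n) : l1Error u v ≤ 2 * n ^ 2 ∧ l2SqError u v ≤ 2 * n ^ 2 := by
  have h1 := l1Error_le_two_mul u v hu hv
  have hn' : (1 : ℝ) ≤ n := by exact_mod_cast hn
  have h2 := l2SqError_le_mul_l1Error (T := n) u v fun j => by
    have hj1 : (u.1 j : ℝ) ≤ n := by exact_mod_cast le_of_sum_eq hu j
    have hj2 : (v.1 j : ℝ) ≤ n := by exact_mod_cast le_of_sum_eq hv j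
    rw [abs_le]
    constructor <;> linarith [(Nat.cast_nonneg (u.1 j) : (0 : ℝ) ≤ _),
      (Nat.cast_nonneg (v.1 j) : (0 : ℝ) ≤ _)]
  constructor <;> nlinarith

/-- The true histogram is admissible unless there is a collision in the first table or the noise
of one of its buckets is large. -/
theorem admissible_of_good {n T : ℕ} {h : Fin D → ℕ} (hh : ∑ j, h j = n) {f : Fin D → Fin B'}
    (hf : Set.InjOn f (Finset.univ.filter fun j => h j ≠ 0)) {x : Fin B' ⊕ Fin B → ℤ}
    (hx : ∀ b, |x (Sum.inl b) - load f h b| ≤ T) : Admissible n T x h := by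
  refine ⟨hh, fun r hr => ⟨?_, ?_⟩⟩
  · rw [← numGE_load hf (by omega)]
    refine Finset.card_le_card fun b hb => ?_
    have := abs_le.1 (hx b)
    simp only [Finset.mem_filter, Finset.mem_univ, true_and] at hb ⊢
    omega
  · rw [← numGE_load hf hr]
    refine Finset.card_le_card fun b hb => ?_
    have := abs_le.1 (hx b)
    simp only [Finset.mem_filter, Finset.mem_univ, true_and] at hb ⊢
    omega

/-! ### The error of the mechanism -/

/-- The two buckets of an item: one in each table. -/
def hashLoc (s : (Fin D → Fin B') × (Fin D → Fin B)) (j : Fin D) :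
    (Fin B' ⊕ Fin B) × (Fin B' ⊕ Fin B) := (Sum.inl (s.1 j), Sum.inr (s.2 j))

theorem load_histogram {n : ℕ} (f : Fin D → Fin B) (z : Fin n → Fin D) (b : Fin B) :
    load f (histogram z) b = ∑ i, if f (z i) = b then 1 else 0 := by
  simp only [load, histogram, Finset.card_filter]
  have : ∀ j, (if f j = b then ∑ i, (if z i = j then 1 else 0) else 0) =
      ∑ i, if z i = j then (if f (z i) = b then 1 else 0) else 0 := by
    intro j
    split_ifs with hj
    · exact Finset.sum_congr rfl fun i _ => by
        by_cases hi : z i = j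
        · simp [hi, hj]
        · simp [hi]
    · exact (Finset.sum_eq_zero fun i _ => by
        by_cases hi : z i = j
        · simp [hi, hj]
        · simp [hi]).symm
  rw [Finset.sum_congr rfl fun j _ => this j, Finset.sum_comm]
  simp

theorem tableOf_hashLoc {n : ℕ} (s : (Fin D → Fin B') × (Fin D → Fin B)) (z : Fin n → Fin D) :
    tableOf (1 : ℤ) (hashLoc s) z = Sum.elim (fun b => (load s.1 (histogram z) b : ℤ))
      fun b => (load s.2 (histogram z) b : ℤ) := by
  funext b
  rcases b with b | b
  · simp [tableOf, itemVec, hashLoc, load_histogram, Pi.single_apply, eq_comm]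
  · simp [tableOf, itemVec, hashLoc, load_histogram, Pi.single_apply, eq_comm]

/-- The constant in the bound for the expected objective. -/
def objectiveConst (q : ℝ) : ℝ := 32 * noiseVar q + 21 + 3 * noiseVar q / (1 - q) ^ 2

theorem one_le_log_add_two {n : ℕ} (hn : 1 ≤ n) : 1 ≤ Real.log ((n : ℝ) + 2) := by
  have hn' : (1 : ℝ) ≤ n := by exact_mod_cast hn
  rw [Real.le_log_iff_exp_le (by linarith)]
  linarith [Real.exp_one_lt_three]

/-- The law of the pair of hash functions and the noise. -/
def seedNoise (D B' B : ℕ) [NeZero B'] [NeZero B] (q : Set.Ioo (0 : ℝ) 1) :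
    PMF (((Fin D → Fin B') × (Fin D → Fin B)) × (Fin B' ⊕ Fin B → ℤ)) :=
  pairPMF (pairPMF (uniformHash D B') (uniformHash D B)) (piPMF fun _ => dlap q)

theorem expect_seedNoise [NeZero B'] [NeZero B] (q : Set.Ioo (0 : ℝ) 1)
    (g : ((Fin D → Fin B') × (Fin D → Fin B)) × (Fin B' ⊕ Fin B → ℤ) → ℝ) :
    expect (seedNoise D B' B q) g = ∑' f, uniformHash D B' f *
      expect (pairPMF (uniformHash D B) (piPMF fun _ => dlap q))
        fun y => g ((f, y.1), y.2) := by
  have e : seedNoise D B' B q = (pairPMF (uniformHash D B')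
      (pairPMF (uniformHash D B) (piPMF fun _ => dlap q))).map fun y => ((y.1, y.2.1), y.2.2) := by
    simp [seedNoise, pairPMF, PMF.map, PMF.bind_bind, Function.comp_def]
  rw [e, expect_map, expect_pairPMF]
  rfl

theorem expect_seedNoise_le [NeZero B'] [NeZero B] (q : Set.Ioo (0 : ℝ) 1)
    {g : ((Fin D → Fin B') × (Fin D → Fin B)) × (Fin B' ⊕ Fin B → ℤ) → ℝ} {c : ℝ≥0∞}
    (h : ∀ f, expect (pairPMF (uniformHash D B) (piPMF fun _ => dlap q))
        (fun y => g ((f, y.1), y.2)) ≤ c) : expect (seedNoise D B' B q) g ≤ c := by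
  rw [expect_seedNoise]
  calc _ ≤ ∑' f, uniformHash D B' f * c := ENNReal.tsum_le_tsum fun f => by gcongr; exact h f
    _ = c := by rw [ENNReal.tsum_mul_right, PMF.tsum_coe, one_mul]

/-- The noisy table of a histogram `h`. -/
def noisyTable (h : Fin D → ℕ)
    (y : ((Fin D → Fin B') × (Fin D → Fin B)) × (Fin B' ⊕ Fin B → ℤ)) : Fin B' ⊕ Fin B → ℤ :=
  Sum.elim (fun b => (load y.1.1 h b : ℤ) + y.2 (Sum.inl b))
    fun b => (load y.1.2 h b : ℤ) + y.2 (Sum.inr b)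

/-- The hash functions of the first table that have no collision of items of positive count. -/
def collisionFree (B' : ℕ) (h : Fin D → ℕ) : Set (Fin D → Fin B') :=
  {f | Set.InjOn f (Finset.univ.filter fun j => h j ≠ 0 : Finset (Fin D))}

theorem expect_objective_le [NeZero B'] [NeZero B] (q : Set.Ioo (0 : ℝ) 1) {n T : ℕ} (hn : 1 ≤ n)
    (hB : 2 ≤ B) (hBn : B ≤ 32 * n) (hT : (B' : ℝ) * q ^ T ≤ 1) {h : Fin D → ℕ}
    (hh : ∑ j, h j = n) :
    expect (seedNoise D B' B q) (fun y => (collisionFree B' h).indicator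
      (fun _ => objective q n T (noisyTable h y) h) y.1.1) ≤
      ENNReal.ofReal (objectiveConst q * (√n * Real.log ((n : ℝ) + 2))) := by
  have hnv := noiseVar_nonneg q
  have h1 : 0 < 1 - (q : ℝ) := by linarith [q.2.2]
  have hn0 : n ≠ 0 := by omega
  have hnr : (1 : ℝ) ≤ n := by exact_mod_cast hn
  have hlog := one_le_log_add_two hn
  have hlogn : Real.log n ≤ Real.log ((n : ℝ) + 2) := Real.log_le_log (by linarith) (by linarith)
  have hlogn0 : 0 ≤ Real.log n := Real.log_nonneg hnr
  refine expect_seedNoise_le q fun f => ?_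
  by_cases hf : f ∈ collisionFree B' h
  swap
  · simp only [Set.indicator_of_notMem hf]
    simp [expect]
  simp only [Set.indicator_of_mem hf, objective, noisyTable, Sum.elim_inl, Sum.elim_inr]
  rw [expect_add _ (fun y => by positivity) fun y => by positivity]
  have hlight : expect (pairPMF (uniformHash D B) (piPMF fun _ : Fin B' ⊕ Fin B => dlap q))
      (fun y => (∑ k ∈ Finset.range (n + 1), ‖lightStat q (rootU (n + 1) ^ k)
        (fun b => (load y.1 h b : ℤ) + y.2 (Sum.inr b)) -
          charProd B (rootU (n + 1) ^ k) h‖) / ((n : ℝ) + 1)) ≤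
      ENNReal.ofReal ((32 * noiseVar q + 20) * √n) := by
    simp only [div_eq_inv_mul]
    rw [expect_const_mul _ (by positivity), expect_sum _ _ fun k y => norm_nonneg _]
    refine (mul_le_mul_right (Finset.sum_le_sum fun k _ =>
      expect_lightStat_le q (norm_rootU_pow (n + 1) k) hB hn0 hBn hh) _).trans ?_
    rw [Finset.sum_const, Finset.card_range, ← ENNReal.ofReal_nsmul,
      ← ENNReal.ofReal_mul (by positivity)]
    refine ENNReal.ofReal_le_ofReal (le_of_eq ?_)
    rw [nsmul_eq_mul]
    push_cast
    field_simp
  have hheavy := expect_pairPMF_snd_le (uniformHash D B) _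
    (expect_heavyStat_le (B := B) q hn0 hT hh hf)
  refine (add_le_add hlight hheavy).trans ?_
  rw [← ENNReal.ofReal_add (by positivity) (by positivity)]
  refine ENNReal.ofReal_le_ofReal ?_
  have hs : 0 ≤ √(n : ℝ) := Real.sqrt_nonneg _
  have hc : 0 ≤ 3 * noiseVar q / (1 - (q : ℝ)) ^ 2 := by positivity
  have key : (32 * noiseVar q + 20) + (3 * noiseVar q / (1 - (q : ℝ)) ^ 2 + (1 + Real.log n)) / 2 ≤
      objectiveConst q * Real.log ((n : ℝ) + 2) := by
    rw [objectiveConst]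
    nlinarith
  calc _ = ((32 * noiseVar q + 20) +
        (3 * noiseVar q / (1 - (q : ℝ)) ^ 2 + (1 + Real.log n)) / 2) * √n := by ring
    _ ≤ objectiveConst q * Real.log ((n : ℝ) + 2) * √n := by gcongr
    _ = _ := by ring

/-- If the histogram is admissible then its objective bounds the error, and otherwise the trivial
bound `2 n ^ 2` applies on the event of a collision or of large noise in the first table. -/
theorem errors_le_pointwise {q : ℝ} {n T : ℕ} (hn : 1 ≤ n) (hT : 1 ≤ T) (hB : 16 * (n + 1) ≤ B)
    {h : Fin D → ℕ} (hh : ∑ j, h j = n)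
    (y : ((Fin D → Fin B') × (Fin D → Fin B)) × (Fin B' ⊕ Fin B → ℤ)) {err : ℝ}
    (herr : err = l1Error (anonymize h) (estimator D q n T (noisyTable h y)) ∨
      err = l2SqError (anonymize h) (estimator D q n T (noisyTable h y))) :
    err ≤ 2 * T ^ 3 * (4 * (collisionFree B' h).indicator
        (fun _ => objective q n T (noisyTable h y) h) y.1.1 + 1) +
      (2 * n ^ 2 * (collisionFree B' h)ᶜ.indicator (fun _ => 1) y.1.1 +
      2 * n ^ 2 * {ξ : Fin B' ⊕ Fin B → ℤ | ∃ b ∈ Finset.univ.map Function.Embedding.inl,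
        (T : ℤ) ≤ |ξ b|}.indicator (fun _ => 1) y.2) := by
  have hsum : ∑ j, (anonymize h).1 j = n := (sum_anonymize h).trans hh
  have hO := objective_nonneg q n T (noisyTable h y) h
  have hbad := errors_le_of_sum_eq hn (anonymize h) (estimator D q n T (noisyTable h y)) hsum
    (sum_estimator hsum)
  have hbad' : err ≤ 2 * n ^ 2 := by rcases herr with rfl | rfl; exacts [hbad.1, hbad.2]
  have hpos1 : 0 ≤ (collisionFree B' h).indicator
      (fun _ => objective q n T (noisyTable h y) h) y.1.1 :=
    Set.indicator_nonneg (fun _ _ => hO) _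
  have hpos2 : (0 : ℝ) ≤ {ξ : Fin B' ⊕ Fin B → ℤ | ∃ b ∈ Finset.univ.map Function.Embedding.inl,
        (T : ℤ) ≤ |ξ b|}.indicator (fun _ => 1) y.2 :=
    Set.indicator_nonneg (fun _ _ => zero_le_one) _
  by_cases hf : y.1.1 ∈ collisionFree B' h
  swap
  · rw [Set.indicator_of_mem (s := (collisionFree B' h)ᶜ) hf, mul_one]
    have : 0 ≤ 2 * (T : ℝ) ^ 3 * (4 * (collisionFree B' h).indicator
        (fun _ => objective q n T (noisyTable h y) h) y.1.1 + 1) := by positivity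
    have : 0 ≤ 2 * (n : ℝ) ^ 2 * {ξ : Fin B' ⊕ Fin B → ℤ | ∃ b ∈ Finset.univ.map
        Function.Embedding.inl, (T : ℤ) ≤ |ξ b|}.indicator (fun _ => 1) y.2 := by positivity
    linarith
  rw [Set.indicator_of_mem hf, Set.indicator_of_notMem (s := (collisionFree B' h)ᶜ) (by simpa)]
  by_cases hξ : ∃ b ∈ Finset.univ.map Function.Embedding.inl, (T : ℤ) ≤ |y.2 b|
  · rw [Set.indicator_of_mem (by exact hξ), mul_one]
    have : 0 ≤ 2 * (T : ℝ) ^ 3 * (4 * objective q n T (noisyTable h y) h + 1) := by positivity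
    linarith
  · rw [Set.indicator_of_notMem (by exact hξ)]
    have hadm : Admissible n T (noisyTable h y) h := admissible_of_good hh hf fun b => by
      by_contra! hb
      refine hξ ⟨Sum.inl b, by simp, ?_⟩
      simp only [noisyTable, Sum.elim_inl, add_sub_cancel_left] at hb
      exact hb.le
    have hadm' : Admissible n T (noisyTable h y) (anonymize h).1 := by
      refine ⟨hsum, fun r hr => ?_⟩
      rw [numGE_anonymize, numGE_anonymize]
      exact hadm.2 r hr
    have hgood := errors_le_of_admissible (q := q) hT hB hadm'
    rw [objective_anonymize] at hgood
    have : err ≤ 2 * T ^ 3 * (4 * objective q n T (noisyTable h y) h + 1) := by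
      rcases herr with rfl | rfl
      exacts [hgood.1, hgood.2]
    linarith

/-- The expected error, when the first table is so large that collisions are unlikely and the
threshold `T` is so large that the noise rarely exceeds it. -/
theorem expect_errors_le [NeZero B'] [NeZero B] (q : Set.Ioo (0 : ℝ) 1) {n T : ℕ} (hn : 1 ≤ n)
    (hT : 1 ≤ T) (hB : 16 * (n + 1) ≤ B) (hBn : B ≤ 32 * n) (hB' : (n + 1) ^ 4 ≤ B')
    (hqT : (B' : ℝ) * q ^ T ≤ 1 / (n + 1) ^ 2) {h : Fin D → ℕ} (hh : ∑ j, h j = n)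
    {err : AnonHist D → AnonHist D → ℝ} (herr : err = l1Error ∨ err = l2SqError) :
    expect (seedNoise D B' B q)
      (fun y => err (anonymize h) (estimator D q n T (noisyTable h y))) ≤
      ENNReal.ofReal (2 * T ^ 3 * (4 * (objectiveConst q * (√n * Real.log ((n : ℝ) + 2))) + 1)
        + 6) := by
  have hnv := noiseVar_nonneg q
  have h0 := q.2.1
  have h1 : 0 < 1 - (q : ℝ) := by linarith [q.2.2]
  have hnr : (1 : ℝ) ≤ n := by exact_mod_cast hn
  have hlog := one_le_log_add_two hn
  have hC : 0 ≤ objectiveConst q := by rw [objectiveConst]; positivity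
  have hB'r : ((n : ℝ) + 1) ^ 4 ≤ B' := by exact_mod_cast hB'
  have hqT1 : (B' : ℝ) * q ^ T ≤ 1 := hqT.trans (by
    rw [div_le_one (by positivity)]
    exact one_le_pow₀ (by linarith))
  have hobj := expect_objective_le q hn (by omega : 2 ≤ B) hBn hqT1 hh
  have hcol : expect (seedNoise D B' B q)
      (fun y => (collisionFree B' h)ᶜ.indicator (fun _ => 1) y.1.1) ≤
      ENNReal.ofReal (1 / (n : ℝ) ^ 2) := by
    have e := expect_pairPMF_fst (pairPMF (uniformHash D B') (uniformHash D B))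
      (piPMF fun _ : Fin B' ⊕ Fin B => dlap q)
      fun s => (collisionFree B' h)ᶜ.indicator (fun _ => (1 : ℝ)) s.1
    rw [seedNoise, e, expect_pairPMF_fst]
    refine (expect_not_injOn_le (B := B') (Finset.univ.filter fun j => h j ≠ 0)).trans
      (ENNReal.ofReal_le_ofReal ?_)
    have hcard : ((Finset.univ.filter fun j => h j ≠ 0).card : ℝ) ≤ n := by
      exact_mod_cast card_ne_zero_le hh
    calc _ ≤ (n : ℝ) ^ 2 / (n + 1) ^ 4 := by gcongr
      _ ≤ (n : ℝ) ^ 2 / n ^ 4 := by gcongr; linarith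
      _ = _ := by field_simp
  have htail : expect (seedNoise D B' B q) (fun y => {ξ : Fin B' ⊕ Fin B → ℤ |
      ∃ b ∈ Finset.univ.map Function.Embedding.inl, (T : ℤ) ≤ |ξ b|}.indicator (fun _ => 1) y.2) ≤
      ENNReal.ofReal (2 / (n : ℝ) ^ 2) := by
    refine expect_pairPMF_snd_le _ _ ((expect_exists_le q _ T).trans
      (ENNReal.ofReal_le_ofReal ?_))
    rw [Finset.card_map, Finset.card_univ, Fintype.card_fin]
    calc (B' : ℝ) * (2 * q ^ T) = 2 * (B' * q ^ T) := by ring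
      _ ≤ 2 * (1 / (n + 1) ^ 2) := by gcongr
      _ ≤ 2 * (1 / n ^ 2) := by gcongr; linarith
      _ = _ := by ring
  have hpos1 : ∀ y : ((Fin D → Fin B') × (Fin D → Fin B)) × (Fin B' ⊕ Fin B → ℤ),
      0 ≤ (collisionFree B' h).indicator (fun _ => objective q n T (noisyTable h y) h) y.1.1 :=
    fun y => Set.indicator_nonneg (fun _ _ => objective_nonneg _ _ _ _ _) _
  have hpos2 : ∀ y : ((Fin D → Fin B') × (Fin D → Fin B)) × (Fin B' ⊕ Fin B → ℤ),
      (0 : ℝ) ≤ (collisionFree B' h)ᶜ.indicator (fun _ => 1) y.1.1 :=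
    fun y => Set.indicator_nonneg (fun _ _ => zero_le_one) _
  have hpos3 : ∀ y : ((Fin D → Fin B') × (Fin D → Fin B)) × (Fin B' ⊕ Fin B → ℤ),
      (0 : ℝ) ≤ {ξ : Fin B' ⊕ Fin B → ℤ | ∃ b ∈ Finset.univ.map Function.Embedding.inl,
        (T : ℤ) ≤ |ξ b|}.indicator (fun _ => 1) y.2 :=
    fun y => Set.indicator_nonneg (fun _ _ => zero_le_one) _
  refine (expect_mono _ fun y => errors_le_pointwise (q := q) hn hT hB hh y
    (by rcases herr with rfl | rfl; exacts [Or.inl rfl, Or.inr rfl])).trans ?_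
  rw [expect_add _ (fun y => mul_nonneg (by positivity) (by linarith [hpos1 y]))
      (fun y => add_nonneg (mul_nonneg (by positivity) (hpos2 y))
        (mul_nonneg (by positivity) (hpos3 y))),
    expect_add _ (fun y => mul_nonneg (by positivity) (hpos2 y))
      (fun y => mul_nonneg (by positivity) (hpos3 y)),
    expect_const_mul _ (by positivity), expect_const_mul _ (by positivity),
    expect_const_mul _ (by positivity),
    expect_add _ (fun y => by linarith [hpos1 y]) (fun y => zero_le_one),
    expect_const_mul _ (by norm_num), expect_const]
  have hlogpos : 0 ≤ √(n : ℝ) * Real.log ((n : ℝ) + 2) := by positivity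
  calc _ ≤ ENNReal.ofReal (2 * T ^ 3) * (ENNReal.ofReal 4 *
        ENNReal.ofReal (objectiveConst q * (√n * Real.log ((n : ℝ) + 2))) + ENNReal.ofReal 1) +
        (ENNReal.ofReal (2 * n ^ 2) * ENNReal.ofReal (1 / (n : ℝ) ^ 2) +
          ENNReal.ofReal (2 * n ^ 2) * ENNReal.ofReal (2 / (n : ℝ) ^ 2)) := by gcongr
    _ = _ := by
      rw [← ENNReal.ofReal_mul (by norm_num), ← ENNReal.ofReal_add (by positivity) (by norm_num),
        ← ENNReal.ofReal_mul (by positivity), ← ENNReal.ofReal_mul (by positivity),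
        ← ENNReal.ofReal_mul (by positivity), ← ENNReal.ofReal_add (by positivity) (by positivity),
        ← ENNReal.ofReal_add (by positivity) (by positivity)]
      congr 2
      field_simp
      norm_num

/-- The output law of both mechanisms as the estimator of a random noisy table. -/
theorem tableLaw_hashLoc [NeZero B'] [NeZero B] (q : Set.Ioo (0 : ℝ) 1) {n T : ℕ}
    (z : Fin n → Fin D) :
    tableLaw (pairPMF (uniformHash D B') (uniformHash D B)) hashLoc q
      (fun _ => estimator D q n T) z =
      (seedNoise D B' B q).map fun y => estimator D q n T (noisyTable (histogram z) y) := by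
  have e : ∀ (s : (Fin D → Fin B') × (Fin D → Fin B)) (ξ : Fin B' ⊕ Fin B → ℤ),
      tableOf 1 (hashLoc s) z + ξ = noisyTable (histogram z) (s, ξ) := by
    intro s ξ
    rw [tableOf_hashLoc]
    funext b
    rcases b with b | b <;> simp [noisyTable]
  have e' : seedNoise D B' B q = (pairPMF (uniformHash D B') (uniformHash D B)).bind fun s =>
      (piPMF fun _ => dlap q).map fun ξ => (s, ξ) := rfl
  rw [tableLaw, e', PMF.map_bind]
  simp only [PMF.map_comp, Function.comp_def, e]

/-- The factor in front of `√n * log (n + 2) ^ 4`. The term `24 / ε + 1` is the ratio of the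
threshold and the logarithm. -/
def errorConst (ε : ℝ) : ℝ :=
  2 * (24 / ε + 1) ^ 3 * (4 * objectiveConst (Real.exp (-(ε / 4))) + 1) + 6

/-- The threshold `T` between light and heavy counts. It makes `exp (-ε T / 4)`, which up to a
factor `2` bounds the probability of noise of size at least `T`, at most `(n + 2) ^ (-6)`. -/
def threshold (ε : ℝ) (n : ℕ) : ℕ := ⌈24 * Real.log ((n : ℝ) + 2) / ε⌉₊

/-- The sizes of the tables and the threshold are such that collisions, and large noise in one of
the `(n + 1) ^ 4` buckets of the first table, have probability `O (n ^ (-2))`. Each of the three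
factors `T` of the error bound, and the harmonic series, gives a logarithm. -/
theorem errorAtMost_tableLaw {ε : ℝ} (hε : 0 < ε) {n : ℕ} (hn : 1 ≤ n) (D : ℕ) :
    ErrorAtMost (n := n) (D := D)
      (tableLaw (pairPMF (uniformHash D ((n + 1) ^ 4)) (uniformHash D (16 * (n + 1)))) hashLoc
        (ratio ε hε) fun _ => estimator D (ratio ε hε) n (threshold ε n))
      (errorConst ε * (√(n : ℝ) * Real.log ((n : ℝ) + 2) ^ (4 : ℝ))) := by
  have hnr : (1 : ℝ) ≤ n := by exact_mod_cast hn
  set Λ := Real.log ((n : ℝ) + 2) with hΛ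
  have hlog : 1 ≤ Λ := one_le_log_add_two hn
  set T := threshold ε n with hT
  have hTpos : 1 ≤ T := Nat.one_le_iff_ne_zero.2 (Nat.ceil_pos.2 (by positivity)).ne'
  have hTle : (T : ℝ) ≤ (24 / ε + 1) * Λ := by
    have := (Nat.ceil_lt_add_one (by positivity : 0 ≤ 24 * Λ / ε)).le
    calc (T : ℝ) ≤ 24 * Λ / ε + 1 := this
      _ ≤ 24 * Λ / ε + Λ := by gcongr
      _ = _ := by ring
  have hq : (ratio ε hε : ℝ) = Real.exp (-(ε / 4)) := rfl
  have hqT : (((n + 1) ^ 4 : ℕ) : ℝ) * (ratio ε hε : ℝ) ^ T ≤ 1 / ((n : ℝ) + 1) ^ 2 := by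
    have h1 : (ratio ε hε : ℝ) ^ T ≤ 1 / ((n : ℝ) + 2) ^ 6 := by
      rw [hq, ← Real.exp_nat_mul, ← Real.exp_log (by positivity : (0 : ℝ) < 1 / ((n : ℝ) + 2) ^ 6),
        Real.exp_le_exp, one_div, Real.log_inv, Real.log_pow]
      have h2 : 24 * Λ / ε ≤ T := Nat.le_ceil _
      rw [div_le_iff₀ hε] at h2
      push_cast
      linarith
    calc (((n + 1) ^ 4 : ℕ) : ℝ) * (ratio ε hε : ℝ) ^ T ≤
          (((n + 1) ^ 4 : ℕ) : ℝ) * (1 / ((n : ℝ) + 2) ^ 6) := by gcongr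
      _ ≤ (((n + 1) ^ 4 : ℕ) : ℝ) * (1 / ((n : ℝ) + 1) ^ 6) := by gcongr; norm_num
      _ = _ := by push_cast; field_simp
  have hnv := noiseVar_nonneg (ratio ε hε)
  have h1 : 0 < 1 - (ratio ε hε : ℝ) := by linarith [(ratio ε hε).2.2]
  have hC : 0 ≤ objectiveConst (ratio ε hε) := by rw [objectiveConst]; positivity
  have hsn : 1 ≤ √(n : ℝ) := Real.one_le_sqrt.2 hnr
  have hsl : 1 ≤ √(n : ℝ) * Λ := by nlinarith
  have hbound : 2 * (T : ℝ) ^ 3 * (4 * (objectiveConst (ratio ε hε) * (√n * Λ)) + 1) + 6 ≤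
      errorConst ε * (√(n : ℝ) * Λ ^ (4 : ℝ)) := by
    have e : Λ ^ (4 : ℝ) = Λ ^ 3 * Λ := by
      rw [← pow_succ]; exact_mod_cast Real.rpow_natCast Λ 4
    have h6 : 1 ≤ √(n : ℝ) * (Λ ^ 3 * Λ) := by
      have : (1 : ℝ) ≤ Λ ^ 3 * Λ := one_le_mul_of_one_le_of_one_le (one_le_pow₀ hlog) hlog
      nlinarith
    rw [e, errorConst, ← hq]
    calc _ ≤ 2 * ((24 / ε + 1) * Λ) ^ 3 *
          (4 * (objectiveConst (ratio ε hε) * (√n * Λ)) + √n * Λ) +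
            6 * (√(n : ℝ) * (Λ ^ 3 * Λ)) := by gcongr; linarith
      _ = _ := by ring
  intro z
  have main : ∀ err : AnonHist D → AnonHist D → ℝ, err = l1Error ∨ err = l2SqError →
      expect (tableLaw (pairPMF (uniformHash D ((n + 1) ^ 4)) (uniformHash D (16 * (n + 1))))
        hashLoc (ratio ε hε) (fun _ => estimator D (ratio ε hε) n T) z)
        (err (anonymize (histogram z))) ≤
      ENNReal.ofReal (errorConst ε * (√(n : ℝ) * Λ ^ (4 : ℝ))) := by
    intro err herr
    rw [tableLaw_hashLoc, expect_map]
    exact (expect_errors_le (ratio ε hε) hn hTpos le_rfl (by omega) le_rfl hqT (sum_histogram z)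
      herr).trans (ENNReal.ofReal_le_ofReal hbound)
  exact ⟨main _ (Or.inl rfl), main _ (Or.inr rfl)⟩

theorem exists_stream {ε : ℝ} (hε : 0 < ε) {n : ℕ} (hn : 1 ≤ n) (D : ℕ) :
    ∃ A : StreamAlgorithm (Fin D) (AnonHist D), A.IsPanPrivate ε ∧
      ErrorAtMost (n := n) (D := D) A.run
        (errorConst ε * (√(n : ℝ) * Real.log ((n : ℝ) + 2) ^ (4 : ℝ))) := by
  refine ⟨panAlgorithm
    (pairPMF (uniformHash D ((n + 1) ^ 4)) (uniformHash D (16 * (n + 1)))) hashLoc (ratio ε hε)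
    (fun _ => estimator D (ratio ε hε) n (threshold ε n)),
    isPanPrivate_panAlgorithm _ _ hε _, fun z => ?_⟩
  rw [run_panAlgorithm]
  exact errorAtMost_tableLaw hε hn D z

theorem exists_shuffle {ε δ : ℝ} (hε : 0 < ε) (hδ : 0 < δ) {n : ℕ} (hn : 1 ≤ n) (D : ℕ) :
    ∃ P : ShuffleProtocol (Fin D) (AnonHist D), P.IsShuffleDP n ε δ ∧
      ErrorAtMost (n := n) (D := D) P.run
        (errorConst ε * (√(n : ℝ) * Real.log ((n : ℝ) + 2) ^ (4 : ℝ))) := by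
  obtain ⟨P, hP, hrun⟩ := exists_shuffleProtocol
    (pairPMF (uniformHash D ((n + 1) ^ 4)) (uniformHash D (16 * (n + 1)))) hashLoc hε hδ
    (fun _ => estimator D (ratio ε hε) n (threshold ε n)) (Nat.one_le_iff_ne_zero.1 hn)
  refine ⟨P, hP, fun z => ?_⟩
  rw [hrun]
  exact errorAtMost_tableLaw hε hn D z

/-! ### Empty datasets -/

theorem eq_of_isEmpty_dataset (z : Fin 0 → Fin D) :
    anonymize (histogram z) = ⟨fun _ => 0, fun _ _ _ => le_rfl⟩ := by
  refine Subtype.ext (funext fun j => ?_)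
  simp [anonymize, histogram]

/-- On empty datasets the constant answer `0` has no error. -/
theorem errorAtMost_zero {M : (Fin 0 → Fin D) → PMF (AnonHist D)}
    (hM : ∀ z, M z = PMF.pure ⟨fun _ => 0, fun _ _ _ => le_rfl⟩) (b : ℝ) : ErrorAtMost M b := by
  intro z
  have h : ∀ f : AnonHist D → ℝ, f (anonymize (histogram z)) = 0 → expect (M z) f = 0 := by
    intro f hf
    rw [hM, ← eq_of_isEmpty_dataset z, expect, tsum_eq_single (anonymize (histogram z))]
    · simp [hf]
    · intro a ha
      rw [PMF.pure_apply_of_ne _ _ ha, zero_mul]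
  rw [h _ (by simp [l1Error]), h _ (by simp [l2SqError])]
  exact ⟨zero_le, zero_le⟩

theorem exists_stream_zero (D : ℕ) {ε : ℝ} (hε : 0 < ε) (b : ℝ) :
    ∃ A : StreamAlgorithm (Fin D) (AnonHist D), A.IsPanPrivate ε ∧
      ErrorAtMost (n := 0) (D := D) A.run b := by
  let A : StreamAlgorithm (Fin D) (AnonHist D) :=
    ⟨Unit, PMF.pure (), fun _ _ => PMF.pure (), fun _ => PMF.pure ⟨fun _ => 0, fun _ _ _ => le_rfl⟩⟩
  have hA : ∀ zs, A.stateAfter zs = PMF.pure () := fun zs => by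
    induction zs using List.reverseRecOn with
    | nil => rfl
    | append_singleton zs z ih =>
      rw [StreamAlgorithm.stateAfter, List.foldl_append, ← StreamAlgorithm.stateAfter, ih]
      exact PMF.bind_const _ _
  refine ⟨A, fun t => isDP_of_close fun S S' _ => ?_, errorAtMost_zero (fun z => ?_) b⟩
  · rw [hA, hA]
    refine (Close.of_le (C := ENNReal.ofReal (Real.exp ε)) fun a => ?_).mono le_rfl zero_le
    refine le_mul_of_one_le_left zero_le ?_
    rw [← ENNReal.ofReal_one]
    exact ENNReal.ofReal_le_ofReal (Real.one_le_exp hε.le)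
  · rw [StreamAlgorithm.run, hA]
    exact PMF.pure_bind _ _

theorem exists_shuffle_zero (D : ℕ) (ε δ b : ℝ) :
    ∃ P : ShuffleProtocol (Fin D) (AnonHist D), P.IsShuffleDP 0 ε δ ∧
      ErrorAtMost (n := 0) (D := D) P.run b := by
  refine ⟨⟨Unit, PMF.pure (), Unit, fun _ _ => PMF.pure 0,
    fun _ _ => PMF.pure ⟨fun _ => 0, fun _ _ _ => le_rfl⟩⟩, fun r S S' ⟨i, _⟩ => i.elim0,
    errorAtMost_zero (fun z => ?_) b⟩
  simp [ShuffleProtocol.run]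

end Estimator

end AnonymizedHistogram

end

theorem mainTheorem4 :
    ∃ c : ℝ, 0 < c ∧ ∃ g : ℝ → ℝ,
      ∀ ε : ℝ, 0 < ε → ∀ n D : ℕ,
        (∃ A : AnonymizedHistogram.StreamAlgorithm (Fin D) (AnonymizedHistogram.AnonHist D),
          A.IsPanPrivate ε ∧
          AnonymizedHistogram.ErrorAtMost (n := n) (D := D) A.run
            (g ε * (√(n : ℝ) * Real.log ((n : ℝ) + 2) ^ c))) ∧
        (∀ δ : ℝ, 0 < δ → δ ≤ 1 →
          ∃ P : AnonymizedHistogram.ShuffleProtocol (Fin D) (AnonymizedHistogram.AnonHist D),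
            P.IsShuffleDP n ε δ ∧
            AnonymizedHistogram.ErrorAtMost (n := n) (D := D) P.run
              (g ε * (√(n : ℝ) * Real.log ((n : ℝ) + 2) ^ c))) := by
  refine ⟨4, by norm_num, AnonymizedHistogram.errorConst, fun ε hε n D => ?_⟩
  rcases Nat.eq_zero_or_pos n with rfl | hn
  · exact ⟨AnonymizedHistogram.exists_stream_zero D hε _,
      fun δ _ _ => AnonymizedHistogram.exists_shuffle_zero D ε δ _⟩
  · exact ⟨AnonymizedHistogram.exists_stream hε hn D,
      fun δ hδ _ => AnonymizedHistogram.exists_shuffle hε hδ hn D⟩
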